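/- All digraphs are finite. A knot of a digraph $D$ is a strongly connected component $K$ of $D$ with at least two vertices such that no arc of $D$ leads from a vertex of $K$ to a vertex outside $K$; $D$ is knot-free if it has no knot. (Loops play no role for knots and are ignored below.) Algorithm $\mathrm{KFVD}(D,\varphi)$. The input is a digraph $D$ with potentials $\varphi:V(D)\to\{1,\tfrac14\}$; let $U=\{v:\varphi(v)=1\}$ be the set of undecided vertices. Write $N^+(v)$, $N^-(v)$ for the sets of out- and in-neighbours of $v$ in $D$ and $N(v)$ for their union; $R^-(v)$ for the set of vertices with a directed path to $v$ in $D-N^+(v)$; $R(v)=N^+(v)\cup R^-(v)$; $R^+(v)=\{u\in U: v\in R^-(u)\}$; $\psi(v)=\sum_{u\in R(v)}\varphi(u)+\tfrac34|R^+(v)\setminus R(v)|$; $\mathcal S_v=\{u\in N^+(v):N^-(u)\cap U=\{v\}\}$; $\mathcal C_v=\bigcup_{y\in N^+(v)}R^+(y)$. For a vertex $s$ and a set $T$, let $\mathrm{KFVD}(s,T)$ be the value returned by the recursive call on $D-R(s)$ with the potentials of the vertices in $R^+(s)\cup T$ lowered to $\tfrac14$, plus $|N^+(s)|$. The algorithm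 executes the first step that applies: 1. If some $x$ has $N^-(x)=\emptyset$, return $\mathrm{KFVD}(D-x,\varphi)$. 2. If some $x$ has $N^+(x)=\emptyset$, return $\mathrm{KFVD}(D-R(x),\varphi)$. 3. If $U=\emptyset$, return $|V(D)|$. 4. If some $x\in U$ has $\psi(x)\ge 3.75$, return the minimum of $\mathrm{KFVD}(x,\emptyset)$ and $\mathrm{KFVD}(D,\varphi')$, where $\varphi'$ is $\varphi$ with the potential of $x$ lowered to $\tfrac14$. 5. Otherwise pick $x\in U$ maximizing $|N(x)\cap U|$. - If $\mathcal S_x=\emptyset$, return the minimum of $\mathrm{KFVD}(x,\emptyset)$ and of $\mathrm{KFVD}(s,\emptyset)$ over all $s\in\mathcal C_x$. - If $\mathcal S_x\ne\emptyset$ and $N(x)\cap U\neq\emptyset$, pick $y\in\mathcal S_x$ and let $B=R^+(y)$; run through the elements $s$ of $R^+(y)$, and whenever $s$ is still in $B$ and $N^+(s)\subseteq N^+(t)$ for some $t\in B$, $t\ne s$, remove one such $t$ from $B$. With $B=\{s_1,\dots,s_r\}$, return the minimum of $\mathrm{KFVD}(x,\emptyset)$ and of $\mathrm{KFVD}(s_i,\{s_j:j<i\})$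 over $1\le i\le r$. - If $\mathcal S_x\ne\emptyset$ and $N(x)\cap U=\emptyset$, pick $y\in\mathcal S_x$ and, if $R^+(y)\neq\emptyset$, some $s\in R^+(y)$; return the minimum of $\mathrm{KFVD}(x,\emptyset)$ and (if $s$ exists) $\mathrm{KFVD}(s,\emptyset)$. All choices are resolved by taking the first suitable vertex in the order in which the vertices are stored. Theorem. There are constants $C$ and $k$ such that for every $n\ge 0$ and every digraph $D$ on $n$ vertices, Algorithm KFVD, started on $D$ with all potentials equal to $1$, terminates after at most $C(n+1)^k\cdot 1.4549^n$ elementary steps (adjacency queries, comparisons of vertices, list-cell visits, loop iterations, procedure calls, arithmetic on counters), that is, in time $\mathcal O^*(1.4549^n)$, and returns the minimum size of a set $S\subseteq V(D)$ such that $D-S$ is knot-free. -/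

import Mathlib

/-! ## Knots and knot-free vertex deletion -/

namespace Digraph

variable {V : Type}

/-- `G.Reach u v`: there is a directed path (possibly of length zero) from `u` to `v`. -/
def Reach (G : Digraph V) (u v : V) : Prop :=
  Relation.ReflTransGen G.Adj u v

/-- `K` is a strongly connected component: the class of some vertex under mutual reachability. -/
def IsStrongComponent (G : Digraph V) (K : Set V) : Prop :=
  ∃ v, K = {w | G.Reach v w ∧ G.Reach w v}

/-- A knot: a strongly connected component with at least two vertices and no arc leaving it. -/
def IsKnot (G : Digraph V) (K : Set V) : Prop :=
  G.IsStrongComponent K ∧ K.Nontrivial ∧ ∀ u ∈ K, ∀ v, G.Adj u v → v ∈ K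

def KnotFree (G : Digraph V) : Prop :=
  ∀ K : Set V, ¬ G.IsKnot K

/-- The digraph `G - S`, i.e. the subgraph induced on the complement of `S`. -/
def deleteVertices (G : Digraph V) (S : Finset V) : Digraph {v : V // v ∉ S} where
  Adj u v := G.Adj u v

/-- `S` is a knot-free vertex deletion set of `G`. -/
def IsKnotFreeDeletionSet (G : Digraph V) (S : Finset V) : Prop :=
  (G.deleteVertices S).KnotFree

end Digraph

namespace KFVD

/-! ## Programs with a step counter

A program is a state transformer on the number of elementary steps executed so far; the value
`none` stands for a computation that does not terminate.  One `tick` is charged for every adjacency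
query, every comparison of two vertices, every list cell that is visited, every iteration of a loop
and every recursive call, and it also pays for the bounded number of additions and comparisons of
counters and of list-cell constructions that go with it. -/

abbrev Prog (α : Type) : Type := StateT ℕ Option α

def tick : Prog Unit := modify (· + 1)

variable {V : Type}

/-! ### List procedures -/

def filterP (p : V → Prog Bool) : List V → Prog (List V)
  | [] => do
    tick
    return []
  | a :: l => do
    tick
    let b ← p a
    let r ← filterP p l
    return if b then a :: r else r

def findP (p : V → Prog Bool) : List V → Prog (Option V)
  | [] => do
    tick
    return none
  | a :: l => do
    tick
    let b ← p a
    if b then return some a else findP p l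

def anyP (p : V → Prog Bool) (l : List V) : Prog Bool := do
  let r ← findP p l
  return r.isSome

def allP (p : V → Prog Bool) (l : List V) : Prog Bool := do
  let r ← findP (fun a => do let b ← p a; return !b) l
  return r.isNone

def lengthP : List V → Prog ℕ
  | [] => do
    tick
    return 0
  | _ :: l => do
    tick
    let k ← lengthP l
    return k + 1

def appendP : List V → List V → Prog (List V)
  | [], l' => do
    tick
    return l'
  | a :: l, l' => do
    tick
    let r ← appendP l l'
    return a :: r

/-- The first element of `a :: l` at which `f` is maximal (`fa` is the value of `f` at `a`),
the earlier elements having been discarded. -/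
def argmaxFrom (f : V → Prog ℕ) (a : V) (fa : ℕ) : List V → Prog V
  | [] => do
    tick
    return a
  | b :: l => do
    tick
    let fb ← f b
    if fa < fb then argmaxFrom f b fb l else argmaxFrom f a fa l

section Vertices

variable [DecidableEq V]

def sameP (u v : V) : Prog Bool := do
  tick
  return decide (u = v)

def memP (v : V) (l : List V) : Prog Bool :=
  anyP (fun a => sameP v a) l

/-- The elements of `l` that are not in `l'`. -/
def diffP (l l' : List V) : Prog (List V) :=
  filterP (fun a => do let b ← memP a l'; return !b) l

/-- The elements of `l` that are in `l'`. -/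
def interP (l l' : List V) : Prog (List V) :=
  filterP (fun a => memP a l') l

end Vertices

/-! ### Instances

An instance `(D, φ)`: `D` is the subgraph of the input digraph induced on the listed vertices,
`und` lists the undecided vertices (`φ = 1`) and `semi` the semi-decided ones (`φ = 1/4`). -/

structure Inst (V : Type) where
  und : List V
  semi : List V

variable [DecidableEq V] (G : Digraph V) [DecidableRel G.Adj]

/-- Adjacency query.  Loops are ignored: they play no role for knots. -/
def arcP (u v : V) : Prog Bool := do
  tick
  return decide (u ≠ v ∧ G.Adj u v)

/-- `V(D)`. -/
def vertsP (I : Inst V) : Prog (List V) :=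
  appendP I.und I.semi

/-- `N⁺(v)`. -/
def outP (I : Inst V) (v : V) : Prog (List V) := do
  let vs ← vertsP I
  filterP (fun w => arcP G v w) vs

/-- `N⁻(v)`. -/
def inP (I : Inst V) (v : V) : Prog (List V) := do
  let vs ← vertsP I
  filterP (fun w => arcP G w v) vs

/-- `N(v) ∩ U`: the undecided in- and out-neighbours of `v`. -/
def undNbrsP (I : Inst V) (v : V) : Prog (List V) :=
  filterP (fun w => do
    let a ← arcP G v w
    if a then return true else arcP G w v) I.und

/-- `k` rounds of backward search inside `avail`, starting from the set `R`: in each round, keep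
the vertices of `avail` that are in the current set or have an arc into it. -/
def growP (avail : List V) : ℕ → List V → Prog (List V)
  | 0, R => do
    tick
    return R
  | k + 1, R => do
    tick
    let R' ← filterP (fun u => anyP (fun w => do
      let e ← sameP u w
      if e then return true else arcP G u w) R) avail
    growP avail k R'

/-- `R⁻(v)`: the vertices that reach `v` in `D - N⁺(v)`. -/
def inReachP (I : Inst V) (v : V) : Prog (List V) := do
  let vs ← vertsP I
  let out ← outP G I v
  let avail ← diffP vs out
  let k ← lengthP vs
  growP G avail k [v]

/-- `R(v) = N⁺(v) ∪ R⁻(v)`. -/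
def bigRP (I : Inst V) (v : V) : Prog (List V) := do
  let out ← outP G I v
  let rm ← inReachP G I v
  appendP out rm

/-- `R⁺(v)`: the undecided vertices `u` with `v ∈ R⁻(u)`. -/
def outReachP (I : Inst V) (v : V) : Prog (List V) :=
  filterP (fun u => do
    let rm ← inReachP G I u
    memP v rm) I.und

/-- Four times the drop function, `4 ψ(x) = 4 φ(R(x)) + 3 |R⁺(x) \ R(x)|`, where
`4 φ(R(x)) = 4 |R(x) ∩ U| + |R(x) \ U|`. -/
def dropP (I : Inst V) (x : V) : Prog ℕ := do
  let r ← bigRP G I x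
  let ru ← interP I.und r
  let rs ← interP I.semi r
  let rp ← outReachP G I x
  let rp' ← diffP rp r
  let a ← lengthP ru
  let b ← lengthP rs
  let c ← lengthP rp'
  tick
  return 4 * a + b + 3 * c

/-- The surviving set `S_x`: the `u ∈ N⁺(x)` whose only undecided in-neighbour is `x`. -/
def survivingP (I : Inst V) (x : V) : Prog (List V) := do
  let out ← outP G I x
  filterP (fun u => allP (fun w => do
    let e ← sameP w x
    if e then return true else
      let a ← arcP G w u
      return !a) I.und) out

/-- The candidate sink set `C_x`: the union of the sets `R⁺(y)`, `y ∈ N⁺(x)`. -/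
def candidatesP (I : Inst V) (x : V) : Prog (List V) := do
  let out ← outP G I x
  filterP (fun u => do
    let rm ← inReachP G I u
    anyP (fun y => memP y rm) out) I.und

/-- `D - X`, with the same potentials. -/
def deleteP (I : Inst V) (X : List V) : Prog (Inst V) := do
  let u ← diffP I.und X
  let s ← diffP I.semi X
  return ⟨u, s⟩

/-- Lower the potential of the vertices of `X` to `1/4`. -/
def lowerP (I : Inst V) (X : List V) : Prog (Inst V) := do
  let u ← diffP I.und X
  let m ← interP I.und X
  let s ← appendP m I.semi
  return ⟨u, s⟩

/-- `update(D, φ, s, NS)`, with the sink `s` provided: delete `R(s)`, and lower the potential of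
the vertices of `R⁺(s)` (taken in `D`) and of `NS`. -/
def updateSinkP (I : Inst V) (s : V) (NS : List V) : Prog (Inst V) := do
  let r ← bigRP G I s
  let rp ← outReachP G I s
  let I₁ ← deleteP I r
  let I₂ ← lowerP I₁ rp
  lowerP I₂ NS

/-- `update(D, φ, -, NS)`, with no sink provided. -/
def updateNonsinkP (I : Inst V) (NS : List V) : Prog (Inst V) :=
  lowerP I NS

/-- The loop that thins out `B_x`: run through the list, and for each `s` that is still in `B`
remove from `B` some `t ≠ s` with `N⁺(s) ⊆ N⁺(t)`, if there is one. -/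
def pruneP (I : Inst V) : List V → List V → Prog (List V)
  | [], B => do
    tick
    return B
  | s :: l, B => do
    tick
    let alive ← memP s B
    if alive then
      let os ← outP G I s
      let t ← findP (fun t => do
        let e ← sameP s t
        if e then return false else
          let ot ← outP G I t
          allP (fun w => memP w ot) os) B
      match t with
      | some t => do
        let B' ← diffP B [t]
        pruneP I l B'
      | none => pruneP I l B
    else pruneP I l B

/-- `|N⁺(s)|`. -/
def outDegP (I : Inst V) (s : V) : Prog ℕ := do
  let out ← outP G I s
  lengthP out

/-- Algorithm KFVD.  "Exists" and "pick" are resolved by the first suitable vertex in the order of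
the lists. -/
def kfvd (I : Inst V) : Prog ℕ := do
  tick
  let vs ← vertsP I
  -- a source: delete it
  let src ← findP (fun v => do let l ← inP G I v; return l.isEmpty) vs
  match src with
  | some x => do
    let I' ← deleteP I [x]
    kfvd I'
  | none => do
  -- a sink: delete `R(x)`
  let snk ← findP (fun v => do let l ← outP G I v; return l.isEmpty) vs
  match snk with
  | some x => do
    let r ← bigRP G I x
    let I' ← deleteP I r
    kfvd I'
  | none => do
  match I.und with
  -- no undecided vertex is left
  | [] => lengthP vs
  | x₀ :: und' => do
  -- Subroutine 1: some undecided `x` has `ψ(x) ≥ 3.75`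
  let big ← findP (fun v => do let k ← dropP G I v; tick; return decide (15 ≤ k)) I.und
  match big with
  | some x => do
    let I₁ ← updateSinkP G I x []
    let I₂ ← updateNonsinkP I [x]
    let d ← outDegP G I x
    let a ← kfvd I₁
    let b ← kfvd I₂
    tick
    return min (a + d) b
  | none => do
  -- pick `x` maximizing `|N(x) ∩ U|`
  let nb := fun v => do let l ← undNbrsP G I v; lengthP l
  let n₀ ← nb x₀
  let x ← argmaxFrom nb x₀ n₀ und'
  let Ix ← updateSinkP G I x []
  let dx ← outDegP G I x
  let ax ← kfvd Ix
  tick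
  let surv ← survivingP G I x
  match surv with
  | [] => do
    -- Subroutine 2: branch on `x` and on every candidate sink
    let C ← candidatesP G I x
    C.foldlM (fun m s => do
      tick
      let Is ← updateSinkP G I s []
      let d ← outDegP G I s
      let a ← kfvd Is
      return min m (a + d)) (ax + dx)
  | y :: _ => do
    let B₀ ← outReachP G I y
    let n ← nb x
    if 1 ≤ n then do
      -- Subroutine 3: branch on `x` and on the first vertex of `B_x` that becomes a sink
      let B ← pruneP G I B₀ B₀
      let res ← B.foldlM (fun (m : ℕ × List V) s => do
        tick
        let Is ← updateSinkP G I s m.2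
        let d ← outDegP G I s
        let a ← kfvd Is
        return (min m.1 (a + d), s :: m.2)) (ax + dx, [])
      return res.1
    else
      -- Subroutine 4: branch on `x` and on one vertex of `R⁺(y)`
      match B₀ with
      | [] => return ax + dx
      | s :: _ => do
        let Is ← updateSinkP G I s []
        let d ← outDegP G I s
        let a ← kfvd Is
        tick
        return min (ax + dx) (a + d)
  partial_fixpoint

/-- Algorithm KFVD on a digraph with vertex set `{0, …, n-1}`: all potentials are `1` initially. -/
def solve {n : ℕ} (G : Digraph (Fin n)) [DecidableRel G.Adj] : Prog ℕ :=
  kfvd G ⟨List.finRange n, []⟩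

end KFVD

namespace KFVD

variable {V : Type}

/-! ## Reachability, sinks and solutions inside a vertex set -/

/-! In a finite digraph every vertex reaches a terminal strong component, which is either a knot or,
loops aside, a single sink. So `D - S` is knot-free exactly when each of its vertices reaches a sink
(`Sol`, `isKnotFreeDeletionSet_iff`), and the task is to guess the sinks. If `s` is a sink of `W -
S` for a minimum `S`, then `N⁺(s) ⊆ S`, all of `R⁻(s)` survives because restoring a vertex that can
still reach a sink would save a deletion, and no other vertex of `R⁺(s)` is a sink. Hence `R(s)` can
be cut off at the price `|N⁺(s)|` and `R⁺(s)` can be lowered; `Sol.lift` and `Compatible.restrict`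
are the two directions of this exchange.

Correctness rests on a one-sided invariant, `Answers`. Whatever was lowered, the returned value is
attained by some solution; it is optimal as soon as some minimum solution has all its new sinks
among the undecided vertices (`Compatible`). In every branching rule, some branch preserves the
compatibility of any given compatible solution. If `x` is not a sink, some candidate is
(`exists_candidate`); if some `y` has `x` as its only undecided in-neighbour, then `y` survives and
a sink lies in `R⁺(y)` (`exists_sink_of_surviving`); dominated members of `R⁺(y)` may be dropped;
and if the undecided vertices are independent, all of `R⁺(y)` become sinks, so one representative is
enough (`Compatible.isSink_of_independent`).

For the running time, write `I(v)` for `interacting`. Making a non-free `s` a sink lowers four times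
the total potential by `3|I(s)| + |R(s)| = 4ψ(s)`. The measure ignores free vertices, those that
interact with nothing else and have a small `R(v)`: they never cause a branching, and each vertex
that becomes free yields a bonus of `4`. Once the first branching rule fails, `3|I(v)| + |R(v)| ≤
14` for all undecided `v`; this leaves so few configurations that each rule has at most four
branches, whose decreases are counted by hand in the `branch_...` lemmas.

With `ρ` the plastic number (`ρ³ = ρ + 1`), the cube root of `ρ` is the exact root for the decreases
`(15, 3)` of the first rule and also for `(12, 9, 15)`; `base` is this root rounded up. The measure
is at most `4n` at the start and `base ^ 4 ≤ 1.4549`. Reductions need not lower the measure, so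
`solvedBelow` is an induction on the total weight, which falls in every call and enters the time
bound only as a linear factor. -/

/-- Arcs of the loopless digraph underlying `G`. -/
def Arc (G : Digraph V) (u v : V) : Prop :=
  u ≠ v ∧ G.Adj u v

/-- `Reaches G X z u`: there is a directed path from `u` to `z` inside `X`. -/
inductive Reaches (G : Digraph V) (X : Finset V) (z : V) : V → Prop
  | refl : z ∈ X → Reaches G X z z
  | step {u w : V} : u ∈ X → Arc G u w → Reaches G X z w → Reaches G X z u

/-- `z` is a sink of the subgraph induced on `X`. -/
def IsSink (G : Digraph V) (X : Finset V) (z : V) : Prop :=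
  z ∈ X ∧ ∀ w ∈ X, ¬ Arc G z w

variable {G : Digraph V}

theorem Arc.ne {u v : V} (h : Arc G u v) : u ≠ v := h.1

theorem not_arc_self (u : V) : ¬ Arc G u u := fun h => h.1 rfl

namespace Reaches

variable {X Y : Finset V} {u v w z : V}

theorem mem_left (h : Reaches G X z u) : u ∈ X := by
  cases h <;> assumption

theorem mem_right (h : Reaches G X z u) : z ∈ X := by
  induction h <;> assumption

theorem mono (hXY : X ⊆ Y) (h : Reaches G X z u) : Reaches G Y z u := by
  induction h with
  | refl h => exact .refl (hXY h)
  | step h a _ ih => exact .step (hXY h) a ih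

theorem trans (h : Reaches G X w u) (h' : Reaches G X z w) : Reaches G X z u := by
  induction h with
  | refl h => exact h'
  | step h a _ ih => exact .step h a ih

theorem eq_of_isSink (h : Reaches G X z u) (hu : IsSink G X u) : u = z := by
  cases h with
  | refl h => rfl
  | step h a h' => exact absurd a (hu.2 _ h'.mem_left)

/-- A path that stays in `Y` as long as it starts there. -/
theorem restrict (h : Reaches G X z u) (hu : u ∈ Y)
    (hY : ∀ p q, p ∈ Y → q ∈ X → Arc G p q → q ∈ Y) : Reaches G Y z u := by
  induction h with
  | refl h => exact .refl hu
  | step h a h' ih => exact .step hu a (ih (hY _ _ hu h'.mem_left a))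

/-- A path from inside `P` to a vertex outside `P` leaves `P` through some arc. -/
theorem exists_exit {P : V → Prop} (h : Reaches G X z u) (hu : P u) (hz : ¬ P z) :
    ∃ p q, P p ∧ ¬ P q ∧ p ∈ X ∧ Arc G p q ∧ Reaches G X z q := by
  induction h with
  | refl h => exact absurd hu hz
  | @step u w h a h' ih =>
    by_cases hw : P w
    · exact ih hw
    · exact ⟨u, w, hu, hw, h, a, h'⟩

end Reaches

open scoped Classical in
/-- `N⁺(v)` in the subgraph induced on `W`. -/
noncomputable def outs (G : Digraph V) (W : Finset V) (v : V) : Finset V :=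
  W.filter (fun w => Arc G v w)

theorem mem_outs {W : Finset V} {v w : V} : w ∈ outs G W v ↔ w ∈ W ∧ Arc G v w := by
  simp [outs]

theorem outs_subset {W : Finset V} {v : V} : outs G W v ⊆ W := fun _ h => (mem_outs.1 h).1

variable [DecidableEq V]

/-- `InReach G W v u`: `u ∈ R⁻(v)` in the subgraph induced on `W`. -/
def InReach (G : Digraph V) (W : Finset V) (v u : V) : Prop :=
  Reaches G (W \ outs G W v) v u

open scoped Classical in
/-- `R(v)` in the subgraph induced on `W`. -/
noncomputable def bigR (G : Digraph V) (W : Finset V) (v : V) : Finset V :=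
  W.filter (fun u => Arc G v u ∨ InReach G W v u)

/-- `S` is a knot-free vertex deletion set of the subgraph induced on `W`. -/
def Sol (G : Digraph V) (W S : Finset V) : Prop :=
  S ⊆ W ∧ ∀ u ∈ W \ S, ∃ z, IsSink G (W \ S) z ∧ Reaches G (W \ S) z u

/-- `S` is a solution of minimum size. -/
def MinSol (G : Digraph V) (W S : Finset V) : Prop :=
  Sol G W S ∧ ∀ S', Sol G W S' → S.card ≤ S'.card

variable {W W' S S' U : Finset V} {p q s t u v w x y z : V}

theorem mem_bigR : u ∈ bigR G W v ↔ u ∈ W ∧ (Arc G v u ∨ InReach G W v u) := by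
  simp [bigR]

namespace InReach

theorem mem (h : InReach G W v u) : u ∈ W := (Finset.mem_sdiff.1 (Reaches.mem_left h)).1

theorem not_arc (h : InReach G W v u) : ¬ Arc G v u := fun a =>
  (Finset.mem_sdiff.1 (Reaches.mem_left h)).2 (mem_outs.2 ⟨h.mem, a⟩)

theorem self (h : v ∈ W) : InReach G W v v :=
  .refl (by simp [mem_outs, h, not_arc_self])

theorem mem_bigR (h : InReach G W v u) : u ∈ bigR G W v := KFVD.mem_bigR.2 ⟨h.mem, .inr h⟩

theorem step (hu : u ∈ W) (hn : ¬ Arc G v u) (a : Arc G u w) (h : InReach G W v w) :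
    InReach G W v u :=
  Reaches.step (by simp [mem_outs, hu, hn]) a h

/-- An in-neighbour of a vertex of `R⁻(v)` is in `R(v)`. -/
theorem pred_mem_bigR (hu : u ∈ W) (a : Arc G u w) (h : InReach G W v w) : u ∈ bigR G W v := by
  by_cases hn : Arc G v u
  · exact KFVD.mem_bigR.2 ⟨hu, .inl hn⟩
  · exact (h.step hu hn a).mem_bigR

theorem mono (hW : W' ⊆ W) (h : InReach G W' v u) : InReach G W v u := by
  refine Reaches.mono (fun q hq => ?_) h
  simp only [Finset.mem_sdiff, mem_outs, not_and] at hq ⊢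
  exact ⟨hW hq.1, fun _ => hq.2 hq.1⟩

/-- Induction along the paths towards `v` in `W - N⁺(v)`. -/
theorem induction_on {P : V → Prop} (h : InReach G W v u) (base : P v)
    (step : ∀ u w, u ∈ W → ¬ Arc G v u → Arc G u w → InReach G W v w → P w → P u) : P u := by
  unfold InReach at h
  induction h with
  | refl h => exact base
  | step h a h' ih =>
    simp only [Finset.mem_sdiff, mem_outs, not_and] at h
    exact step _ _ h.1 (h.2 h.1) a h' ih

end InReach

theorem bigR_subset : bigR G W v ⊆ W := fun _ h => (mem_bigR.1 h).1

theorem outs_subset_bigR : outs G W v ⊆ bigR G W v := fun _ h =>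
  mem_bigR.2 ⟨(mem_outs.1 h).1, .inl (mem_outs.1 h).2⟩

theorem self_mem_bigR (h : v ∈ W) : v ∈ bigR G W v := (InReach.self h).mem_bigR

theorem bigR_mono (hW : W' ⊆ W) : bigR G W' v ⊆ bigR G W v := fun u hu => by
  rw [mem_bigR] at hu ⊢
  exact ⟨hW hu.1, hu.2.imp id (InReach.mono hW)⟩

theorem pred_mem_bigR (hv : v ∈ W) (hu : u ∈ W) (a : Arc G u v) : u ∈ bigR G W v :=
  (InReach.self hv).pred_mem_bigR hu a

/-- A path to a sink `z` of `W - S` avoids `N⁺(z)`. -/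
theorem Reaches.inReach (h : Reaches G (W \ S) z u) (hz : IsSink G (W \ S) z) :
    InReach G W z u := by
  refine Reaches.mono (fun q hq => ?_) h
  have := hz.2 q hq
  simp only [Finset.mem_sdiff, mem_outs, not_and] at hq ⊢
  exact ⟨hq.1, fun _ => this⟩

/-! ## Structure of minimum solutions -/

theorem mem_sdiff_erase (hp : p ∈ W) : q ∈ W \ S.erase p ↔ q = p ∨ q ∈ W \ S := by
  simp only [Finset.mem_sdiff, Finset.mem_erase, not_and]
  by_cases h : q = p
  · subst h; simp [hp]
  · simp [h]

theorem sdiff_subset_sdiff_erase : W \ S ⊆ W \ S.erase p :=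
  Finset.sdiff_subset_sdiff le_rfl (Finset.erase_subset _ _)

theorem IsSink.sdiff_erase (hp : p ∈ W) (hz : IsSink G (W \ S) z) (hzp : ¬ Arc G z p) :
    IsSink G (W \ S.erase p) z := by
  refine ⟨sdiff_subset_sdiff_erase hz.1, fun w hw => ?_⟩
  rcases (mem_sdiff_erase hp).1 hw with rfl | hw
  · exact hzp
  · exact hz.2 w hw

/-- A deleted vertex that would reach a sink need not be deleted. -/
theorem Sol.erase (h : Sol G W S) (hp : p ∈ S) (hz : IsSink G (W \ S.erase p) z)
    (hpz : Reaches G (W \ S.erase p) z p) : Sol G W (S.erase p) := by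
  have hpW := h.1 hp
  refine ⟨(Finset.erase_subset _ _).trans h.1, fun u hu => ?_⟩
  rcases (mem_sdiff_erase hpW).1 hu with rfl | hu
  · exact ⟨z, hz, hpz⟩
  · obtain ⟨z', hz', hr⟩ := h.2 u hu
    have hr' := hr.mono (sdiff_subset_sdiff_erase (p := p))
    by_cases a : Arc G z' p
    · exact ⟨z, hz, hr'.trans (.step (sdiff_subset_sdiff_erase hz'.1) a hpz)⟩
    · exact ⟨z', hz'.sdiff_erase hpW a, hr'⟩

/-- The form in which minimality is used throughout: to show that a vertex survives, restore it and
exhibit a path to a vertex that is still a sink. -/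
theorem MinSol.not_reaches (h : MinSol G W S) (hp : p ∈ S) (hz : IsSink G (W \ S.erase p) z) :
    ¬ Reaches G (W \ S.erase p) z p := fun hpz => by
  have := h.2 _ (h.1.erase hp hz hpz)
  have := Finset.card_erase_lt_of_mem hp
  omega

/-- A deleted vertex has an out-neighbour that is not deleted. -/
theorem MinSol.exists_out (h : MinSol G W S) (hp : p ∈ S) : ∃ w ∈ W \ S, Arc G p w := by
  by_contra! hn
  have hpW := h.1.1 hp
  have hpm : p ∈ W \ S.erase p := (mem_sdiff_erase hpW).2 (.inl rfl)
  refine h.not_reaches hp (z := p) ⟨hpm, fun w hw => ?_⟩ (.refl hpm)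
  rcases (mem_sdiff_erase hpW).1 hw with rfl | hw
  · exact not_arc_self _
  · exact hn w hw

/-- The vertices of `R⁻(u)` of a sink `u` are not deleted. -/
theorem MinSol.reaches_of_inReach (h : MinSol G W S) (hu : IsSink G (W \ S) u)
    (hs : InReach G W u s) : Reaches G (W \ S) u s := by
  refine hs.induction_on (.refl hu.1) fun v w hv hn a _ hw => ?_
  have hvS : v ∉ S := fun hvS => by
    refine h.not_reaches hvS (hu.sdiff_erase hv hn) (.step ?_ a
      (hw.mono sdiff_subset_sdiff_erase))
    exact (mem_sdiff_erase hv).2 (.inl rfl)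
  exact .step (Finset.mem_sdiff.2 ⟨hv, hvS⟩) a hw

/-- All of `R⁻(u)` survives and reaches `u`, while a sink reaches only itself. This is why `R⁺(s)`
may be lowered once `s` is made a sink. -/
theorem MinSol.sink_eq (h : MinSol G W S) (hs : IsSink G (W \ S) s) (hu : IsSink G (W \ S) u)
    (hsu : InReach G W u s) : s = u :=
  (h.reaches_of_inReach hu hsu).eq_of_isSink hs

/-- A vertex with no out-neighbour outside the solution is itself outside, hence a sink. -/
theorem MinSol.isSink_of_outs_subset (h : MinSol G W S) (hs : s ∈ W) (ho : outs G W s ⊆ S) :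
    IsSink G (W \ S) s := by
  have key : ∀ w ∈ W \ S, ¬ Arc G s w := fun w hw a =>
    (Finset.mem_sdiff.1 hw).2 (ho (mem_outs.2 ⟨(Finset.mem_sdiff.1 hw).1, a⟩))
  refine ⟨Finset.mem_sdiff.2 ⟨hs, fun hsS => ?_⟩, key⟩
  obtain ⟨w, hw, a⟩ := h.exists_out hsS
  exact key w hw a

theorem IsSink.outs_subset (h : IsSink G (W \ S) s) : outs G W s ⊆ S := fun w hw => by
  by_contra hn
  exact h.2 w (Finset.mem_sdiff.2 ⟨(mem_outs.1 hw).1, hn⟩) (mem_outs.1 hw).2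

theorem MinSol.isSink_of_isSink (h : MinSol G W S) (hs : IsSink G W s) : IsSink G (W \ S) s :=
  h.isSink_of_outs_subset hs.1 fun w hw => absurd (mem_outs.1 hw).2 (hs.2 w (mem_outs.1 hw).1)

/-- The solution contains `N⁺(t)`, hence `N⁺(s)`. This justifies dropping `t` from the list of
branches in favour of `s`. -/
theorem MinSol.isSink_of_outs_subset_outs (h : MinSol G W S) (ht : IsSink G (W \ S) t)
    (hs : s ∈ W) (hst : outs G W s ⊆ outs G W t) : IsSink G (W \ S) s :=
  h.isSink_of_outs_subset hs (hst.trans ht.outs_subset)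

/-! ## Making a vertex a sink -/

/-- A solution of `W - R(s)` together with `N⁺(s)` solves `W`. -/
theorem Sol.lift (hs : s ∈ W) (h : Sol G (W \ bigR G W s) S') :
    Sol G W (S' ∪ outs G W s) := by
  have hS' : ∀ q ∈ S', q ∉ bigR G W s := fun q hq => (Finset.mem_sdiff.1 (h.1 hq)).2
  set Y := W \ (S' ∪ outs G W s) with hY
  have hsub : (W \ bigR G W s) \ S' ⊆ Y := fun q hq => by
    simp only [hY, Finset.mem_sdiff, Finset.mem_union, not_or] at hq ⊢
    exact ⟨hq.1.1, hq.2, fun ho => hq.1.2 (outs_subset_bigR ho)⟩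
  have hin : ∀ q, InReach G W s q → q ∈ Y := fun q hq => by
    simp only [hY, Finset.mem_sdiff, Finset.mem_union, not_or, mem_outs, not_and]
    exact ⟨hq.mem, fun hS => hS' q hS hq.mem_bigR, fun _ => hq.not_arc⟩
  have hreach : ∀ q, InReach G W s q → Reaches G Y s q := fun q hq =>
    hq.induction_on (.refl (hin s (.self hs))) fun u w hu hn a hw ih =>
      .step (hin u (hw.step hu hn a)) a ih
  have hsink : IsSink G Y s := by
    refine ⟨hin s (.self hs), fun w hw a => ?_⟩
    simp only [hY, Finset.mem_sdiff, Finset.mem_union, not_or, mem_outs, not_and] at hw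
    exact hw.2.2 hw.1 a
  refine ⟨Finset.union_subset (h.1.trans Finset.sdiff_subset) KFVD.outs_subset, fun u hu => ?_⟩
  by_cases hus : InReach G W s u
  · exact ⟨s, hsink, hreach u hus⟩
  · have hu' := hu
    simp only [Finset.mem_sdiff, Finset.mem_union, not_or, mem_outs, not_and] at hu'
    have humem : u ∈ (W \ bigR G W s) \ S' := by
      simp only [Finset.mem_sdiff, mem_bigR, not_and, not_or]
      exact ⟨⟨hu'.1, fun _ => ⟨hu'.2.2 hu'.1, hus⟩⟩, hu'.2.1⟩
    obtain ⟨z, hz, hr⟩ := h.2 u humem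
    have hr' := hr.mono hsub
    -- A sink `z` of the smaller digraph may have arcs into `R(s)`. What is left of `R(s)` lies in
    -- `R⁻(s)`, so the path through `z` can be prolonged to `s`.
    by_cases hzn : ∃ w ∈ Y, Arc G z w
    · obtain ⟨w, hw, a⟩ := hzn
      have hwR : w ∈ bigR G W s := by
        by_contra hwR
        refine hz.2 w ?_ a
        simp only [hY, Finset.mem_sdiff, Finset.mem_union, not_or] at hw ⊢
        exact ⟨⟨hw.1, hwR⟩, hw.2.1⟩
      have hwI : InReach G W s w := by
        rcases mem_bigR.1 hwR with ⟨_, ha | hi⟩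
        · exact absurd ha (hsink.2 w hw)
        · exact hi
      exact ⟨s, hsink, hr'.trans (.step (hsub hz.1) a (hreach w hwI))⟩
    · push Not at hzn
      exact ⟨z, ⟨hsub hz.1, hzn⟩, hr'⟩

theorem Sol.disjoint_outs (h : Sol G (W \ bigR G W s) S') : Disjoint S' (outs G W s) := by
  rw [Finset.disjoint_left]
  exact fun q hq ho => (Finset.mem_sdiff.1 (h.1 hq)).2 (outs_subset_bigR ho)

theorem Sol.card_lift (h : Sol G (W \ bigR G W s) S') :
    (S' ∪ outs G W s).card = S'.card + (outs G W s).card :=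
  Finset.card_union_of_disjoint h.disjoint_outs

theorem notMem_bigR_of_arc (hu : u ∈ W) (huR : u ∉ bigR G W s) (a : Arc G u w) :
    ¬ InReach G W s w := fun hw => huR (hw.pred_mem_bigR hu a)

/-- If `s` is a sink of `W - S`, the sinks of the rest of `W - R(s)` are sinks of `W - S`. -/
theorem IsSink.of_sdiff_bigR (hs : IsSink G (W \ S) s)
    (hz : IsSink G ((W \ bigR G W s) \ (S \ bigR G W s)) z) :
    IsSink G (W \ S) z ∧ z ∉ bigR G W s := by
  have hz1 := hz.1
  simp only [Finset.mem_sdiff, not_and, not_not] at hz1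
  have hzS : z ∉ S := fun h => hz1.1.2 (hz1.2 h)
  refine ⟨⟨Finset.mem_sdiff.2 ⟨hz1.1.1, hzS⟩, fun w hw a => ?_⟩, hz1.1.2⟩
  have hw' := Finset.mem_sdiff.1 hw
  by_cases hwR : w ∈ bigR G W s
  · rcases mem_bigR.1 hwR with ⟨_, ha | hi⟩
    · exact hs.2 w hw ha
    · exact notMem_bigR_of_arc hz1.1.1 hz1.1.2 a hi
  · exact hz.2 w (by simp [hw'.1, hw'.2, hwR]) a

/-- A solution that makes `s` a sink restricts to `W - R(s)`. -/
theorem Sol.restrict (h : Sol G W S) (hs : IsSink G (W \ S) s) :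
    Sol G (W \ bigR G W s) (S \ bigR G W s) := by
  refine ⟨Finset.sdiff_subset_sdiff h.1 le_rfl, fun u hu => ?_⟩
  have hu' := hu
  simp only [Finset.mem_sdiff, not_and, not_not] at hu'
  have huS : u ∈ W \ S := Finset.mem_sdiff.2 ⟨hu'.1.1, fun h => hu'.1.2 (hu'.2 h)⟩
  obtain ⟨z, hz, hr⟩ := h.2 u huS
  have hclosed : ∀ p q, p ∈ (W \ bigR G W s) \ (S \ bigR G W s) → q ∈ W \ S → Arc G p q →
      q ∈ (W \ bigR G W s) \ (S \ bigR G W s) := fun p q hp hq a => by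
    have hp' := hp
    have hq' := Finset.mem_sdiff.1 hq
    simp only [Finset.mem_sdiff] at hp'
    have hqR : q ∉ bigR G W s := fun hqR => by
      rcases mem_bigR.1 hqR with ⟨_, ha | hi⟩
      · exact hs.2 q hq ha
      · exact notMem_bigR_of_arc hp'.1.1 hp'.1.2 a hi
    simp [hq'.1, hq'.2, hqR]
  have hr' := hr.restrict hu hclosed
  refine ⟨z, ⟨hr'.mem_right, fun w hw a => ?_⟩, hr'⟩
  have hw' := hw
  simp only [Finset.mem_sdiff, not_and, not_not] at hw'
  exact hz.2 w (Finset.mem_sdiff.2 ⟨hw'.1.1, fun h => hw'.1.2 (hw'.2 h)⟩) a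

/-- `N⁺(s)` is contained both in `S` and in `R(s)`, so it is lost when `R(s)` is removed from `S`.
-/
theorem IsSink.card_restrict (hs : IsSink G (W \ S) s) :
    (S \ bigR G W s).card + (outs G W s).card ≤ S.card := by
  rw [← Finset.card_union_of_disjoint]
  · exact Finset.card_le_card (Finset.union_subset Finset.sdiff_subset hs.outs_subset)
  · rw [Finset.disjoint_left]
    exact fun q hq ho => (Finset.mem_sdiff.1 hq).2 (outs_subset_bigR ho)

/-- Exchange: a smaller solution of the rest, together with `N⁺(s)`, would beat `S`, which pays for
`N⁺(s)` as well. -/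
theorem MinSol.restrict (h : MinSol G W S) (hs : IsSink G (W \ S) s) :
    MinSol G (W \ bigR G W s) (S \ bigR G W s) := by
  refine ⟨h.1.restrict hs, fun S' hS' => ?_⟩
  have h1 := h.2 _ (hS'.lift (Finset.mem_sdiff.1 hs.1).1)
  rw [hS'.card_lift] at h1
  have h2 := hs.card_restrict
  omega

/-! ## Solutions compatible with the undecided set -/

/-- `S` is a minimum solution whose sinks are undecided or sinks already. -/
def Compatible (G : Digraph V) (W U S : Finset V) : Prop :=
  MinSol G W S ∧ ∀ z, IsSink G (W \ S) z → z ∈ U ∨ IsSink G W z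

/-- A sink `z` of the rest is a sink of `W - S` outside `R(s)`. It cannot have `s ∈ R⁻(z)`, for then
`z = s`. So `U'` need not contain any vertex of `R(s)` or of `R⁺(s)`. -/
theorem Compatible.restrict {U' : Finset V} (h : Compatible G W U S) (hs : IsSink G (W \ S) s)
    (hU' : ∀ z ∈ U, IsSink G (W \ S) z → z ∉ bigR G W s → ¬ InReach G W z s → z ∈ U') :
    Compatible G (W \ bigR G W s) U' (S \ bigR G W s) := by
  refine ⟨h.1.restrict hs, fun z hz => ?_⟩
  obtain ⟨hz1, hz2⟩ := hs.of_sdiff_bigR hz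
  rcases h.2 z hz1 with hU | hW
  · refine .inl (hU' z hU hz1 hz2 fun hi => ?_)
    have := h.1.sink_eq hs hz1 hi
    subst this
    exact hz2 (self_mem_bigR hi.mem)
  · exact .inr ⟨Finset.mem_sdiff.2 ⟨hW.1, hz2⟩, fun w hw => hW.2 w (Finset.mem_sdiff.1 hw).1⟩

theorem Compatible.erase (h : Compatible G W U S) (hx : ¬ IsSink G (W \ S) x) :
    Compatible G W (U.erase x) S :=
  ⟨h.1, fun z hz => (h.2 z hz).imp
    (fun hU => Finset.mem_erase.2 ⟨fun e => hx (e ▸ hz), hU⟩) id⟩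

/-- No arc enters `x`, so its return destroys no sink; `x` itself either is a sink or has an arc to
a vertex that already reaches one. -/
theorem Sol.insert_source (hx : ∀ w ∈ W, ¬ Arc G w x) (h : Sol G (W.erase x) S) : Sol G W S := by
  have hxS : x ∉ S := fun hxS => by simpa using h.1 hxS
  have hsub : W.erase x \ S ⊆ W \ S := Finset.sdiff_subset_sdiff (Finset.erase_subset _ _) le_rfl
  have hsink : ∀ z, IsSink G (W.erase x \ S) z → IsSink G (W \ S) z := fun z hz => by
    refine ⟨hsub hz.1, fun w hw a => ?_⟩
    by_cases hwx : w = x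
    · subst hwx
      exact hx z (Finset.mem_sdiff.1 (hsub hz.1)).1 a
    · exact hz.2 w (by simpa [hwx] using hw) a
  have main : ∀ u ∈ W.erase x \ S, ∃ z, IsSink G (W \ S) z ∧ Reaches G (W \ S) z u :=
    fun u hu => by
      obtain ⟨z, hz, hr⟩ := h.2 u hu
      exact ⟨z, hsink z hz, hr.mono hsub⟩
  refine ⟨h.1.trans (Finset.erase_subset _ _), fun u hu => ?_⟩
  by_cases hux : u = x
  · subst hux
    by_cases hn : ∃ w ∈ W \ S, Arc G u w
    · obtain ⟨w, hw, a⟩ := hn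
      obtain ⟨z, hz, hr⟩ := main w (by simpa [a.ne.symm] using hw)
      exact ⟨z, hz, .step hu a hr⟩
    · push Not at hn
      exact ⟨u, ⟨hu, hn⟩, .refl hu⟩
  · exact main u (by simpa [hux] using hu)

/-- Paths from other vertices never visit a source. Solutions of the smaller digraph solve the
larger one unchanged, so erasing `x` keeps minimality whether or not `x ∈ S`. -/
theorem Compatible.erase_source (hxW : x ∈ W) (hx : ∀ w ∈ W, ¬ Arc G w x)
    (h : Compatible G W U S) : Compatible G (W.erase x) (U.erase x) (S.erase x) := by
  have heq : W.erase x \ S.erase x = (W \ S).erase x := by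
    ext q; simp only [Finset.mem_sdiff, Finset.mem_erase]; tauto
  have hsink : ∀ z, IsSink G (W.erase x \ S.erase x) z → z ≠ x ∧ IsSink G (W \ S) z :=
    fun z hz => by
      rw [heq] at hz
      have hz1 := Finset.mem_erase.1 hz.1
      refine ⟨hz1.1, hz1.2, fun w hw a => ?_⟩
      by_cases hwx : w = x
      · subst hwx
        exact hx z (Finset.mem_sdiff.1 hz1.2).1 a
      · exact hz.2 w (Finset.mem_erase.2 ⟨hwx, hw⟩) a
  refine ⟨⟨⟨Finset.erase_subset_erase _ h.1.1.1, fun u hu => ?_⟩, fun S' hS' => ?_⟩,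
    fun z hz => ?_⟩
  · rw [heq] at hu ⊢
    obtain ⟨z, hz, hr⟩ := h.1.1.2 u (Finset.mem_erase.1 hu).2
    have hr' := hr.restrict hu fun p q hp hq a => Finset.mem_erase.2 ⟨fun e => by
      subst e
      exact hx p (Finset.mem_sdiff.1 (Finset.mem_erase.1 hp).2).1 a, hq⟩
    exact ⟨z, ⟨hr'.mem_right, fun w hw => hz.2 w (Finset.mem_erase.1 hw).2⟩, hr'⟩
  · exact (Finset.card_le_card (Finset.erase_subset _ _)).trans (h.1.2 _ (hS'.insert_source hx))
  · obtain ⟨hne, hz'⟩ := hsink z hz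
    refine (h.2 z hz').imp (fun hU => Finset.mem_erase.2 ⟨hne, hU⟩) fun hW => ?_
    exact ⟨Finset.mem_erase.2 ⟨hne, hW.1⟩, fun w hw => hW.2 w (Finset.mem_erase.1 hw).2⟩

/-! ## Which vertices become sinks -/

theorem Compatible.mem_of_isSink (h : Compatible G W U S) (hW : ∀ x ∈ W, ¬ IsSink G W x)
    (hz : IsSink G (W \ S) z) : z ∈ U :=
  (h.2 z hz).resolve_right fun h' => hW z h'.1 h'

theorem Compatible.eq_of_undecided_empty (h : Compatible G W ∅ S)
    (hW : ∀ x ∈ W, ¬ IsSink G W x) : S = W := by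
  refine h.1.1.1.antisymm fun u hu => ?_
  by_contra hn
  obtain ⟨z, hz, _⟩ := h.1.1.2 u (Finset.mem_sdiff.2 ⟨hu, hn⟩)
  simpa using h.mem_of_isSink hW hz

/-- If all of `N⁺(x)` were deleted, `x` would be a sink. So some out-neighbour survives, and its
path to a sink `z` avoids `N⁺(z)`. -/
theorem Compatible.exists_candidate (h : Compatible G W U S) (hW : ∀ x ∈ W, ¬ IsSink G W x)
    (hx : x ∈ W) (hxs : ¬ IsSink G (W \ S) x) :
    ∃ z ∈ U, IsSink G (W \ S) z ∧ ∃ y ∈ outs G W x, InReach G W z y := by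
  obtain ⟨y, hy, hyS⟩ : ∃ y ∈ outs G W x, y ∉ S := by
    by_contra! hn
    exact hxs (h.1.isSink_of_outs_subset hx hn)
  obtain ⟨z, hz, hr⟩ := h.1.1.2 y (Finset.mem_sdiff.2 ⟨(mem_outs.1 hy).1, hyS⟩)
  exact ⟨z, h.mem_of_isSink hW hz, hz, y, hy, hr.inReach hz⟩

/-- A vertex whose only undecided in-neighbour `x` is not made a sink survives. -/
theorem Compatible.notMem_of_surviving (h : Compatible G W U S) (hW : ∀ x ∈ W, ¬ IsSink G W x)
    (hxs : ¬ IsSink G (W \ S) x) (hy : ∀ u ∈ U, Arc G u y → u = x) : y ∉ S := fun hyS => by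
  have hyW := h.1.1.1 hyS
  obtain ⟨w, hw, a⟩ := h.1.exists_out hyS
  obtain ⟨z, hz, hr⟩ := h.1.1.2 w hw
  have hzy : ¬ Arc G z y := fun a' => hxs (hy z (h.mem_of_isSink hW hz) a' ▸ hz)
  exact h.1.not_reaches hyS (hz.sdiff_erase hyW hzy)
    (.step ((mem_sdiff_erase hyW).2 (.inl rfl)) a (hr.mono sdiff_subset_sdiff_erase))

/-- Since `y` is known to survive, the branches can be confined to `R⁺(y)` instead of the union over
all of `N⁺(x)`. -/
theorem Compatible.exists_sink_of_surviving (h : Compatible G W U S)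
    (hW : ∀ x ∈ W, ¬ IsSink G W x) (hxs : ¬ IsSink G (W \ S) x) (hyW : y ∈ W)
    (hy : ∀ u ∈ U, Arc G u y → u = x) : ∃ z ∈ U, IsSink G (W \ S) z ∧ InReach G W z y := by
  obtain ⟨z, hz, hr⟩ := h.1.1.2 y (Finset.mem_sdiff.2
    ⟨hyW, h.notMem_of_surviving hW hxs hy⟩)
  exact ⟨z, h.mem_of_isSink hW hz, hz, hr.inReach hz⟩

/-- If the undecided vertices are pairwise non-adjacent, none of them is deleted. -/
theorem Compatible.notMem_of_independent (h : Compatible G W U S) (hW : ∀ x ∈ W, ¬ IsSink G W x)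
    (hind : ∀ u ∈ U, ∀ w ∈ U, ¬ Arc G u w) (hs : s ∈ U) : s ∉ S := fun hsS => by
  have hsW := h.1.1.1 hsS
  obtain ⟨w, hw, a⟩ := h.1.exists_out hsS
  obtain ⟨z, hz, hr⟩ := h.1.1.2 w hw
  exact h.1.not_reaches hsS (hz.sdiff_erase hsW (hind z (h.mem_of_isSink hW hz) s hs))
    (.step ((mem_sdiff_erase hsW).2 (.inl rfl)) a (hr.mono sdiff_subset_sdiff_erase))

end KFVD

namespace KFVD

variable {V : Type} {G : Digraph V} [DecidableEq V]
variable {W W' S S' U U' T F : Finset V} {p q s t u v w x y z : V}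

/-! ## Interacting and free vertices, and the measure -/

/-- The undecided vertices `w` with `w ∈ R(v)` or `v ∈ R(w)`. -/
noncomputable def interacting (G : Digraph V) (W U : Finset V) (v : V) : Finset V :=
  open scoped Classical in U.filter fun w => w ∈ bigR G W v ∨ v ∈ bigR G W w

/-- The undecided vertices with a small set `R(v)` that interact with no other vertex. -/
noncomputable def freeVerts (G : Digraph V) (W U : Finset V) : Finset V :=
  open scoped Classical in
  U.filter fun v => (bigR G W v).card ≤ 11 ∧ interacting G W U v ⊆ {v}

/-- Four times the sum of the potentials of the vertices that are not free. -/
noncomputable def measure (G : Digraph V) (W U : Finset V) : ℕ :=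
  3 * (U \ freeVerts G W U).card + (W \ freeVerts G W U).card

theorem mem_interacting :
    w ∈ interacting G W U v ↔ w ∈ U ∧ (w ∈ bigR G W v ∨ v ∈ bigR G W w) := by
  simp [interacting]

theorem mem_freeVerts : v ∈ freeVerts G W U ↔
    v ∈ U ∧ (bigR G W v).card ≤ 11 ∧ interacting G W U v ⊆ {v} := by
  simp [freeVerts]

theorem freeVerts_subset : freeVerts G W U ⊆ U := fun _ h => (mem_freeVerts.1 h).1

theorem interacting_subset : interacting G W U v ⊆ U := fun _ h => (mem_interacting.1 h).1

theorem self_mem_interacting (hU : U ⊆ W) (h : v ∈ U) : v ∈ interacting G W U v :=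
  mem_interacting.2 ⟨h, .inl (self_mem_bigR (hU h))⟩

theorem interacting_mono (hW : W' ⊆ W) (hU : U' ⊆ U) :
    interacting G W' U' v ⊆ interacting G W U v := fun w hw => by
  rw [mem_interacting] at hw ⊢
  exact ⟨hU hw.1, hw.2.imp (fun h => bigR_mono hW h) fun h => bigR_mono hW h⟩

/-- Deleting and lowering only shrink `R(v)` and `I(v)`, so a free vertex stays free for as long as
it stays undecided. -/
theorem freeVerts_mono (hW : W' ⊆ W) (hU : U' ⊆ U) (h : v ∈ freeVerts G W U) (hv : v ∈ U') :
    v ∈ freeVerts G W' U' := by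
  rw [mem_freeVerts] at h ⊢
  exact ⟨hv, (Finset.card_le_card (bigR_mono hW)).trans h.2.1,
    (interacting_mono hW hU).trans h.2.2⟩

theorem mem_interacting_comm (hv : v ∈ U) (h : w ∈ interacting G W U v) :
    v ∈ interacting G W U w := by
  rw [mem_interacting] at h ⊢
  exact ⟨hv, h.2.symm⟩

theorem notMem_freeVerts (h : w ∈ interacting G W U v) (hne : w ≠ v) :
    v ∉ freeVerts G W U := fun hf => hne (by simpa using (mem_freeVerts.1 hf).2.2 h)

/-- `R⁺(v)` and the undecided part of `R(v)` make up the interacting vertices. -/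
theorem mem_interacting_iff (hU : U ⊆ W) (hv : v ∈ W) : w ∈ interacting G W U v ↔
    w ∈ U ∧ (w ∈ bigR G W v ∨ InReach G W w v) := by
  rw [mem_interacting]
  refine and_congr_right fun hw => ⟨fun h => h.elim .inl fun h => ?_, fun h =>
    h.imp id fun h => h.mem_bigR⟩
  rcases (mem_bigR.1 h).2 with a | h
  · exact .inl (pred_mem_bigR hv (hU hw) a)
  · exact .inr h

/-- The deletion of vertices does not increase the measure. -/
theorem measure_le (hW : W' ⊆ W) (hU : U' ⊆ U) (hF : ∀ v ∈ freeVerts G W U, v ∈ W' → v ∈ U')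
    (hUW : U' ⊆ W') : measure G W' U' ≤ measure G W U := by
  -- A free vertex that was kept but lowered would re-enter the measure with weight `1`; `hF`
  -- excludes this.
  have key : ∀ v ∈ W', v ∉ freeVerts G W' U' → v ∉ freeVerts G W U := fun v hv hn hf =>
    hn (freeVerts_mono hW hU hf (hF v hf hv))
  unfold measure
  refine Nat.add_le_add (Nat.mul_le_mul_left _ (Finset.card_le_card fun v hv => ?_))
    (Finset.card_le_card fun v hv => ?_) <;> rw [Finset.mem_sdiff] at hv ⊢
  · exact ⟨hU hv.1, key v (hUW hv.1) hv.2⟩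
  · exact ⟨hW hv.1, key v hv.1 hv.2⟩

/-- Every free vertex is undecided and hides its full weight `4`. In this form the decrease of the
measure reduces to counting three cardinalities. -/
theorem measure_add (hU : U ⊆ W) :
    measure G W U + 4 * (freeVerts G W U).card = 3 * U.card + W.card := by
  have h1 := Finset.card_sdiff_add_card_eq_card (freeVerts_subset (G := G) (W := W) (U := U))
  have h2 := Finset.card_sdiff_add_card_eq_card
    ((freeVerts_subset (G := G) (W := W) (U := U)).trans hU)
  unfold measure
  omega

/-- The undecided set after `s` is made a sink and `T` is lowered. -/
noncomputable def undAfter (G : Digraph V) (W U : Finset V) (s : V) (T : Finset V) : Finset V :=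
  U \ (interacting G W U s ∪ T)

theorem undAfter_subset : undAfter G W U s T ⊆ U := Finset.sdiff_subset

theorem undAfter_subset_sdiff (hU : U ⊆ W) : undAfter G W U s T ⊆ W \ bigR G W s := fun v hv => by
  simp only [undAfter, Finset.mem_sdiff, Finset.mem_union, not_or] at hv
  exact Finset.mem_sdiff.2 ⟨hU hv.1, fun h => hv.2.1 (mem_interacting.2 ⟨hv.1, .inl h⟩)⟩

/-- The measure drops by `3 |I(s) ∪ T| + |R(s)|`, and by `4` more for every vertex that becomes
free. -/
theorem measure_update (hU : U ⊆ W) (hs : s ∈ U) (hsf : s ∉ freeVerts G W U) (hT : T ⊆ U)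
    (hTf : ∀ t ∈ T, t ∉ freeVerts G W U) (hF : ∀ v ∈ F, v ∉ freeVerts G W U ∧
      v ∈ freeVerts G (W \ bigR G W s) (undAfter G W U s T)) :
    measure G (W \ bigR G W s) (undAfter G W U s T) +
      (3 * (interacting G W U s ∪ T).card + (bigR G W s).card + 4 * F.card) ≤
        measure G W U := by
  have h1 := measure_add (G := G) hU
  have h2 := measure_add (G := G) (undAfter_subset_sdiff (G := G) (s := s) (T := T) hU)
  have h3 : (undAfter G W U s T).card + (interacting G W U s ∪ T).card = U.card :=
    Finset.card_sdiff_add_card_eq_card (Finset.union_subset interacting_subset hT)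
  have h4 : (W \ bigR G W s).card + (bigR G W s).card = W.card :=
    Finset.card_sdiff_add_card_eq_card bigR_subset
  -- The old free vertices survive the update: they interact only with themselves, hence not with
  -- `s`, and they are not in `T`. Those of `F` come on top.
  have h5 : (freeVerts G W U).card + F.card ≤
      (freeVerts G (W \ bigR G W s) (undAfter G W U s T)).card := by
    rw [← Finset.card_union_of_disjoint
      (Finset.disjoint_right.2 fun v hv => (hF v hv).1)]
    refine Finset.card_le_card (Finset.union_subset (fun v hv => ?_) fun v hv => (hF v hv).2)
    refine freeVerts_mono Finset.sdiff_subset undAfter_subset hv ?_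
    have hvs : v ≠ s := fun e => hsf (e ▸ hv)
    simp only [undAfter, Finset.mem_sdiff, Finset.mem_union, not_or]
    refine ⟨freeVerts_subset hv, fun hi => ?_, fun ht => hTf v ht hv⟩
    exact notMem_freeVerts (mem_interacting_comm hs hi) hvs.symm hv
  omega

/-- Vertices all of whose interactions are removed or lowered become free. -/
theorem mem_freeVerts_update (hv : v ∈ U) (hcard : (bigR G W v).card ≤ 11)
    (hvs : v ∉ interacting G W U s) (hvT : v ∉ T)
    (hint : ∀ w ∈ interacting G W U v, w ≠ v → w ∈ interacting G W U s ∨ w ∈ T) :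
    v ∈ freeVerts G (W \ bigR G W s) (undAfter G W U s T) := by
  rw [mem_freeVerts]
  refine ⟨by simp [undAfter, hv, hvs, hvT],
    (Finset.card_le_card (bigR_mono Finset.sdiff_subset)).trans hcard, fun w hw => ?_⟩
  have hw1 := interacting_mono Finset.sdiff_subset undAfter_subset hw
  have hw2 := (mem_interacting.1 hw).1
  simp only [undAfter, Finset.mem_sdiff, Finset.mem_union] at hw2
  by_contra hne
  exact hw2.2 (hint w hw1 (by simpa using hne))

theorem measure_erase (hU : U ⊆ W) (hx : x ∈ U) (hxf : x ∉ freeVerts G W U) :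
    measure G W (U.erase x) + 3 ≤ measure G W U := by
  have h1 := measure_add (G := G) hU
  have h2 := measure_add (G := G) ((Finset.erase_subset x U).trans hU)
  have h3 := Finset.card_erase_add_one hx
  have h4 : (freeVerts G W U).card ≤ (freeVerts G W (U.erase x)).card :=
    Finset.card_le_card fun v hv => freeVerts_mono le_rfl (Finset.erase_subset _ _) hv
      (Finset.mem_erase.2 ⟨fun e => hxf (e ▸ hv), freeVerts_subset hv⟩)
  omega

/-! ## The base of the exponential -/

/-- The base per quarter unit of the measure. -/
noncomputable def base : ℝ := 1.098267

theorem base_pos : 0 < base := by norm_num [base]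

theorem one_le_base : 1 ≤ base := by norm_num [base]

/-- An undecided vertex weighs four quarter units, so this is the growth rate per vertex. -/
theorem base_pow_four : base ^ 4 ≤ 1.4549 := by norm_num [base]

theorem base_pow_le {a m M : ℕ} (h : m + a ≤ M) : base ^ m ≤ base ^ M * (base ^ a)⁻¹ := by
  rw [← div_eq_mul_inv, le_div_iff₀ (pow_pos base_pos a), ← pow_add]
  exact pow_le_pow_right₀ one_le_base h

theorem branch_two {a b m₁ m₂ M : ℕ} (h₁ : m₁ + a ≤ M) (h₂ : m₂ + b ≤ M)
    (h : (base ^ a)⁻¹ + (base ^ b)⁻¹ ≤ 1) : base ^ m₁ + base ^ m₂ ≤ base ^ M := by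
  have := mul_le_mul_of_nonneg_left h (pow_pos base_pos M).le
  linarith [base_pow_le h₁, base_pow_le h₂]

theorem branch_three {a b c m₁ m₂ m₃ M : ℕ} (h₁ : m₁ + a ≤ M) (h₂ : m₂ + b ≤ M) (h₃ : m₃ + c ≤ M)
    (h : (base ^ a)⁻¹ + (base ^ b)⁻¹ + (base ^ c)⁻¹ ≤ 1) :
    base ^ m₁ + base ^ m₂ + base ^ m₃ ≤ base ^ M := by
  have := mul_le_mul_of_nonneg_left h (pow_pos base_pos M).le
  linarith [base_pow_le h₁, base_pow_le h₂, base_pow_le h₃]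

theorem branch_four {a b c d m₁ m₂ m₃ m₄ M : ℕ} (h₁ : m₁ + a ≤ M) (h₂ : m₂ + b ≤ M)
    (h₃ : m₃ + c ≤ M) (h₄ : m₄ + d ≤ M)
    (h : (base ^ a)⁻¹ + (base ^ b)⁻¹ + (base ^ c)⁻¹ + (base ^ d)⁻¹ ≤ 1) :
    base ^ m₁ + base ^ m₂ + base ^ m₃ + base ^ m₄ ≤ base ^ M := by
  have := mul_le_mul_of_nonneg_left h (pow_pos base_pos M).le
  linarith [base_pow_le h₁, base_pow_le h₂, base_pow_le h₃, base_pow_le h₄]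


end KFVD

namespace KFVD

variable {V : Type} {G : Digraph V} [DecidableEq V]
variable {W W' S S' U U' T F : Finset V} {p q s t u v w x y z : V}

/-! ## Analysis of the branching steps -/

theorem two_le_card {A : Finset V} {a b : V} (ha : a ∈ A) (hb : b ∈ A) (hab : a ≠ b) :
    2 ≤ A.card := by
  rw [← Finset.card_pair hab]
  exact Finset.card_le_card (by simp [Finset.insert_subset_iff, *])

theorem three_le_card {A : Finset V} {a b c : V} (ha : a ∈ A) (hb : b ∈ A) (hc : c ∈ A)
    (hab : a ≠ b) (hac : a ≠ c) (hbc : b ≠ c) : 3 ≤ A.card := by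
  rw [← Finset.card_eq_three.2 ⟨a, b, c, hab, hac, hbc, rfl⟩]
  exact Finset.card_le_card (by simp [Finset.insert_subset_iff, *])

omit [DecidableEq V] in
theorem card_lt_of_notMem {A B : Finset V} {a : V} (h : B ⊆ A) (ha : a ∈ A) (hB : a ∉ B) :
    B.card + 1 ≤ A.card :=
  Finset.card_lt_card (Finset.ssubset_iff_subset_ne.2 ⟨h, fun e => hB (e ▸ ha)⟩)

theorem four_le_card {A : Finset V} {a b c d : V} (ha : a ∈ A) (hb : b ∈ A) (hc : c ∈ A)
    (hd : d ∈ A) (hab : a ≠ b) (hac : a ≠ c) (hbc : b ≠ c) (had : a ≠ d) (hbd : b ≠ d)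
    (hcd : c ≠ d) : 4 ≤ A.card := by
  have h : 3 ≤ (A.erase d).card := three_le_card (a := a) (b := b) (c := c)
    (by simp [*]) (by simp [*]) (by simp [*]) hab hac hbc
  have := Finset.card_erase_add_one hd
  omega

theorem five_le_card {A : Finset V} {a b c d e : V} (ha : a ∈ A) (hb : b ∈ A) (hc : c ∈ A)
    (hd : d ∈ A) (he : e ∈ A) (hab : a ≠ b) (hac : a ≠ c) (hbc : b ≠ c) (had : a ≠ d)
    (hbd : b ≠ d) (hcd : c ≠ d) (hae : a ≠ e) (hbe : b ≠ e) (hce : c ≠ e) (hde : d ≠ e) :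
    5 ≤ A.card := by
  have h : 4 ≤ (A.erase e).card := four_le_card (a := a) (b := b) (c := c) (d := d)
    (by simp [*]) (by simp [*]) (by simp [*]) (by simp [*]) hab hac hbc had hbd hcd
  have := Finset.card_erase_add_one he
  omega

/-- An instance to which neither a reduction nor the first branching rule applies. -/
structure Reduced (G : Digraph V) (W U : Finset V) : Prop where
  subset : U ⊆ W
  exists_succ : ∀ x ∈ W, ∃ w ∈ W, Arc G x w
  drop_le : ∀ v ∈ U, 3 * (interacting G W U v).card + (bigR G W v).card ≤ 14

/-- The measure of the instance in which `s` is made a sink and `T` is lowered. -/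
noncomputable def measureAfter (G : Digraph V) (W U : Finset V) (s : V) (T : Finset V) : ℕ :=
  measure G (W \ bigR G W s) (undAfter G W U s T)

/-- The undecided neighbours of `v`. -/
noncomputable def undNbrs (G : Digraph V) (U : Finset V) (v : V) : Finset V :=
  open scoped Classical in U.filter fun w => Arc G v w ∨ Arc G w v

omit [DecidableEq V] in
theorem mem_undNbrs : w ∈ undNbrs G U v ↔ w ∈ U ∧ (Arc G v w ∨ Arc G w v) := by
  simp [undNbrs]

theorem arc_mem_bigR (hw : w ∈ W) (a : Arc G v w) : w ∈ bigR G W v := mem_bigR.2 ⟨hw, .inl a⟩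

theorem undNbrs_subset_bigR (hU : U ⊆ W) (hv : v ∈ W) : undNbrs G U v ⊆ bigR G W v :=
  fun w hw => by
    rw [mem_undNbrs] at hw
    exact hw.2.elim (arc_mem_bigR (hU hw.1)) (pred_mem_bigR hv (hU hw.1))

/-! ### Decrease of the measure in a reduced instance -/

namespace Reduced

/-- As `v ∈ I(v)`, at least `3` of the allowed `14` is used up by the interaction term. This is the
source of the bound `11` in `freeVerts`. -/
theorem card_bigR_le (h : Reduced G W U) (hv : v ∈ U) : (bigR G W v).card ≤ 11 := by
  have h1 := h.drop_le v hv
  have h2 := Finset.card_pos.2 ⟨v, self_mem_interacting (G := G) h.subset hv⟩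
  omega

/-- Serves the nodes with a single recursive call, where `s` may be free and no decrease is
available. A free vertex other than `s` does not interact with `s`, so it is not lowered. -/
theorem measureAfter_le (h : Reduced G W U) (hs : s ∈ U) :
    measureAfter G W U s ∅ ≤ measure G W U := by
  refine measure_le Finset.sdiff_subset undAfter_subset (fun v hv hvW => ?_)
    (undAfter_subset_sdiff h.subset)
  simp only [undAfter, Finset.union_empty, Finset.mem_sdiff]
  refine ⟨freeVerts_subset hv, fun hi => ?_⟩
  have hvs : s ≠ v := fun e =>
    (Finset.mem_sdiff.1 hvW).2 (e ▸ self_mem_bigR (h.subset hs))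
  exact notMem_freeVerts (mem_interacting_comm hs hi) hvs hv

/-- The second interacting vertex `w` certifies that `s` is not free, so the full `4ψ(s)` is gained.
-/
theorem drop (h : Reduced G W U) (hs : s ∈ U) (hw : w ∈ interacting G W U s) (hws : w ≠ s) :
    measureAfter G W U s ∅ + (3 * (interacting G W U s).card + (bigR G W s).card) ≤
      measure G W U := by
  simpa [measureAfter] using measure_update (F := ∅) (T := ∅) h.subset hs (notMem_freeVerts hw hws)
    (by simp) (by simp) (by simp)

/-- Once `s` is a sink, every partner of `v` is deleted or lowered while `v` stays undecided, so `v`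
becomes free; `q` certifies that it was not free before. The bonus is `4`. -/
theorem drop_free (h : Reduced G W U) (hs : s ∈ U) (hw : w ∈ interacting G W U s) (hws : w ≠ s)
    (hv : v ∈ U) (hvs : v ∉ interacting G W U s) (hq : q ∈ interacting G W U v) (hqv : q ≠ v)
    (hint : ∀ w ∈ interacting G W U v, w ≠ v → w ∈ interacting G W U s) :
    measureAfter G W U s ∅ + (3 * (interacting G W U s).card + (bigR G W s).card + 4) ≤
      measure G W U := by
  have := measure_update (F := {v}) (T := ∅) h.subset hs (notMem_freeVerts hw hws)
    (by simp) (by simp) (by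
      simp only [Finset.mem_singleton, forall_eq]
      exact ⟨notMem_freeVerts hq hqv, mem_freeVerts_update hv (h.card_bigR_le hv) hvs (by simp)
        fun w hw hwv => .inl (hint w hw hwv)⟩)
  simpa [measureAfter] using this

theorem drop_lower (h : Reduced G W U) (hs : s ∈ U) (hw : w ∈ interacting G W U s) (hws : w ≠ s)
    (ht : t ∈ U) (hq : q ∈ interacting G W U t) (hqt : q ≠ t) :
    measureAfter G W U s {t} + (3 * (insert t (interacting G W U s)).card + (bigR G W s).card) ≤
      measure G W U := by
  have := measure_update (F := ∅) (T := {t}) h.subset hs (notMem_freeVerts hw hws)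
    (by simpa using ht) (by simpa using notMem_freeVerts hq hqt) (by simp)
  rw [Finset.union_comm, ← Finset.insert_eq] at this
  simpa [measureAfter] using this

end Reduced

/-- The situation of a candidate `s ∈ R⁺(y)` with `y ∈ N⁺(x)`. -/
structure Candidate (G : Digraph V) (W U : Finset V) (x y s : V) : Prop where
  mem_outs : y ∈ outs G W x
  mem : s ∈ U
  inReach : InReach G W s y

namespace Candidate

/-- `y` is an out-neighbour of `x`, whereas paths witnessing `y ∈ R⁻(s)` avoid `N⁺(s)`. -/
theorem ne (h : Candidate G W U x y s) : x ≠ s := fun e => by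
  subst e
  exact h.inReach.not_arc (KFVD.mem_outs.1 h.mem_outs).2

theorem mem_bigR (h : Candidate G W U x y s) (hx : x ∈ W) : x ∈ bigR G W s :=
  h.inReach.pred_mem_bigR hx (KFVD.mem_outs.1 h.mem_outs).2

theorem mem_interacting (h : Candidate G W U x y s) (hU : U ⊆ W) (hx : x ∈ U) :
    x ∈ interacting G W U s :=
  KFVD.mem_interacting.2 ⟨hx, .inl (h.mem_bigR (hU hx))⟩

theorem mem_interacting' (h : Candidate G W U x y s) (hU : U ⊆ W) (hx : x ∈ U) :
    s ∈ interacting G W U x :=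
  mem_interacting_comm h.mem (h.mem_interacting hU hx)

/-- The bounds `7` and `8` for a single candidate. -/
theorem branch (h : Candidate G W U x y s) (hR : Reduced G W U) (hx : x ∈ U) :
    base ^ measureAfter G W U x ∅ + base ^ measureAfter G W U s ∅ ≤ base ^ measure G W U := by
  have hxs := h.mem_interacting hR.subset hx
  have hsx := h.mem_interacting' hR.subset hx
  have hxx := self_mem_interacting (G := G) hR.subset hx
  have hss := self_mem_interacting (G := G) hR.subset h.mem
  have d1 := hR.drop hx hsx h.ne.symm
  have d2 := hR.drop h.mem hxs h.ne
  have c1 := two_le_card hxx hsx h.ne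
  have c2 := two_le_card hss hxs h.ne.symm
  have c3 := two_le_card (self_mem_bigR (hR.subset h.mem)) (h.mem_bigR (hR.subset hx)) h.ne.symm
  have c4 := Finset.card_pos.2 ⟨x, self_mem_bigR (G := G) (hR.subset hx)⟩
  exact branch_two (a := 7) (b := 8) (by omega) (by omega) (by norm_num [base])

end Candidate

/-! ### No surviving out-neighbour -/

section NoSurvivor

variable (hR : Reduced G W U) (hx : x ∈ U)
  (hmax : ∀ v ∈ U, (undNbrs G U v).card ≤ (undNbrs G U x).card)
  (hS : ∀ y ∈ outs G W x, ∃ u ∈ U, u ≠ x ∧ Arc G u y)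

include hR hx

/-- The second undecided in-neighbour `u` of `y` is, like `x`, a predecessor of a vertex of `R⁻(s)`,
hence in `R(s)`. It differs from `s`, which has no arc to `y`. -/
theorem candidate_drop (h : Candidate G W U x y s) (hu : u ∈ U) (hux : u ≠ x) (a : Arc G u y) :
    u ≠ s ∧ u ∈ bigR G W s ∧ u ∈ interacting G W U s ∧ 3 ≤ (interacting G W U s).card := by
  have hus : u ≠ s := fun e => h.inReach.not_arc (e ▸ a)
  have huR : u ∈ bigR G W s := h.inReach.pred_mem_bigR (hR.subset hu) a
  have huI : u ∈ interacting G W U s := mem_interacting.2 ⟨hu, .inl huR⟩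
  exact ⟨hus, huR, huI, three_le_card (self_mem_interacting hR.subset h.mem)
    (h.mem_interacting hR.subset hx) huI h.ne.symm hus.symm hux.symm⟩

include hS in
-- `s`, `x` and `u` lie in `R(s)` and in `I(s)`: `3·3 + 3`.
theorem candidate_drop_twelve (h : Candidate G W U x y s) :
    measureAfter G W U s ∅ + 12 ≤ measure G W U := by
  obtain ⟨u, hu, hux, a⟩ := hS y h.mem_outs
  obtain ⟨hus, huR, huI, hc⟩ := candidate_drop hR hx h hu hux a
  have d := hR.drop h.mem (h.mem_interacting hR.subset hx) h.ne
  have := three_le_card (self_mem_bigR (hR.subset h.mem)) (h.mem_bigR (hR.subset hx)) huR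
    h.ne.symm hus.symm hux.symm
  omega

include hS in
-- A decided `y` is a fourth element of `R(s)`: `3·3 + 4`.
theorem candidate_drop_thirteen (h : Candidate G W U x y s) (hy : y ∉ U) :
    measureAfter G W U s ∅ + 13 ≤ measure G W U := by
  obtain ⟨u, hu, hux, a⟩ := hS y h.mem_outs
  obtain ⟨hus, huR, huI, hc⟩ := candidate_drop hR hx h hu hux a
  have d := hR.drop h.mem (h.mem_interacting hR.subset hx) h.ne
  have hne : ∀ v ∈ U, v ≠ y := fun v hv e => hy (e ▸ hv)
  have := four_le_card (self_mem_bigR (hR.subset h.mem)) (h.mem_bigR (hR.subset hx)) huR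
    h.inReach.mem_bigR h.ne.symm hus.symm hux.symm (hne s h.mem) (hne x hx) (hne u hu)
  omega

include hS in
-- Under independence neither `y` nor a successor `n` of `s` is undecided, so `s, x, u, y, n` are
-- five elements of `R(s)`: `3·3 + 5`.
theorem candidate_drop_fourteen (h : Candidate G W U x y s)
    (hind : ∀ u ∈ U, ∀ w ∈ U, ¬ Arc G u w) :
    measureAfter G W U s ∅ + 14 ≤ measure G W U := by
  obtain ⟨u, hu, hux, a⟩ := hS y h.mem_outs
  obtain ⟨hus, huR, huI, hc⟩ := candidate_drop hR hx h hu hux a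
  have d := hR.drop h.mem (h.mem_interacting hR.subset hx) h.ne
  have hne : ∀ v ∈ U, v ≠ y := fun v hv e => hind u hu v hv (e ▸ a)
  obtain ⟨n, hn, an⟩ := hR.exists_succ s (hR.subset h.mem)
  have hnn : ∀ v ∈ U, v ≠ n := fun v hv e => hind s h.mem v hv (e ▸ an)
  have := five_le_card (self_mem_bigR (hR.subset h.mem)) (h.mem_bigR (hR.subset hx)) huR
    h.inReach.mem_bigR (arc_mem_bigR hn an) h.ne.symm hus.symm hux.symm (hne s h.mem)
    (hne x hx) (hne u hu) (hnn s h.mem) (hnn x hx) (hnn u hu)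
    fun e => h.inReach.not_arc (e ▸ an)
  omega

include hmax hS in
-- If `x` has no undecided neighbour, each `yᵢ` is decided and the decreases are `(11, 13, 13)`.
-- Otherwise `|R(x)| ≥ 3`, by maximality of `x` if `y₁` is undecided and by an undecided neighbour
-- distinct from `y₁` if not; this gives `(12, 12, 12)`.
theorem branch_two_candidates {s₁ s₂ y₁ y₂ : V} (h₁ : Candidate G W U x y₁ s₁)
    (h₂ : Candidate G W U x y₂ s₂) (hne : s₁ ≠ s₂) :
    base ^ measureAfter G W U x ∅ + base ^ measureAfter G W U s₁ ∅ +
      base ^ measureAfter G W U s₂ ∅ ≤ base ^ measure G W U := by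
  have hxW := hR.subset hx
  have c1 := three_le_card (self_mem_interacting (G := G) hR.subset hx)
    (h₁.mem_interacting' hR.subset hx) (h₂.mem_interacting' hR.subset hx) h₁.ne h₂.ne hne
  have d := hR.drop hx (h₁.mem_interacting' hR.subset hx) h₁.ne.symm
  have hyR := outs_subset_bigR h₁.mem_outs
  have hy := (mem_outs.1 h₁.mem_outs)
  have hsub := undNbrs_subset_bigR (G := G) hR.subset hxW
  have hxx : x ∉ undNbrs G U x := fun h => by
    simp [mem_undNbrs, not_arc_self] at h
  rcases Finset.eq_empty_or_nonempty (undNbrs G U x) with h0 | ⟨v, hv⟩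
  · have hU : ∀ y ∈ outs G W x, y ∉ U := fun y hy hyU => by
      have : y ∈ undNbrs G U x := mem_undNbrs.2 ⟨hyU, .inl (mem_outs.1 hy).2⟩
      simp [h0] at this
    have e1 := candidate_drop_thirteen hR hx hS h₁ (hU _ h₁.mem_outs)
    have e2 := candidate_drop_thirteen hR hx hS h₂ (hU _ h₂.mem_outs)
    have := two_le_card (self_mem_bigR hxW) hyR hy.2.ne
    exact branch_three (a := 11) (by omega) e1 e2 (by norm_num [base])
  · have c2 : 3 ≤ (bigR G W x).card := by
      by_cases hyU : y₁ ∈ U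
      · obtain ⟨u, hu, hux, a⟩ := hS y₁ h₁.mem_outs
        have h2 : 2 ≤ (undNbrs G U y₁).card :=
          two_le_card (mem_undNbrs.2 ⟨hu, .inr a⟩) (mem_undNbrs.2 ⟨hx, .inr hy.2⟩) hux
        have h3 := hmax y₁ hyU
        have := card_lt_of_notMem hsub (self_mem_bigR hxW) hxx
        omega
      · have hv' := mem_undNbrs.1 hv
        exact three_le_card (self_mem_bigR hxW) hyR (hsub hv) hy.2.ne
          (fun e => hxx (e ▸ hv)) fun e => hyU (e ▸ hv'.1)
    exact branch_three (by omega) (candidate_drop_twelve hR hx hS h₁)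
      (candidate_drop_twelve hR hx hS h₂) (a := 12) (by norm_num [base])

include hmax hS in
-- Three candidates fill the allowance `14` of `x` exactly, which makes the situation rigid: there
-- is a single `y`, it is decided, and by maximality of `x` the undecided vertices are independent.
-- Four decreases of `14` would not suffice for `base`; but the other in-neighbour `u` of `y`
-- interacts only with the three candidates and becomes free when `x` is made a sink, so `x` gains
-- `18`.
theorem branch_three_candidates {s₁ s₂ s₃ y₁ y₂ y₃ : V} (h₁ : Candidate G W U x y₁ s₁)
    (h₂ : Candidate G W U x y₂ s₂) (h₃ : Candidate G W U x y₃ s₃) (h12 : s₁ ≠ s₂)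
    (h13 : s₁ ≠ s₃) (h23 : s₂ ≠ s₃) :
    base ^ measureAfter G W U x ∅ + base ^ measureAfter G W U s₁ ∅ +
      base ^ measureAfter G W U s₂ ∅ + base ^ measureAfter G W U s₃ ∅ ≤ base ^ measure G W U := by
  have hxW := hR.subset hx
  have i1 := h₁.mem_interacting' hR.subset hx
  have i2 := h₂.mem_interacting' hR.subset hx
  have i3 := h₃.mem_interacting' hR.subset hx
  have ix := self_mem_interacting (G := G) hR.subset hx
  have c1 := four_le_card ix i1 i2 i3 h₁.ne h₂.ne h12 h₃.ne h13 h23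
  have hd := hR.drop_le x hx
  have hyx := mem_outs.1 h₁.mem_outs
  have hyR := outs_subset_bigR h₁.mem_outs
  have c2 := two_le_card (self_mem_bigR hxW) hyR hyx.2.ne
  -- `3·4 + 2` already equals the bound, so `R(x) = {x, y₁}` and `I(x) = {x, s₁, s₂, s₃}`; in
  -- particular the three candidates share one `y`.
  have hRx : ∀ q ∈ bigR G W x, q ≠ x → q = y₁ := fun q hq hqx => by
    by_contra hqy
    have := three_le_card (self_mem_bigR hxW) hyR hq hyx.2.ne hqx.symm (Ne.symm hqy)
    omega
  have hIx : ∀ q ∈ interacting G W U x, q = x ∨ q = s₁ ∨ q = s₂ ∨ q = s₃ := fun q hq => by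
    by_contra! hn
    have := five_le_card ix i1 i2 i3 hq h₁.ne h₂.ne h12 h₃.ne h13 h23 hn.1.symm hn.2.1.symm
      hn.2.2.1.symm hn.2.2.2.symm
    omega
  have e2 : y₂ = y₁ := hRx _ (outs_subset_bigR h₂.mem_outs) (mem_outs.1 h₂.mem_outs).2.ne.symm
  have e3 : y₃ = y₁ := hRx _ (outs_subset_bigR h₃.mem_outs) (mem_outs.1 h₃.mem_outs).2.ne.symm
  subst e2 e3
  obtain ⟨u, hu, hux, a⟩ := hS _ h₁.mem_outs
  have hsub := undNbrs_subset_bigR (G := G) hR.subset hxW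
  have hyU : y₃ ∉ U := fun hyU => by
    have h2 : 2 ≤ (undNbrs G U y₃).card :=
      two_le_card (mem_undNbrs.2 ⟨hu, .inr a⟩) (mem_undNbrs.2 ⟨hx, .inr hyx.2⟩) hux
    have hxx : x ∉ undNbrs G U x := fun h => by simp [mem_undNbrs, not_arc_self] at h
    have := card_lt_of_notMem hsub (self_mem_bigR hxW) hxx
    have := hmax _ hyU
    omega
  have h0 : undNbrs G U x = ∅ := by
    refine Finset.eq_empty_of_forall_notMem fun v hv => ?_
    have hv' := mem_undNbrs.1 hv
    have hvx : v ≠ x := fun e => by simp [e, not_arc_self] at hv'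
    exact hyU (hRx v (hsub hv) hvx ▸ hv'.1)
  have hind : ∀ u ∈ U, ∀ w ∈ U, ¬ Arc G u w := fun v hv w hw a => by
    have h1 := hmax v hv
    rw [h0, Finset.card_empty, Nat.le_zero, Finset.card_eq_zero] at h1
    have : w ∈ undNbrs G U v := mem_undNbrs.2 ⟨hw, .inl a⟩
    simp [h1] at this
  have hus : ∀ s, Candidate G W U x y₃ s → u ≠ s ∧ s ∈ interacting G W U u := fun s h => by
    obtain ⟨hus, -, huI, -⟩ := candidate_drop hR hx h hu hux a
    exact ⟨hus, mem_interacting_comm h.mem huI⟩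
  have huI : ∀ q ∈ interacting G W U u, q ≠ u → q = s₁ ∨ q = s₂ ∨ q = s₃ := fun q hq hqu => by
    by_contra! hn
    have := five_le_card (self_mem_interacting (G := G) hR.subset hu) (hus _ h₁).2 (hus _ h₂).2
      (hus _ h₃).2 hq (hus _ h₁).1 (hus _ h₂).1 h12 (hus _ h₃).1 h13 h23 hqu.symm hn.1.symm
      hn.2.1.symm hn.2.2.symm
    have := hR.drop_le u hu
    omega
  have hux' : u ∉ interacting G W U x := fun hI => by
    rcases hIx u hI with h | h | h | h
    exacts [hux h, (hus _ h₁).1 h, (hus _ h₂).1 h, (hus _ h₃).1 h]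
  have d := hR.drop_free hx i1 h₁.ne.symm hu hux' (hus _ h₁).2 (hus _ h₁).1.symm
    fun w hw hwu => by
      rcases huI w hw hwu with rfl | rfl | rfl <;> assumption
  exact branch_four (a := 18) (by omega) (candidate_drop_fourteen hR hx hS h₁ hind)
    (candidate_drop_fourteen hR hx hS h₂ hind) (candidate_drop_fourteen hR hx hS h₃ hind)
    (by norm_num [base])

/-- Five interacting vertices alone would contribute `15 > 14`. -/
theorem not_four_candidates {s₁ s₂ s₃ s₄ y₁ y₂ y₃ y₄ : V} (h₁ : Candidate G W U x y₁ s₁)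
    (h₂ : Candidate G W U x y₂ s₂) (h₃ : Candidate G W U x y₃ s₃) (h₄ : Candidate G W U x y₄ s₄)
    (h12 : s₁ ≠ s₂) (h13 : s₁ ≠ s₃) (h23 : s₂ ≠ s₃) (h14 : s₁ ≠ s₄) (h24 : s₂ ≠ s₄)
    (h34 : s₃ ≠ s₄) : False := by
  have := five_le_card (self_mem_interacting (G := G) hR.subset hx)
    (h₁.mem_interacting' hR.subset hx) (h₂.mem_interacting' hR.subset hx)
    (h₃.mem_interacting' hR.subset hx) (h₄.mem_interacting' hR.subset hx)
    h₁.ne h₂.ne h12 h₃.ne h13 h23 h₄.ne h14 h24 h34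
  have := hR.drop_le x hx
  omega

include hmax hS in
theorem branch_candidates {L : List V} (hL : L.Nodup)
    (hc : ∀ s ∈ L, ∃ y, Candidate G W U x y s) : L.length ≤ 3 ∧
      base ^ measureAfter G W U x ∅ + (L.map fun s => base ^ measureAfter G W U s ∅).sum ≤
        base ^ measure G W U := by
  rcases L with _ | ⟨s₁, _ | ⟨s₂, _ | ⟨s₃, _ | ⟨s₄, L⟩⟩⟩⟩
  · simpa using pow_le_pow_right₀ one_le_base (hR.measureAfter_le hx)
  · obtain ⟨y, h⟩ := hc s₁ (by simp)
    simpa using h.branch hR hx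
  · obtain ⟨y₁, h₁⟩ := hc s₁ (by simp)
    obtain ⟨y₂, h₂⟩ := hc s₂ (by simp)
    simpa [add_assoc] using branch_two_candidates hR hx hmax hS h₁ h₂ (by simpa using hL)
  · obtain ⟨y₁, h₁⟩ := hc s₁ (by simp)
    obtain ⟨y₂, h₂⟩ := hc s₂ (by simp)
    obtain ⟨y₃, h₃⟩ := hc s₃ (by simp)
    simp only [List.nodup_cons, List.mem_cons, List.not_mem_nil, or_false, not_or] at hL
    simpa [add_assoc] using
      branch_three_candidates hR hx hmax hS h₁ h₂ h₃ hL.1.1 hL.1.2 hL.2.1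
  · obtain ⟨y₁, h₁⟩ := hc s₁ (by simp)
    obtain ⟨y₂, h₂⟩ := hc s₂ (by simp)
    obtain ⟨y₃, h₃⟩ := hc s₃ (by simp)
    obtain ⟨y₄, h₄⟩ := hc s₄ (by simp)
    simp only [List.nodup_cons, List.mem_cons, not_or] at hL
    exact (not_four_candidates hR hx h₁ h₂ h₃ h₄ hL.1.1 hL.1.2.1 hL.2.1.1 hL.1.2.2.1
      hL.2.1.2.1 hL.2.2.1.1).elim

end NoSurvivor

/-! ### A surviving out-neighbour -/

section Survivor

variable (hR : Reduced G W U) (hx : x ∈ U)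

include hR hx

/-- The bound `14` forces `R(x) = {x, y}`, so the undecided neighbour of `x` is `y`, which is then
one of its own candidates. The same bound at `y`, which interacts with `x` and the other two, forces
`R(y) = {x, y}`. But a path from `y` to another candidate has to leave `{x, y}`. -/
theorem not_three_candidates {s₁ s₂ s₃ : V} (hne : (undNbrs G U x).Nonempty)
    (hpos : ∀ s, InReach G W s y → s ∈ U → s = s₁ ∨ s = s₂ ∨ s = s₃)
    (h₁ : Candidate G W U x y s₁)
    (h₂ : Candidate G W U x y s₂) (h₃ : Candidate G W U x y s₃) (h12 : s₁ ≠ s₂)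
    (h13 : s₁ ≠ s₃) (h23 : s₂ ≠ s₃) : False := by
  have hxW := hR.subset hx
  have i1 := h₁.mem_interacting' hR.subset hx
  have i2 := h₂.mem_interacting' hR.subset hx
  have i3 := h₃.mem_interacting' hR.subset hx
  have ix := self_mem_interacting (G := G) hR.subset hx
  have c1 := four_le_card ix i1 i2 i3 h₁.ne h₂.ne h12 h₃.ne h13 h23
  have hd := hR.drop_le x hx
  have hyx := mem_outs.1 h₁.mem_outs
  have hyR := outs_subset_bigR h₁.mem_outs
  have hRx : ∀ q ∈ bigR G W x, q ≠ x → q = y := fun q hq hqx => by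
    by_contra hqy
    have := three_le_card (self_mem_bigR hxW) hyR hq hyx.2.ne hqx.symm (Ne.symm hqy)
    omega
  obtain ⟨v, hv⟩ := hne
  have hvx : v ≠ x := fun e => by simp [e, mem_undNbrs, not_arc_self] at hv
  have hyU : y ∈ U :=
    hRx v (undNbrs_subset_bigR hR.subset hxW hv) hvx ▸ (mem_undNbrs.1 hv).1
  -- one of the three candidates is `y`, the other two leave `R(y) = {x, y}`
  obtain ⟨a, b, ha, hb, hay, hby, hab⟩ : ∃ a b, Candidate G W U x y a ∧ Candidate G W U x y b ∧
      a ≠ y ∧ b ≠ y ∧ a ≠ b := by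
    rcases hpos y (.self hyx.1) hyU with rfl | rfl | rfl
    · exact ⟨_, _, h₂, h₃, h12.symm, h13.symm, h23⟩
    · exact ⟨_, _, h₁, h₃, h12, h23.symm, h13⟩
    · exact ⟨_, _, h₁, h₂, h13, h23, h12⟩
  have hxyR : x ∈ bigR G W y := pred_mem_bigR hyx.1 hxW hyx.2
  have hyI : ∀ s, Candidate G W U x y s → s ∈ interacting G W U y := fun s h =>
    mem_interacting.2 ⟨h.mem, .inr h.inReach.mem_bigR⟩
  have c2 := four_le_card (self_mem_interacting (G := G) hR.subset hyU)
    (mem_interacting.2 ⟨hx, .inl hxyR⟩) (hyI a ha) (hyI b hb) hyx.2.ne.symm hay.symm ha.ne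
    hby.symm hb.ne hab
  have hdy := hR.drop_le y hyU
  have hRy : ∀ q ∈ bigR G W y, q ≠ x → q = y := fun q hq hqx => by
    by_contra hqy
    have := three_le_card (self_mem_bigR hyx.1) hxyR hq hyx.2.ne.symm (Ne.symm hqy) hqx.symm
    omega
  obtain ⟨p, q, hp, hq, -, apq, hqr⟩ := Reaches.exists_exit (P := fun v => v = x ∨ v = y) ha.inReach
    (.inr rfl) (by simp [ha.ne.symm, hay])
  push Not at hq
  have hqW : q ∈ W := InReach.mem hqr
  rcases hp with rfl | rfl
  · exact hq.2 (hRx q (arc_mem_bigR hqW apq) hq.1)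
  · exact hq.2 (hRy q (arc_mem_bigR hqW apq) hq.1)

theorem length_le_two_of_survivor {L : List V} (hL : L.Nodup) (hne : (undNbrs G U x).Nonempty)
    (hy : y ∈ outs G W x) (hc : ∀ s, s ∈ L ↔ Candidate G W U x y s) : L.length ≤ 2 := by
  rcases L with _ | ⟨s₁, _ | ⟨s₂, _ | ⟨s₃, _ | ⟨s₄, L⟩⟩⟩⟩
  · simp
  · simp
  · simp
  · simp only [List.nodup_cons, List.mem_cons, List.not_mem_nil, or_false, not_or] at hL
    exact (not_three_candidates hR hx hne (fun s hs hsU => by simpa using (hc s).2 ⟨hy, hsU, hs⟩)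
      ((hc s₁).1 (by simp)) ((hc s₂).1 (by simp)) ((hc s₃).1 (by simp)) hL.1.1 hL.1.2
      hL.2.1).elim
  · simp only [List.nodup_cons, List.mem_cons, not_or] at hL
    exact (not_four_candidates hR hx ((hc s₁).1 (by simp)) ((hc s₂).1 (by simp))
      ((hc s₃).1 (by simp)) ((hc s₄).1 (by simp)) hL.1.1 hL.1.2.1 hL.2.1.1 hL.1.2.2.1
      hL.2.1.2.1 hL.2.2.1.1).elim

/-- The crude count `(12, 9, 12)` is not enough. Either `s₁` and `s₂` interact and `s₁` gains `3`;
or `s₂` has a further partner `w` and its own branch gains `3`; or `x` and possibly `s₁` are the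
only partners of `s₂`, which becomes free when `s₁` is made a sink, a bonus of `4`. -/
theorem branch_two_survivor_decided {s₁ s₂ : V} (hne : (undNbrs G U x).Nonempty) (hyU : y ∉ U)
    (h₁ : Candidate G W U x y s₁) (h₂ : Candidate G W U x y s₂) (h12 : s₁ ≠ s₂) :
    base ^ measureAfter G W U x ∅ + base ^ measureAfter G W U s₁ ∅ +
      base ^ measureAfter G W U s₂ {s₁} ≤ base ^ measure G W U := by
  have hxW := hR.subset hx
  have hyx := mem_outs.1 h₁.mem_outs
  have hyne : ∀ v ∈ U, v ≠ y := fun v hv e => hyU (e ▸ hv)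
  obtain ⟨v, hv⟩ := hne
  have hvx : x ≠ v := fun e => by simp [← e, mem_undNbrs, not_arc_self] at hv
  have cx := three_le_card (self_mem_interacting (G := G) hR.subset hx)
    (h₁.mem_interacting' hR.subset hx) (h₂.mem_interacting' hR.subset hx) h₁.ne h₂.ne h12
  have cx' := three_le_card (self_mem_bigR hxW) (outs_subset_bigR h₁.mem_outs)
    (undNbrs_subset_bigR (G := G) hR.subset hxW hv) (hyne x hx) hvx
    (hyne v (mem_undNbrs.1 hv).1).symm
  have dx := hR.drop hx (h₁.mem_interacting' hR.subset hx) h₁.ne.symm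
  have cR : ∀ s, Candidate G W U x y s → 3 ≤ (bigR G W s).card := fun s h =>
    three_le_card (self_mem_bigR (hR.subset h.mem)) (h.mem_bigR hxW) h.inReach.mem_bigR
      h.ne.symm (hyne s h.mem) (hyne x hx)
  have r1 := cR _ h₁
  have r2 := cR _ h₂
  have x1 := h₁.mem_interacting hR.subset hx
  have x2 := h₂.mem_interacting hR.subset hx
  have ss1 := self_mem_interacting (G := G) hR.subset h₁.mem
  have ss2 := self_mem_interacting (G := G) hR.subset h₂.mem
  have d1 := hR.drop h₁.mem x1 h₁.ne
  have d2 := hR.drop_lower h₂.mem x2 h₂.ne h₁.mem x1 h₁.ne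
  have c2 : 3 ≤ (insert s₁ (interacting G W U s₂)).card :=
    three_le_card (Finset.mem_insert_self _ _) (Finset.mem_insert_of_mem x2)
      (Finset.mem_insert_of_mem ss2) h₁.ne.symm h12 h₂.ne
  by_cases h21 : s₂ ∈ interacting G W U s₁
  · have := three_le_card ss1 x1 h21 h₁.ne.symm h12 h₂.ne
    exact branch_three (a := 12) (b := 12) (c := 12) (by omega) (by omega) (by omega)
      (by norm_num [base])
  by_cases hw : ∃ w ∈ interacting G W U s₂, w ≠ x ∧ w ≠ s₁ ∧ w ≠ s₂
  · obtain ⟨w, hw, hwx, hw1, hw2⟩ := hw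
    have := four_le_card (Finset.mem_insert_self s₁ (interacting G W U s₂))
      (Finset.mem_insert_of_mem x2)
      (Finset.mem_insert_of_mem ss2) (Finset.mem_insert_of_mem hw) h₁.ne.symm h12 h₂.ne
      hw1.symm hwx.symm hw2.symm
    have := two_le_card ss1 x1 h₁.ne.symm
    exact branch_three (a := 12) (b := 9) (c := 15) (by omega) (by omega) (by omega)
      (by norm_num [base])
  · push Not at hw
    have d1' := hR.drop_free h₁.mem x1 h₁.ne h₂.mem h21 x2 h₂.ne fun w hw' hw2 => by
      by_cases hwx : w = x
      · exact hwx ▸ x1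
      · by_cases hw1 : w = s₁
        · exact hw1 ▸ ss1
        · exact absurd (hw w hw' hwx hw1) hw2
    have := two_le_card ss1 x1 h₁.ne.symm
    exact branch_three (a := 12) (b := 13) (c := 12) (by omega) (by omega) (by omega)
      (by norm_num [base])

/-- The crude count `(11, 11, 12)` is not enough. If `s` has an out-neighbour besides `x`, then
`|R(s)| ≥ 4`, and the path from `y` to `s` leaves `{x, y}`, enlarging `R(x)` or `R(y)`. If not,
`N⁺(s) = {x}`; non-domination then denies `y` the arc to `x`, so `y` has another successor, and `s`
enters `R(x)`. The numbers `m₁`, `m₂` let either of the two branches, with or without lowering, play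
the role of `y`. -/
theorem branch_two_survivor_undecided (hyU : y ∈ U) (h : Candidate G W U x y s) (hsy : s ≠ y)
    (hdom : ¬ outs G W s ⊆ outs G W y) {m₁ m₂ : ℕ}
    (hm₁ : m₁ + (3 * (interacting G W U y).card + (bigR G W y).card) ≤ measure G W U)
    (hm₂ : m₂ + (3 * (interacting G W U s).card + (bigR G W s).card) ≤ measure G W U) :
    base ^ measureAfter G W U x ∅ + base ^ m₁ + base ^ m₂ ≤ base ^ measure G W U := by
  have hxW := hR.subset hx
  have hyx := mem_outs.1 h.mem_outs
  have hxyR : x ∈ bigR G W y := pred_mem_bigR hyx.1 hxW hyx.2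
  have hxR := self_mem_bigR (G := G) hxW
  have hyR := self_mem_bigR (G := G) hyx.1
  have hsR := self_mem_bigR (G := G) (hR.subset h.mem)
  have hyRx := outs_subset_bigR h.mem_outs
  have hxs := h.mem_bigR hxW
  have hys := h.inReach.mem_bigR
  have hxyI : x ∈ interacting G W U y := mem_interacting.2 ⟨hx, .inl hxyR⟩
  have hyxI : y ∈ interacting G W U x := mem_interacting_comm hyU hxyI
  have hysI : y ∈ interacting G W U s := mem_interacting.2 ⟨hyU, .inl hys⟩
  have hsyI : s ∈ interacting G W U y := mem_interacting_comm h.mem hysI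
  have hxI := self_mem_interacting (G := G) hR.subset hx
  have hyI := self_mem_interacting (G := G) hR.subset hyU
  have hsI := self_mem_interacting (G := G) hR.subset h.mem
  have ix := three_le_card hxI hyxI (h.mem_interacting' hR.subset hx) hyx.2.ne h.ne hsy.symm
  have iy := three_le_card hyI hxyI hsyI hyx.2.ne.symm hsy.symm h.ne
  have is := three_le_card hsI hysI (h.mem_interacting hR.subset hx) hsy h.ne.symm hyx.2.ne.symm
  have rx := two_le_card hxR hyRx hyx.2.ne
  have ry := two_le_card hyR hxyR hyx.2.ne.symm
  have rs := three_le_card hsR hys hxs hsy h.ne.symm hyx.2.ne.symm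
  have dx := hR.drop hx hyxI hyx.2.ne.symm
  by_cases hq : ∃ q ∈ outs G W s, q ≠ x
  · obtain ⟨q, hq, hqx⟩ := hq
    have hqs := mem_outs.1 hq
    have hqy : q ≠ y := fun e => h.inReach.not_arc (e ▸ hqs.2)
    have rs' := four_le_card hsR hys hxs (arc_mem_bigR hqs.1 hqs.2) hsy h.ne.symm
      hyx.2.ne.symm hqs.2.ne hqy.symm hqx.symm
    obtain ⟨p, r, hp, hr, -, apr, hrr⟩ := Reaches.exists_exit (P := fun v => v = x ∨ v = y) h.inReach
      (.inr rfl) (by simp [h.ne.symm, hsy])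
    push Not at hr
    have hrW : r ∈ W := InReach.mem hrr
    rcases hp with rfl | rfl
    · have := three_le_card hxR hyRx (arc_mem_bigR hrW apr) hyx.2.ne hr.1.symm hr.2.symm
      exact branch_three (a := 12) (b := 11) (c := 13) (by omega) (by omega) (by omega)
        (by norm_num [base])
    · have := three_le_card hyR hxyR (arc_mem_bigR hrW apr) hyx.2.ne.symm hr.2.symm hr.1.symm
      exact branch_three (a := 11) (b := 12) (c := 13) (by omega) (by omega) (by omega)
        (by norm_num [base])
  · push Not at hq
    obtain ⟨q, hqs, hqy⟩ := Finset.not_subset.1 hdom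
    have := hq q hqs
    subst this
    have hyq : ¬ Arc G y q := fun a => hqy (mem_outs.2 ⟨hxW, a⟩)
    obtain ⟨r, hrW, ar⟩ := hR.exists_succ y hyx.1
    have hrq : r ≠ q := fun e => hyq (e ▸ ar)
    have := three_le_card hyR hxyR (arc_mem_bigR hrW ar) hyx.2.ne.symm ar.ne hrq.symm
    have := three_le_card hxR hyRx (pred_mem_bigR hxW (hR.subset h.mem) (mem_outs.1 hqs).2)
      hyx.2.ne h.ne hsy.symm
    exact branch_three (a := 12) (b := 12) (c := 12) (by omega) (by omega) (by omega)
      (by norm_num [base])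

/-- An undecided `y` belongs to `R⁺(y)`, so it is one of the two candidates. -/
theorem branch_two_survivor {s₁ s₂ : V} (hne : (undNbrs G U x).Nonempty)
    (hpos : ∀ s, InReach G W s y → s ∈ U → s = s₁ ∨ s = s₂)
    (h₁ : Candidate G W U x y s₁) (h₂ : Candidate G W U x y s₂) (h12 : s₁ ≠ s₂)
    (hd1 : ¬ outs G W s₁ ⊆ outs G W s₂) (hd2 : ¬ outs G W s₂ ⊆ outs G W s₁) :
    base ^ measureAfter G W U x ∅ + base ^ measureAfter G W U s₁ ∅ +
      base ^ measureAfter G W U s₂ {s₁} ≤ base ^ measure G W U := by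
  by_cases hyU : y ∈ U
  · have d1 := hR.drop h₁.mem (h₁.mem_interacting hR.subset hx) h₁.ne
    have d2 := hR.drop_lower h₂.mem (h₂.mem_interacting hR.subset hx) h₂.ne h₁.mem
      (h₁.mem_interacting hR.subset hx) h₁.ne
    have := Finset.card_le_card (Finset.subset_insert s₁ (interacting G W U s₂))
    rcases hpos y (.self (mem_outs.1 h₁.mem_outs).1) hyU with rfl | rfl
    · exact branch_two_survivor_undecided hR hx hyU h₂ h12.symm hd2 d1 (by omega)
    · rw [add_right_comm]
      exact branch_two_survivor_undecided hR hx hyU h₁ h12 hd1 (by omega) d1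
  · exact branch_two_survivor_decided hR hx hne hyU h₁ h₂ h12

end Survivor

/-! ### Independent undecided vertices -/

/-- If the undecided vertices are pairwise non-adjacent and `x` is not made a sink, then all of
`R⁺(y)` is, for every `y` whose only undecided in-neighbour is `x`. -/
theorem Compatible.isSink_of_independent (hR : Reduced G W U) (hx : x ∈ U)
    (hind : ∀ u ∈ U, ∀ w ∈ U, ¬ Arc G u w) (h : Candidate G W U x y s)
    (hy : ∀ u ∈ U, Arc G u y → u = x) (hS : Compatible G W U S) (hxs : ¬ IsSink G (W \ S) x) :
    IsSink G (W \ S) s := by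
  have hxW := hR.subset hx
  have hsW := hR.subset h.mem
  have hW : ∀ x ∈ W, ¬ IsSink G W x := fun x hx hs => by
    obtain ⟨w, hw, a⟩ := hR.exists_succ x hx
    exact hs.2 w hw a
  have hyx := mem_outs.1 h.mem_outs
  have hnot : ∀ v ∈ U, v ≠ y := fun v hv e => hind x hx v hv (e ▸ hyx.2)
  -- `s` is not deleted, so if it is not a sink it has a surviving out-neighbour `p`, which reaches
  -- a sink `z` other than `x` and `s`. The aim is to show that `z` would violate the bound `14`.
  by_contra hns
  obtain ⟨p, hp, ap⟩ : ∃ p ∈ W \ S, Arc G s p := by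
    by_contra! hn
    exact hns ⟨Finset.mem_sdiff.2 ⟨hsW, hS.notMem_of_independent hW hind h.mem⟩, hn⟩
  obtain ⟨z, hz, hr⟩ := hS.1.1.2 p hp
  have hpW := (Finset.mem_sdiff.1 hp).1
  have hzU := hS.mem_of_isSink hW hz
  have hzp : InReach G W z p := hr.inReach hz
  have hzx : z ≠ x := fun e => hxs (e ▸ hz)
  have hzs : z ≠ s := fun e => hns (e ▸ hz)
  have hpU : ∀ v ∈ U, v ≠ p := fun v hv e => hind s h.mem v hv (e ▸ ap)
  have hzs' : InReach G W z s := hzp.step hsW (hind z hzU s h.mem) ap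
  have hpy : p ≠ y := fun e => h.inReach.not_arc (e ▸ ap)
  -- the undecided vertices of `R(s)` are `x` and `s`
  have hRs : ∀ t ∈ U, t ∈ bigR G W s → t = x ∨ t = s := fun t ht htR => by
    by_contra! hn
    have hti : InReach G W s t := (mem_bigR.1 htR).2.resolve_left (hind s h.mem t ht)
    have hI := three_le_card (self_mem_interacting (G := G) hR.subset h.mem)
      (h.mem_interacting hR.subset hx) (mem_interacting.2 ⟨ht, .inl htR⟩) h.ne.symm hn.2.symm
      hn.1.symm
    -- `d` is the next vertex after `t` on its path to `s`. It is decided and differs from `y` and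
    -- `p`, so `R(s)` has the six elements `s, x, t, y, p, d`, and `3·3 + 6 = 15`.
    obtain ⟨c, d, rfl, hcd, -, a, hd⟩ := Reaches.exists_exit (P := fun v => v = t) hti rfl
      hn.2.symm
    have hdU : ∀ v ∈ U, v ≠ d := fun v hv e => hind c ht v hv (e ▸ a)
    have hdy : d ≠ y := fun e => hn.1 (hy c ht (e ▸ a))
    have hdi : InReach G W s d := hd
    have hdp : d ≠ p := fun e => hdi.not_arc (e ▸ ap)
    have h5 : 5 ≤ ((bigR G W s).erase d).card := five_le_card (a := s) (b := x) (c := c) (d := y) (e := p)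
      (Finset.mem_erase.2 ⟨hdU _ h.mem, self_mem_bigR hsW⟩)
      (Finset.mem_erase.2 ⟨hdU _ hx, h.mem_bigR hxW⟩)
      (Finset.mem_erase.2 ⟨hdU _ ht, htR⟩)
      (Finset.mem_erase.2 ⟨hdy.symm, h.inReach.mem_bigR⟩)
      (Finset.mem_erase.2 ⟨hdp.symm, arc_mem_bigR hpW ap⟩)
      h.ne.symm hn.2.symm hn.1.symm (hnot _ h.mem) (hnot _ hx) (hnot _ ht)
      (hpU _ h.mem) (hpU _ hx) (hpU _ ht) hpy.symm
    have := Finset.card_erase_add_one hdi.mem_bigR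
    have := hR.drop_le s h.mem
    omega
  have hzR : ¬ InReach G W s z := fun hi => by
    rcases hRs z hzU hi.mem_bigR with e | e
    exacts [hzx e, hzs e]
  -- hence `y` reaches `z`
  have hyz : InReach G W z y := by
    -- Pulling back from `s`: a vertex of `R⁻(s)` fails to reach `z` only if the path meets an
    -- out-neighbour of `z`, and if that happened before the end, `z` itself would be in `R⁻(s)`.
    have key : ∀ v, InReach G W s v → InReach G W z v ∨ Arc G z v := fun v hv => by
      refine hv.induction_on (P := fun v => InReach G W z v ∨ Arc G z v) (.inl hzs') fun u w hu hn a hw ih => ?_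
      rcases ih with ih | ih
      · by_cases hzu : Arc G z u
        · exact .inr hzu
        · exact .inl (ih.step hu hzu a)
      · exact absurd (hw.step (hR.subset hzU) (hind s h.mem z hzU) ih) hzR
    exact (key y h.inReach).resolve_right fun a => hzx (hy z hzU a)
  -- Now `R(z)` contains `z, x, s, y, p` and a successor `n` of `z`, while `z, x, s` interact: again
  -- `3·3 + 6 = 15`.
  obtain ⟨n, hnW, an⟩ := hR.exists_succ z (hR.subset hzU)
  have hnU : ∀ v ∈ U, v ≠ n := fun v hv e => hind z hzU v hv (e ▸ an)
  have hxz : InReach G W z x := hyz.step hxW (hind z hzU x hx) hyx.2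
  have hI := three_le_card (self_mem_interacting (G := G) hR.subset hzU)
    (mem_interacting.2 ⟨hx, .inl hxz.mem_bigR⟩) (mem_interacting.2 ⟨h.mem, .inl hzs'.mem_bigR⟩)
    hzx hzs h.ne
  have h5 : 5 ≤ ((bigR G W z).erase n).card := five_le_card (a := z) (b := x) (c := s) (d := y) (e := p)
    (Finset.mem_erase.2 ⟨hnU _ hzU, self_mem_bigR (hR.subset hzU)⟩)
    (Finset.mem_erase.2 ⟨hnU _ hx, hxz.mem_bigR⟩)
    (Finset.mem_erase.2 ⟨hnU _ h.mem, hzs'.mem_bigR⟩)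
    (Finset.mem_erase.2 ⟨fun e => hyz.not_arc (e ▸ an), hyz.mem_bigR⟩)
    (Finset.mem_erase.2 ⟨fun e => hzp.not_arc (e ▸ an), hzp.mem_bigR⟩)
    hzx hzs h.ne (hnot _ hzU) (hnot _ hx) (hnot _ h.mem)
    (hpU _ hzU) (hpU _ hx) (hpU _ h.mem) hpy.symm
  have := Finset.card_erase_add_one (arc_mem_bigR hnW an)
  have := hR.drop_le z hzU
  omega

end KFVD

namespace KFVD

/-! ## Running programs -/

section Programs

variable {α β : Type} {V : Type}

/-- The program `p` terminates with value `a` after at most `c` steps. -/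
def Computes (p : Prog α) (a : α) (c : ℕ) : Prop :=
  ∀ t, ∃ t', p.run t = some (a, t') ∧ t' ≤ t + c

namespace Computes

theorem pure (a : α) (c : ℕ) : Computes (Pure.pure a : Prog α) a c := fun t =>
  ⟨t, rfl, Nat.le_add_right _ _⟩

theorem tick : Computes KFVD.tick () 1 := fun t => ⟨t + 1, rfl, le_rfl⟩

theorem bind {p : Prog α} {f : α → Prog β} {a : α} {b : β} {c d : ℕ} (hp : Computes p a c)
    (hf : Computes (f a) b d) : Computes (p >>= f) b (c + d) := fun t => by
  obtain ⟨t', h, ht⟩ := hp t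
  obtain ⟨t'', h', ht'⟩ := hf t'
  refine ⟨t'', ?_, by omega⟩
  rw [StateT.run_bind, h]
  exact h'

theorem mono {p : Prog α} {a : α} {c d : ℕ} (hp : Computes p a c) (h : c ≤ d) :
    Computes p a d := fun t => by
  obtain ⟨t', h', ht⟩ := hp t
  exact ⟨t', h', by omega⟩

theorem bind_pure {p : Prog α} {f : α → β} {a : α} {c : ℕ} (hp : Computes p a c) :
    Computes (p >>= fun a => Pure.pure (f a)) (f a) c :=
  bind (f := fun a => Pure.pure (f a)) hp (pure (f a) 0)

theorem bind_le {p : Prog α} {f : α → Prog β} {a : α} {b : β} {c d e : ℕ} (hp : Computes p a c)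
    (hf : Computes (f a) b d) (h : c + d ≤ e) : Computes (p >>= f) b e :=
  (bind hp hf).mono h

/-- All costs are powers of one number `B ≥ 2`, since two summands of exponent below `k` fit into `B
^ k`. Sequencing thus costs one exponent and, by `loop_cost`, a loop over fewer than `B` items costs
two. -/
theorem bind_pow {p : Prog α} {f : α → Prog β} {a : α} {b : β} {B i j : ℕ} (k : ℕ) (hB : 2 ≤ B)
    (hp : Computes p a (B ^ i)) (hf : Computes (f a) b (B ^ j)) (hi : i < k) (hj : j < k) :
    Computes (p >>= f) b (B ^ k) := by
  refine (bind hp hf).mono ?_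
  obtain ⟨k, rfl⟩ : ∃ l, k = l + 1 := ⟨k - 1, by omega⟩
  have h1 : B ^ i ≤ B ^ k := Nat.pow_le_pow_right (by omega) (by omega)
  have h2 : B ^ j ≤ B ^ k := Nat.pow_le_pow_right (by omega) (by omega)
  rw [pow_succ]
  have h3 := Nat.mul_le_mul_left (B ^ k) hB
  omega

theorem pow_mono {p : Prog α} {a : α} {B i : ℕ} (k : ℕ) (hB : 2 ≤ B) (hp : Computes p a (B ^ i))
    (hik : i ≤ k) : Computes p a (B ^ k) :=
  hp.mono (Nat.pow_le_pow_right (by omega) hik)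

theorem tick_pow {B : ℕ} (k : ℕ) (hB : 2 ≤ B) : Computes KFVD.tick () (B ^ k) :=
  tick.mono (Nat.one_le_pow _ _ (by omega))

end Computes

theorem loop_cost {B k n : ℕ} (hB : 2 ≤ B) (hn : n + 1 ≤ B) :
    n * (B ^ k + 1) + 1 ≤ B ^ (k + 2) := by
  have h1 : 1 ≤ B ^ k := Nat.one_le_pow _ _ (by omega)
  have h2 : B ^ (k + 2) = B * (B * B ^ k) := by ring
  have h3 : B ^ k + 1 ≤ B * B ^ k := by nlinarith
  rw [h2]
  calc n * (B ^ k + 1) + 1 ≤ (n + 1) * (B ^ k + 1) := by nlinarith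
    _ ≤ B * (B * B ^ k) := Nat.mul_le_mul hn h3

theorem filterP_computes {p : V → Prog Bool} {q : V → Bool} {c : ℕ} {l : List V}
    (h : ∀ a ∈ l, Computes (p a) (q a) c) :
    Computes (filterP p l) (l.filter q) (l.length * (c + 1) + 1) := by
  induction l with
  | nil => exact Computes.bind_le (e := _ + 1) .tick (.pure [] 0) (by omega)
  | cons a l ih =>
    rw [List.filter_cons, filterP]
    refine Computes.bind_le .tick (.bind (h a (by simp))
      (.bind_pure (f := fun r => if q a then a :: r else r) (ih fun b hb => h b (by simp [hb])))) ?_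
    simp only [List.length_cons, add_mul]
    omega

theorem findP_computes {p : V → Prog Bool} {q : V → Bool} {c : ℕ} {l : List V}
    (h : ∀ a ∈ l, Computes (p a) (q a) c) :
    Computes (findP p l) (l.find? q) (l.length * (c + 1) + 1) := by
  induction l with
  | nil => exact Computes.bind_le (e := _ + 1) .tick (.pure none 0) (by omega)
  | cons a l ih =>
    have key : Computes (if q a then (pure (some a) : Prog (Option V)) else findP p l)
        ((a :: l).find? q) (l.length * (c + 1) + 1) := by
      cases hq : q a
      · simpa [hq] using ih fun b hb => h b (by simp [hb])
      · simpa [hq] using Computes.pure (some a) _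
    rw [findP]
    refine Computes.bind_le .tick (.bind (h a (by simp)) key) ?_
    simp only [List.length_cons, add_mul]
    omega

/-! ### Costs of the list procedures as powers of `B` -/

section Pow

variable {B k : ℕ} {l : List V}

theorem filterP_pow {p : V → Prog Bool} {q : V → Bool} (hB : 2 ≤ B) (hl : l.length + 1 ≤ B)
    (h : ∀ a ∈ l, Computes (p a) (q a) (B ^ k)) :
    Computes (filterP p l) (l.filter q) (B ^ (k + 2)) :=
  (filterP_computes h).mono (loop_cost hB hl)

theorem findP_pow {p : V → Prog Bool} {q : V → Bool} (hB : 2 ≤ B) (hl : l.length + 1 ≤ B)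
    (h : ∀ a ∈ l, Computes (p a) (q a) (B ^ k)) :
    Computes (findP p l) (l.find? q) (B ^ (k + 2)) :=
  (findP_computes h).mono (loop_cost hB hl)

theorem anyP_pow {p : V → Prog Bool} {q : V → Bool} (hB : 2 ≤ B) (hl : l.length + 1 ≤ B)
    (h : ∀ a ∈ l, Computes (p a) (q a) (B ^ k)) :
    Computes (anyP p l) (l.any q) (B ^ (k + 2)) := by
  have := (findP_pow hB hl h).bind_pure (f := Option.isSome)
  rwa [List.isSome_find?] at this

theorem allP_pow {p : V → Prog Bool} {q : V → Bool} (hB : 2 ≤ B) (hl : l.length + 1 ≤ B)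
    (h : ∀ a ∈ l, Computes (p a) (q a) (B ^ k)) :
    Computes (allP p l) (l.all q) (B ^ (k + 2)) := by
  have := (findP_pow (q := fun a => !q a) hB hl fun a ha =>
    (h a ha).bind_pure (f := not)).bind_pure (f := Option.isNone)
  rw [← Option.not_isSome, List.isSome_find?, List.not_any_eq_all_not] at this
  simp only [Bool.not_not] at this
  exact this

theorem lengthP_pow (hl : l.length + 1 ≤ B) :
    Computes (lengthP l) l.length (B ^ 1) := by
  have : Computes (lengthP l) l.length (l.length + 1) := by
    clear hl
    induction l with
    | nil => exact Computes.bind_le (e := 1) .tick (.pure 0 0) (by omega)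
    | cons a l ih =>
      refine Computes.bind_le .tick (.bind_pure (f := (· + 1)) ih) ?_
      simp only [List.length_cons]
      omega
  exact this.mono (by simpa using hl)

theorem appendP_pow {l' : List V} (hl : l.length + 1 ≤ B) :
    Computes (appendP l l') (l ++ l') (B ^ 1) := by
  have : Computes (appendP l l') (l ++ l') (l.length + 1) := by
    clear hl
    induction l with
    | nil => exact Computes.bind_le (e := 1) .tick (.pure l' 0) (by omega)
    | cons a l ih =>
      refine Computes.bind_le .tick (.bind_pure (f := fun r => a :: r) ih) ?_
      simp only [List.length_cons]
      omega
  exact this.mono (by simpa using hl)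

theorem argmaxFrom_pow {f : V → Prog ℕ} {g : V → ℕ} (hB : 2 ≤ B) (hl : l.length + 1 ≤ B)
    (a : V) (h : ∀ b ∈ l, Computes (f b) (g b) (B ^ k)) :
    ∃ x ∈ a :: l, (∀ b ∈ a :: l, g b ≤ g x) ∧
      Computes (argmaxFrom f a (g a) l) x (B ^ (k + 2)) := by
  suffices ∃ x ∈ a :: l, (∀ b ∈ a :: l, g b ≤ g x) ∧
      Computes (argmaxFrom f a (g a) l) x (l.length * (B ^ k + 1) + 1) by
    obtain ⟨x, hx, hm, hc⟩ := this
    exact ⟨x, hx, hm, hc.mono (loop_cost hB hl)⟩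
  clear hl
  induction l generalizing a with
  | nil => exact ⟨a, by simp, by simp, Computes.bind_le (e := _ + 1) .tick (.pure a 0) (by omega)⟩
  | cons b l ih =>
    have hstep : ∀ x, Computes (if g a < g b then argmaxFrom f b (g b) l
        else argmaxFrom f a (g a) l) x (l.length * (B ^ k + 1) + 1) →
        Computes (argmaxFrom f a (g a) (b :: l)) x ((b :: l).length * (B ^ k + 1) + 1) :=
      fun x hx => by
        rw [argmaxFrom]
        refine Computes.bind_le .tick (.bind (h b (by simp)) hx) ?_
        simp only [List.length_cons, add_mul]
        omega
    by_cases hab : g a < g b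
    · obtain ⟨x, hx, hm, hc⟩ := ih b fun c hc => h c (by simp [hc])
      refine ⟨x, by simp at hx ⊢; tauto, fun c hc => ?_, hstep x (by rwa [if_pos hab])⟩
      rcases List.mem_cons.1 hc with rfl | hc
      · exact hab.le.trans (hm b (by simp))
      · exact hm c hc
    · obtain ⟨x, hx, hm, hc⟩ := ih a fun c hc => h c (by simp [hc])
      refine ⟨x, by simp at hx ⊢; tauto, fun c hc => ?_, hstep x (by rwa [if_neg hab])⟩
      rcases List.mem_cons.1 hc with rfl | hc
      · exact hm c (by simp)
      · rcases List.mem_cons.1 hc with rfl | hc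
        · exact (not_lt.1 hab).trans (hm a (by simp))
        · exact hm c (by simp [hc])

variable [DecidableEq V]

theorem sameP_pow (hB : 2 ≤ B) (u v : V) : Computes (sameP u v) (decide (u = v)) (B ^ 0) :=
  Computes.bind_pure (f := fun _ => decide (u = v)) (.tick_pow 0 hB)

theorem memP_pow (hB : 2 ≤ B) (hl : l.length + 1 ≤ B) (v : V) :
    Computes (memP v l) (decide (v ∈ l)) (B ^ 2) := by
  have h : decide (v ∈ l) = l.any fun a => decide (v = a) := by
    rw [Bool.eq_iff_iff]
    simp
  rw [h]
  exact anyP_pow hB hl fun a _ => sameP_pow hB v a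

theorem diffP_pow {l' : List V} (hB : 2 ≤ B) (hl : l.length + 1 ≤ B) (hl' : l'.length + 1 ≤ B) :
    Computes (diffP l l') (l.filter (· ∉ l')) (B ^ 4) := by
  simp only [decide_not]
  exact filterP_pow (l := l) hB hl fun a _ => (memP_pow hB hl' a).bind_pure (f := not)

theorem interP_pow {l' : List V} (hB : 2 ≤ B) (hl : l.length + 1 ≤ B) (hl' : l'.length + 1 ≤ B) :
    Computes (interP l l') (l.filter (· ∈ l')) (B ^ 4) :=
  filterP_pow (l := l) hB hl fun a _ => memP_pow hB hl' a

end Pow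

end Programs

end KFVD

namespace KFVD

variable {V : Type} [DecidableEq V]

/-! ## Instances -/

namespace Inst

/-- The vertices of an instance, in the order in which they are stored. -/
def verts (I : Inst V) : List V := I.und ++ I.semi

/-- The vertex set of an instance. -/
def vertSet (I : Inst V) : Finset V := I.verts.toFinset

/-- The set of undecided vertices of an instance. -/
def undSet (I : Inst V) : Finset V := I.und.toFinset

/-- `I` is stored without repetitions and is small compared with `B`. -/
structure Fits (I : Inst V) (B : ℕ) : Prop where
  nodup : I.verts.Nodup
  size : 2 * I.verts.length + 2 ≤ B

/-- `D - X`. -/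
def delete (I : Inst V) (X : List V) : Inst V :=
  ⟨I.und.filter (· ∉ X), I.semi.filter (· ∉ X)⟩

/-- `I` with the potentials of the vertices of `X` lowered. -/
def lower (I : Inst V) (X : List V) : Inst V :=
  ⟨I.und.filter (· ∉ X), I.und.filter (· ∈ X) ++ I.semi⟩

variable {I : Inst V} {X : List V} {B : ℕ} {v : V}

theorem mem_vertSet : v ∈ I.vertSet ↔ v ∈ I.verts := List.mem_toFinset

theorem mem_undSet : v ∈ I.undSet ↔ v ∈ I.und := List.mem_toFinset

theorem undSet_subset : I.undSet ⊆ I.vertSet := fun v hv => by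
  simp only [mem_undSet, mem_vertSet, verts, List.mem_append] at hv ⊢
  exact .inl hv

theorem verts_delete : (I.delete X).verts = I.verts.filter (· ∉ X) := by
  simp [verts, delete]

theorem vertSet_delete : (I.delete X).vertSet = I.vertSet \ X.toFinset := by
  ext v
  simp [mem_vertSet, verts_delete]

theorem undSet_delete : (I.delete X).undSet = I.undSet \ X.toFinset := by
  ext v
  simp [mem_undSet, delete]

theorem verts_lower : (I.lower X).verts.Perm I.verts := by
  have h := List.filter_append_perm (fun v => decide (v ∉ X)) I.und
  have h2 : (fun v => !decide (v ∉ X)) = fun v => decide (v ∈ X) := by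
    funext v
    simp
  rw [h2] at h
  simpa [verts, lower] using h.append_right I.semi

theorem vertSet_lower : (I.lower X).vertSet = I.vertSet := by
  ext v
  simp only [mem_vertSet, verts_lower.mem_iff]

theorem undSet_lower : (I.lower X).undSet = I.undSet \ X.toFinset := by
  ext v
  simp [mem_undSet, lower]

namespace Fits

omit [DecidableEq V] in
theorem two_le (h : I.Fits B) : 2 ≤ B := by have := h.size; omega

omit [DecidableEq V] in
theorem verts_lt (h : I.Fits B) : I.verts.length + 1 ≤ B := by have := h.size; omega

omit [DecidableEq V] in
theorem und_length (_ : I.Fits B) : I.und.length ≤ I.verts.length := by simp [verts]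

omit [DecidableEq V] in
theorem semi_length (_ : I.Fits B) : I.semi.length ≤ I.verts.length := by simp [verts]

omit [DecidableEq V] in
theorem und_lt (h : I.Fits B) : I.und.length + 1 ≤ B := by
  have := h.verts_lt
  have := h.und_length
  omega

omit [DecidableEq V] in
theorem semi_lt (h : I.Fits B) : I.semi.length + 1 ≤ B := by
  have := h.verts_lt
  have := h.semi_length
  omega

omit [DecidableEq V] in
theorem und_nodup (h : I.Fits B) : I.und.Nodup := h.nodup.of_append_left

theorem delete (h : I.Fits B) (X : List V) : (I.delete X).Fits B := by
  refine ⟨?_, ?_⟩ <;> rw [verts_delete]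
  · exact h.nodup.filter _
  · have := List.length_filter_le (fun v => decide (v ∉ X)) I.verts
    have := h.size
    omega

theorem lower (h : I.Fits B) (X : List V) : (I.lower X).Fits B :=
  ⟨verts_lower.nodup_iff.2 h.nodup, by rw [verts_lower.length_eq]; exact h.size⟩

end Fits

end Inst

/-! ## The procedures on instances -/

section Procedures

variable {G : Digraph V} [DecidableRel G.Adj] {I : Inst V} {B : ℕ} {u v w x s : V}

instance : DecidableRel (Arc G) := fun u v => inferInstanceAs (Decidable (u ≠ v ∧ G.Adj u v))

omit [DecidableEq V] in
theorem filter_length_lt {l : List V} (p : V → Bool) (h : l.length + 1 ≤ B) :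
    (l.filter p).length + 1 ≤ B := by
  have := List.length_filter_le p l
  omega

theorem arcP_pow (hB : 2 ≤ B) (u v : V) : Computes (arcP G u v) (decide (Arc G u v)) (B ^ 0) :=
  .bind_pure (f := fun _ => decide (Arc G u v)) (.tick_pow 0 hB)

omit [DecidableEq V] in
theorem vertsP_pow (h : I.Fits B) : Computes (vertsP I) I.verts (B ^ 1) := appendP_pow h.und_lt

/-- The list computed for `N⁺(v)`. -/
def outList (G : Digraph V) [DecidableRel G.Adj] (I : Inst V) (v : V) : List V :=
  I.verts.filter fun w => decide (Arc G v w)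

theorem mem_outList : w ∈ outList G I v ↔ w ∈ outs G I.vertSet v := by
  simp [outList, mem_outs, Inst.mem_vertSet]

theorem toFinset_outList : (outList G I v).toFinset = outs G I.vertSet v := by
  ext w
  simp [mem_outList]

theorem outList_lt (h : I.Fits B) : (outList G I v).length + 1 ≤ B :=
  filter_length_lt _ h.verts_lt

theorem outP_pow (h : I.Fits B) (v : V) : Computes (outP G I v) (outList G I v) (B ^ 3) :=
  .bind_pow 3 h.two_le (vertsP_pow h)
    (filterP_pow h.two_le h.verts_lt fun w _ => arcP_pow h.two_le v w) (by omega) (by omega)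

theorem inP_pow (h : I.Fits B) (v : V) :
    Computes (inP G I v) (I.verts.filter fun w => decide (Arc G w v)) (B ^ 3) :=
  .bind_pow 3 h.two_le (vertsP_pow h)
    (filterP_pow h.two_le h.verts_lt fun w _ => arcP_pow h.two_le w v) (by omega) (by omega)

theorem orP_pow {p r : Prog Bool} {a b : Bool} {i : ℕ} (hB : 2 ≤ B) (hp : Computes p a (B ^ i))
    (hr : Computes r b (B ^ i)) :
    Computes (do let e ← p; if e then return true else r) (a || b) (B ^ (i + 1)) := by
  refine .bind_pow (i + 1) hB hp (j := i) ?_ (by omega) (by omega)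
  cases a
  · simpa using hr
  · simpa using Computes.pure true _

theorem undNbrsP_pow (h : I.Fits B) (v : V) : Computes (undNbrsP G I v)
    (I.und.filter fun w => decide (Arc G v w) || decide (Arc G w v)) (B ^ 3) :=
  filterP_pow h.two_le h.und_lt fun w _ =>
    orP_pow h.two_le (arcP_pow h.two_le v w) (arcP_pow h.two_le w v)

theorem undDegP_pow (h : I.Fits B) (v : V) :
    Computes (do let l ← undNbrsP G I v; lengthP l) (undNbrs G I.undSet v).card (B ^ 4) := by
  have e : (undNbrs G I.undSet v).card =
      (I.und.filter fun w => decide (Arc G v w) || decide (Arc G w v)).length := by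
    rw [← List.toFinset_card_of_nodup (h.und_nodup.filter _)]
    congr 1
    ext w
    simp [mem_undNbrs, Inst.mem_undSet]
  rw [e]
  exact .bind_pow 4 h.two_le (undNbrsP_pow h v) (lengthP_pow (filter_length_lt _ h.und_lt))
    (by omega) (by omega)

/-! ### Backward search -/

/-- One round of backward search. -/
def growStep (G : Digraph V) [DecidableRel G.Adj] (avail R : List V) : List V :=
  avail.filter fun u => R.any fun w => decide (u = w) || decide (Arc G u w)

/-- `k` rounds of backward search. -/
def growList (G : Digraph V) [DecidableRel G.Adj] (avail : List V) : ℕ → List V → List V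
  | 0, R => R
  | k + 1, R => growList G avail k (growStep G avail R)

theorem growP_computes {avail : List V} (hB : 2 ≤ B) (ha : avail.length + 1 ≤ B) (k : ℕ)
    {R : List V} (hR : R.length + 1 ≤ B) :
    Computes (growP G avail k R) (growList G avail k R) (k * (B ^ 5 + 1) + 1) := by
  induction k generalizing R with
  | zero => exact .bind_le (e := _ + 1) .tick (.pure R 0) (by omega)
  | succ k ih =>
    rw [growP]
    refine .bind_le .tick (.bind (a := growStep G avail R) (c := B ^ 5) ?_
      (ih (filter_length_lt _ ha))) (by rw [add_mul]; omega)
    exact filterP_pow hB ha fun u _ => anyP_pow hB hR fun w _ =>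
      orP_pow hB (sameP_pow hB u w) (arcP_pow hB u w)

open scoped Classical in
-- Once the search is saturated, a further round changes only the order: the result is listed in the
-- order of `avail`.
theorem growStep_of_complete {avail R : List V}
    (hR : ∀ u, u ∈ R ↔ Reaches G avail.toFinset v u) :
    growStep G avail R = avail.filter fun u => decide (Reaches G avail.toFinset v u) := by
  refine List.filter_congr fun u hu => ?_
  rw [Bool.eq_iff_iff]
  simp only [List.any_eq_true, Bool.or_eq_true, decide_eq_true_eq]
  constructor
  · rintro ⟨w, hw, rfl | a⟩
    · exact (hR _).1 hw
    · exact .step (by simpa using hu) a ((hR _).1 hw)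
  · exact fun h => ⟨u, (hR u).2 h, .inl rfl⟩

open scoped Classical in
theorem growList_of_complete {avail : List V} (k : ℕ) {R : List V}
    (hR : ∀ u, u ∈ R ↔ Reaches G avail.toFinset v u) :
    growList G avail (k + 1) R = avail.filter fun u => decide (Reaches G avail.toFinset v u) := by
  induction k generalizing R with
  | zero => exact growStep_of_complete hR
  | succ k ih =>
    rw [growList]
    refine ih fun u => ?_
    rw [growStep_of_complete hR, List.mem_filter, decide_eq_true_eq, and_iff_right_iff_imp]
    exact fun h => by simpa using h.mem_left

open scoped Classical in
-- Each round either starts saturated or gains a vertex, namely the last one outside `R` before a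
-- path enters `R`. So `k` rounds saturate, and the extra one brings the list into the order of
-- `avail`.
theorem growList_eq {avail : List V} {k : ℕ} {R : List V} (hv : v ∈ R)
    (hR : ∀ u ∈ R, Reaches G avail.toFinset v u)
    (hk : (avail.toFinset.filter (Reaches G avail.toFinset v)).card ≤ R.toFinset.card + k) :
    growList G avail (k + 1) R = avail.filter fun u => decide (Reaches G avail.toFinset v u) := by
  have hstep : ∀ u, u ∈ growStep G avail R ↔ u ∈ avail ∧ ∃ w ∈ R, u = w ∨ Arc G u w := fun u => by
    simp [growStep]
  have hsound : ∀ u ∈ growStep G avail R, Reaches G avail.toFinset v u := fun u hu => by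
    obtain ⟨ha, w, hw, rfl | a⟩ := (hstep u).1 hu
    · exact hR u hw
    · exact .step (by simpa using ha) a (hR w hw)
  have hsub : ∀ u ∈ R, u ∈ growStep G avail R := fun u hu =>
    (hstep u).2 ⟨by simpa using (hR u hu).mem_left, u, hu, .inl rfl⟩
  by_cases hfull : ∀ u, Reaches G avail.toFinset v u → u ∈ R
  · exact growList_of_complete k fun u => ⟨hR u, hfull u⟩
  · push Not at hfull
    obtain ⟨u, hu, huR⟩ := hfull
    obtain ⟨p, q, hp, hq, hpX, a, hqr⟩ := hu.exists_exit (P := fun u => u ∉ R) huR (by simpa using hv)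
    have hlt : R.toFinset.card + 1 ≤ (growStep G avail R).toFinset.card :=
      card_lt_of_notMem (a := p) (fun u hu => by
        simp only [List.mem_toFinset] at hu ⊢
        exact hsub u hu) (by
        rw [List.mem_toFinset, hstep]
        exact ⟨by simpa using hpX, q, by simpa using hq, .inr a⟩) (by simpa using hp)
    cases k with
    | zero =>
      have : (growStep G avail R).toFinset ⊆
          avail.toFinset.filter (Reaches G avail.toFinset v) := fun u hu => by
        rw [List.mem_toFinset] at hu
        exact Finset.mem_filter.2 ⟨(hsound u hu).mem_left, hsound u hu⟩
      have := Finset.card_le_card this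
      omega
    | succ k =>
      rw [growList]
      exact growList_eq (hsub v hv) hsound (by omega)
termination_by k

open scoped Classical in
/-- The list computed for `R⁻(v)`. -/
noncomputable def inReachList (G : Digraph V) (I : Inst V) (v : V) : List V :=
  I.verts.filter fun u => decide (InReach G I.vertSet v u)

omit [DecidableRel G.Adj] in
theorem mem_inReachList : u ∈ inReachList G I v ↔ InReach G I.vertSet v u := by
  simp only [inReachList, List.mem_filter, decide_eq_true_eq, and_iff_right_iff_imp]
  exact fun h => Inst.mem_vertSet.1 h.mem

omit [DecidableRel G.Adj] in
theorem inReachList_lt (h : I.Fits B) : (inReachList G I v).length + 1 ≤ B :=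
  filter_length_lt _ h.verts_lt

theorem inReachP_pow (h : I.Fits B) (hv : v ∈ I.vertSet) :
    Computes (inReachP G I v) (inReachList G I v) (B ^ 11) := by
  set avail := I.verts.filter (· ∉ outList G I v) with havail
  have hav : avail.toFinset = I.vertSet \ outs G I.vertSet v := by
    ext u
    simp [havail, mem_outList, Inst.mem_vertSet]
  have hvr : Reaches G avail.toFinset v v := by
    rw [hav]
    exact InReach.self hv
  obtain ⟨k, hk⟩ : ∃ k, I.verts.length = k + 1 :=
    ⟨I.verts.length - 1, by
      have := List.length_pos_of_mem (Inst.mem_vertSet.1 hv)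
      omega⟩
  have hgrow : growList G avail I.verts.length [v] = inReachList G I v := by
    classical
    -- The start `[v]` already counts one vertex, so as many rounds as there are vertices include
    -- the spare one.
    rw [hk, growList_eq (List.mem_singleton_self v) (by simpa using hvr)]
    · rw [havail, List.filter_filter, ← havail, hav]
      refine List.filter_congr fun u hu => ?_
      rw [Bool.eq_iff_iff]
      simp only [Bool.and_eq_true, decide_eq_true_eq, mem_outList]
      exact ⟨fun h => h.1, fun h => ⟨h, (Finset.mem_sdiff.1 (Reaches.mem_left h)).2⟩⟩
    · have h1 := Finset.card_filter_le avail.toFinset (Reaches G avail.toFinset v)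
      have h2 := avail.toFinset_card_le
      have h3 : avail.length ≤ I.verts.length := List.length_filter_le _ _
      simp only [List.toFinset_cons, List.toFinset_nil, insert_empty_eq, Finset.card_singleton]
      omega
  have hB := h.two_le
  rw [← hgrow]
  refine .bind_pow 11 hB (vertsP_pow h) (j := 10) ?_ (by omega) (by omega)
  refine .bind_pow 10 hB (outP_pow h v) (j := 9) ?_ (by omega) (by omega)
  refine .bind_pow 9 hB (diffP_pow hB h.verts_lt (outList_lt h)) (j := 8) ?_ (by omega) (by omega)
  refine .bind_pow 8 hB (lengthP_pow h.verts_lt) (j := 7) ?_ (by omega) (by omega)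
  exact (growP_computes hB (filter_length_lt _ h.verts_lt) _
    (by simpa using hB)).mono (loop_cost hB h.verts_lt)

/-- The list computed for `R(v)`. -/
noncomputable def bigRList (G : Digraph V) [DecidableRel G.Adj] (I : Inst V) (v : V) : List V :=
  outList G I v ++ inReachList G I v

theorem mem_bigRList : u ∈ bigRList G I v ↔ u ∈ bigR G I.vertSet v := by
  rw [bigRList, List.mem_append, mem_outList, mem_inReachList, mem_outs, mem_bigR]
  exact ⟨fun h => h.elim (fun h => ⟨h.1, .inl h.2⟩) fun h => ⟨h.mem, .inr h⟩,
    fun h => h.2.imp (fun a => ⟨h.1, a⟩) id⟩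

theorem toFinset_bigRList : (bigRList G I v).toFinset = bigR G I.vertSet v := by
  ext u
  simp [mem_bigRList]

/-- `R(v)` is stored as a concatenation of two sublists of the vertex list; this is why `Fits` asks
for twice the number of vertices. -/
theorem bigRList_lt (h : I.Fits B) : (bigRList G I v).length + 1 ≤ B := by
  have h1 : (outList G I v).length ≤ I.verts.length := List.length_filter_le _ _
  have h2 : (inReachList G I v).length ≤ I.verts.length := List.length_filter_le _ _
  have := h.size
  rw [bigRList, List.length_append]
  omega

theorem bigRP_pow (h : I.Fits B) (hv : v ∈ I.vertSet) :
    Computes (bigRP G I v) (bigRList G I v) (B ^ 13) := by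
  refine .bind_pow 13 h.two_le (outP_pow h v) (j := 12) ?_ (by omega) (by omega)
  exact .bind_pow 12 h.two_le (inReachP_pow h hv) (appendP_pow (outList_lt h)) (by omega) (by omega)

open scoped Classical in
/-- The list computed for `R⁺(v)`. -/
noncomputable def outReachList (G : Digraph V) (I : Inst V) (v : V) : List V :=
  I.und.filter fun u => decide (InReach G I.vertSet u v)

omit [DecidableRel G.Adj] in
theorem mem_outReachList : u ∈ outReachList G I v ↔ u ∈ I.undSet ∧ InReach G I.vertSet u v := by
  simp [outReachList, Inst.mem_undSet]

omit [DecidableRel G.Adj] in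
theorem outReachList_lt (h : I.Fits B) : (outReachList G I v).length + 1 ≤ B :=
  filter_length_lt _ h.und_lt

theorem mem_vertSet_of_mem_und (h : u ∈ I.und) : u ∈ I.vertSet :=
  Inst.undSet_subset (Inst.mem_undSet.2 h)

theorem outReachP_pow (h : I.Fits B) (v : V) :
    Computes (outReachP G I v) (outReachList G I v) (B ^ 14) := by
  classical
  refine filterP_pow h.two_le h.und_lt fun u hu => ?_
  have e : decide (InReach G I.vertSet u v) = decide (v ∈ inReachList G I u) := by
    simp [mem_inReachList]
  rw [e]
  exact .bind_pow 12 h.two_le (inReachP_pow h (mem_vertSet_of_mem_und hu))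
    (memP_pow h.two_le (inReachList_lt h) v) (by omega) (by omega)

/-- `I(x)` splits into the undecided part of `R(x)` and `R⁺(x) \ R(x)`. The undecided vertices of
`R(x)` are counted in both terms, with total weight `4`. -/
theorem dropP_pow (h : I.Fits B) (hx : x ∈ I.vertSet) : Computes (dropP G I x)
    (3 * (interacting G I.vertSet I.undSet x).card + (bigR G I.vertSet x).card) (B ^ 18) := by
  have hB := h.two_le
  set r := bigRList G I x with hr
  set rp := outReachList G I x with hrp
  have e1 : (bigR G I.vertSet x).card =
      (I.und.filter (· ∈ r)).length + (I.semi.filter (· ∈ r)).length := by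
    have hn : ((I.und ++ I.semi).filter (· ∈ r)).Nodup := h.nodup.filter _
    rw [← List.length_append, ← List.filter_append, ← List.toFinset_card_of_nodup hn]
    congr 1
    ext v
    simp only [hr, List.mem_toFinset, List.mem_filter, decide_eq_true_eq, mem_bigRList]
    exact ⟨fun h => ⟨Inst.mem_vertSet.1 (bigR_subset h), h⟩, fun h => h.2⟩
  have e2 : (interacting G I.vertSet I.undSet x).card =
      (I.und.filter (· ∈ r)).length + (rp.filter (· ∉ r)).length := by
    have hn : (rp.filter (· ∉ r)).Nodup := (h.und_nodup.filter _).filter _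
    rw [← List.toFinset_card_of_nodup (h.und_nodup.filter _), ← List.toFinset_card_of_nodup hn,
      ← Finset.card_union_of_disjoint]
    · congr 1
      ext v
      simp only [mem_interacting_iff Inst.undSet_subset hx, hr, hrp, Finset.mem_union,
        List.mem_toFinset, List.mem_filter, decide_eq_true_eq, mem_bigRList, mem_outReachList,
        Inst.mem_undSet]
      tauto
    · rw [Finset.disjoint_left]
      intro v hv hv'
      simp only [List.mem_toFinset, List.mem_filter, decide_eq_true_eq] at hv hv'
      exact hv'.2 hv.2
  have hu := filter_length_lt (B := B) (fun v => decide (v ∈ r)) h.und_lt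
  have hs := filter_length_lt (B := B) (fun v => decide (v ∈ r)) h.semi_lt
  have hp := filter_length_lt (B := B) (fun v => decide (v ∉ r)) (outReachList_lt (G := G) (v := x) h)
  have hrl := bigRList_lt (G := G) (v := x) h
  have e3 : 3 * (interacting G I.vertSet I.undSet x).card + (bigR G I.vertSet x).card =
      4 * (I.und.filter (· ∈ r)).length + (I.semi.filter (· ∈ r)).length +
        3 * (rp.filter (· ∉ r)).length := by omega
  rw [e3]
  refine .bind_pow 18 hB (bigRP_pow h hx) (j := 17) ?_ (by omega) (by omega)
  refine .bind_pow 17 hB (interP_pow hB h.und_lt hrl) (j := 16) ?_ (by omega) (by omega)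
  refine .bind_pow 16 hB (interP_pow hB h.semi_lt hrl) (j := 15) ?_ (by omega) (by omega)
  refine .bind_pow 15 hB (outReachP_pow h x) (j := 14) ?_ (by omega) (by omega)
  refine .bind_pow 14 hB (diffP_pow hB (outReachList_lt h) hrl) (j := 13) ?_ (by omega) (by omega)
  refine .bind_pow 13 hB (lengthP_pow hu) (j := 12) ?_ (by omega) (by omega)
  refine .bind_pow 12 hB (lengthP_pow hs) (j := 11) ?_ (by omega) (by omega)
  refine .bind_pow 11 hB (lengthP_pow hp) (j := 10) ?_ (by omega) (by omega)
  exact .bind_pow 10 hB (.tick_pow 0 hB) (.pure _ (B ^ 0)) (by omega) (by omega)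

/-- The list computed for the surviving set. -/
def survivingList (G : Digraph V) [DecidableRel G.Adj] (I : Inst V) (x : V) : List V :=
  (outList G I x).filter fun u => I.und.all fun w => decide (w = x) || !decide (Arc G w u)

theorem mem_survivingList : u ∈ survivingList G I x ↔
    u ∈ outs G I.vertSet x ∧ ∀ w ∈ I.undSet, Arc G w u → w = x := by
  simp only [survivingList, List.mem_filter, mem_outList, List.all_eq_true, Bool.or_eq_true,
    decide_eq_true_eq, Bool.not_eq_true', decide_eq_false_iff_not, Inst.mem_undSet]
  refine and_congr_right fun _ => forall₂_congr fun w _ => ?_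
  tauto

theorem survivingP_pow (h : I.Fits B) (x : V) :
    Computes (survivingP G I x) (survivingList G I x) (B ^ 6) := by
  have hB := h.two_le
  refine .bind_pow 6 hB (outP_pow h x) (j := 5) ?_ (by omega) (by omega)
  exact filterP_pow hB (outList_lt h) fun u _ => allP_pow hB h.und_lt fun w _ =>
    orP_pow hB (sameP_pow hB w x) (.bind_pure (f := not) (arcP_pow hB w u))

open scoped Classical in
/-- The list computed for the candidate sinks. -/
noncomputable def candidateList (G : Digraph V) (I : Inst V) (x : V) : List V :=
  I.und.filter fun u => decide (∃ y ∈ outs G I.vertSet x, InReach G I.vertSet u y)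

omit [DecidableRel G.Adj] in
theorem mem_candidateList : s ∈ candidateList G I x ↔
    ∃ y, Candidate G I.vertSet I.undSet x y s := by
  simp only [candidateList, List.mem_filter, decide_eq_true_eq]
  exact ⟨fun ⟨h, y, hy, hr⟩ => ⟨y, hy, Inst.mem_undSet.2 h, hr⟩,
    fun ⟨y, h⟩ => ⟨Inst.mem_undSet.1 h.mem, y, h.mem_outs, h.inReach⟩⟩

theorem candidatesP_pow (h : I.Fits B) (x : V) :
    Computes (candidatesP G I x) (candidateList G I x) (B ^ 15) := by
  classical
  have hB := h.two_le
  refine .bind_pow 15 hB (outP_pow h x) (j := 14) ?_ (by omega) (by omega)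
  refine filterP_pow hB h.und_lt fun u hu => ?_
  have e : decide (∃ y ∈ outs G I.vertSet x, InReach G I.vertSet u y) =
      (outList G I x).any fun y => decide (y ∈ inReachList G I u) := by
    rw [Bool.eq_iff_iff]
    simp [mem_inReachList, mem_outList]
  rw [e]
  exact .bind_pow 12 hB (inReachP_pow h (mem_vertSet_of_mem_und hu))
    (anyP_pow hB (outList_lt h) fun y _ => memP_pow hB (inReachList_lt h) y) (by omega) (by omega)

/-! ### Updates -/

theorem deleteP_pow (h : I.Fits B) {X : List V} (hX : X.length + 1 ≤ B) :
    Computes (deleteP I X) (I.delete X) (B ^ 6) := by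
  have hB := h.two_le
  refine .bind_pow 6 hB (diffP_pow hB h.und_lt hX) (j := 5) ?_ (by omega) (by omega)
  exact .bind_pow 5 hB (diffP_pow hB h.semi_lt hX) (.pure _ (B ^ 0)) (by omega) (by omega)

theorem lowerP_pow (h : I.Fits B) {X : List V} (hX : X.length + 1 ≤ B) :
    Computes (lowerP I X) (I.lower X) (B ^ 7) := by
  have hB := h.two_le
  refine .bind_pow 7 hB (diffP_pow hB h.und_lt hX) (j := 6) ?_ (by omega) (by omega)
  refine .bind_pow 6 hB (interP_pow hB h.und_lt hX) (j := 5) ?_ (by omega) (by omega)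
  exact .bind_pow 5 hB (appendP_pow (filter_length_lt _ h.und_lt)) (.pure _ (B ^ 0))
    (by omega) (by omega)

/-- The instance in which `s` is made a sink and `T` is lowered. -/
noncomputable def afterSink (G : Digraph V) [DecidableRel G.Adj] (I : Inst V) (s : V)
    (T : List V) : Inst V :=
  ((I.delete (bigRList G I s)).lower (outReachList G I s)).lower T

theorem updateSinkP_pow (h : I.Fits B) (hs : s ∈ I.vertSet) {T : List V}
    (hT : T.length + 1 ≤ B) : Computes (updateSinkP G I s T) (afterSink G I s T) (B ^ 16) := by
  have hB := h.two_le
  refine .bind_pow 16 hB (bigRP_pow h hs) (j := 15) ?_ (by omega) (by omega)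
  refine .bind_pow 15 hB (outReachP_pow h s) (j := 9) ?_ (by omega) (by omega)
  refine .bind_pow 9 hB (deleteP_pow h (bigRList_lt h)) (j := 8) ?_ (by omega) (by omega)
  exact .bind_pow 8 hB (lowerP_pow (h.delete _) (outReachList_lt h))
    (lowerP_pow ((h.delete _).lower _) hT) (by omega) (by omega)

theorem afterSink_fits (h : I.Fits B) (T : List V) : (afterSink G I s T).Fits B :=
  ((h.delete _).lower _).lower _

theorem vertSet_afterSink {T : List V} :
    (afterSink G I s T).vertSet = I.vertSet \ bigR G I.vertSet s := by
  simp only [afterSink, Inst.vertSet_lower, Inst.vertSet_delete, toFinset_bigRList]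

theorem undSet_afterSink (hs : s ∈ I.vertSet) {T : List V} :
    (afterSink G I s T).undSet = undAfter G I.vertSet I.undSet s T.toFinset := by
  ext v
  simp only [afterSink, Inst.undSet_lower, Inst.undSet_delete, toFinset_bigRList, undAfter,
    Finset.mem_sdiff, Finset.mem_union, mem_interacting_iff Inst.undSet_subset hs,
    List.mem_toFinset, mem_outReachList]
  tauto

theorem outDegP_pow (h : I.Fits B) (s : V) :
    Computes (outDegP G I s) (outs G I.vertSet s).card (B ^ 4) := by
  have e : (outs G I.vertSet s).card = (outList G I s).length := by
    have hn : (outList G I s).Nodup := h.nodup.filter _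
    rw [← toFinset_outList, List.toFinset_card_of_nodup hn]
  rw [e]
  exact .bind_pow 4 h.two_le (outP_pow h s) (lengthP_pow (outList_lt h)) (by omega) (by omega)

/-! ### Thinning out -/

/-- The choice of a dominated vertex. -/
theorem dominatedP_pow (h : I.Fits B) {L : List V} (hL : L.length + 1 ≤ B) (s : V) :
    Computes (findP (fun t => do
        let e ← sameP s t
        if e then return false else
          let ot ← outP G I t
          allP (fun w => memP w ot) (outList G I s)) L)
      (L.find? fun t => !decide (s = t) && (outList G I s).all fun w => decide (w ∈ outList G I t))
      (B ^ 8) := by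
  have hB := h.two_le
  refine findP_pow (k := 6) hB hL fun t _ => ?_
  refine .bind_pow 6 hB (sameP_pow hB s t) (j := 5) ?_ (by omega) (by omega)
  by_cases e : s = t
  · simpa [e] using Computes.pure false _
  · simp only [e, decide_false, Bool.not_false, Bool.true_and, Bool.false_eq_true, if_false]
    exact .bind_pow 5 hB (outP_pow h t) (allP_pow hB (outList_lt h) fun w _ =>
      memP_pow hB (outList_lt h) w) (by omega) (by omega)

/-- A removed vertex leaves its dominator in the list, so any property `Q` that passes from `t` to
its dominators keeps a witness; it is used for being a sink. If nothing was removed, each search for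
a dominated vertex failed on the whole list, so no domination is left. -/
theorem pruneP_computes (h : I.Fits B) (l : List V) {L : List V} (hL : L.length + 1 ≤ B) :
    ∃ L', Computes (pruneP G I l L) L' (l.length * (B ^ 10 + 1) + 1) ∧ L'.Sublist L ∧
      (∀ Q : V → Prop, (∀ s ∈ L, ∀ t ∈ L, outs G I.vertSet s ⊆ outs G I.vertSet t → Q t → Q s) →
        (∃ s ∈ L, Q s) → ∃ s ∈ L', Q s) ∧
      (L'.length = L.length → ∀ s ∈ l, s ∈ L → ∀ t ∈ L, t ≠ s →
        ¬ outs G I.vertSet s ⊆ outs G I.vertSet t) := by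
  have hB := h.two_le
  induction l generalizing L with
  | nil =>
    exact ⟨L, .bind_le (e := _ + 1) .tick (.pure L 0) (by omega), .refl L, fun Q _ h => h, by simp⟩
  | cons s l ih =>
    have hcost : ∀ c, c ≤ l.length * (B ^ 10 + 1) + 1 →
        1 + (B ^ 10 + c) ≤ (s :: l).length * (B ^ 10 + 1) + 1 := fun c hc => by
      simp only [List.length_cons, add_mul]
      omega
    have hmem := (memP_pow hB hL s)
    by_cases hs : s ∈ L
    · have hfind := dominatedP_pow (G := G) h hL s
      have hsplit : B ^ 2 + (B ^ 3 + B ^ 8) + B ^ 4 ≤ B ^ 10 := by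
        have h2 : B ^ 2 ≤ B ^ 8 := Nat.pow_le_pow_right (by omega) (by omega)
        have h3 : B ^ 3 ≤ B ^ 8 := Nat.pow_le_pow_right (by omega) (by omega)
        have h4 : B ^ 4 ≤ B ^ 8 := Nat.pow_le_pow_right (by omega) (by omega)
        have h5 : B ^ 10 = B * B * B ^ 8 := by ring
        have h6 : 4 ≤ B * B := Nat.mul_le_mul hB hB
        have h7 := Nat.mul_le_mul_right (B ^ 8) h6
        omega
      cases ht : L.find? fun t =>
          !decide (s = t) && (outList G I s).all fun w => decide (w ∈ outList G I t) with
      | none =>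
        rw [ht] at hfind
        obtain ⟨L', hc, hsub, hQ, hfull⟩ := ih hL
        refine ⟨L', ?_, hsub, hQ, fun hlen s' hs' hs'L t htL hne hdom => ?_⟩
        · rw [pruneP]
          refine .bind_le .tick (.bind hmem (d := B ^ 3 + B ^ 8 + (l.length * (B ^ 10 + 1) + 1)) ?_) ?_
          · simp only [hs, decide_true, if_true]
            refine .bind_le (outP_pow h s) (.bind hfind hc) (by omega)
          · have := hcost _ le_rfl
            omega
        · rcases List.mem_cons.1 hs' with rfl | hs'
          · have := List.find?_eq_none.1 ht t htL
            simp only [Bool.and_eq_true, Bool.not_eq_true', decide_eq_false_iff_not,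
              List.all_eq_true, decide_eq_true_eq, mem_outList, not_and] at this
            exact this hne.symm fun w hw => hdom hw
          · exact hfull hlen s' hs' hs'L t htL hne hdom
      | some t =>
        rw [ht] at hfind
        have htL : t ∈ L := List.mem_of_find?_eq_some ht
        have htp := List.find?_some ht
        simp only [Bool.and_eq_true, Bool.not_eq_true', decide_eq_false_iff_not,
          List.all_eq_true, decide_eq_true_eq, mem_outList] at htp
        obtain ⟨L', hc, hsub, hQ, hfull⟩ := ih (L := L.filter (· ∉ [t])) (filter_length_lt _ hL)
        have hlt : (L.filter (· ∉ [t])).length < L.length := by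
          refine lt_of_le_of_ne (List.length_filter_le _ _) fun e => ?_
          have := List.length_filter_eq_length_iff.1 e t htL
          simp at this
        refine ⟨L', ?_, hsub.trans List.filter_sublist, fun Q hcl hex => ?_, fun hlen => ?_⟩
        · rw [pruneP]
          refine .bind_le .tick
            (.bind hmem (d := B ^ 3 + B ^ 8 + B ^ 4 + (l.length * (B ^ 10 + 1) + 1)) ?_) ?_
          · simp only [hs, decide_true, if_true]
            refine .bind_le (outP_pow h s) (.bind hfind
              (.bind (diffP_pow hB hL (l' := [t]) (by simpa using hB)) hc)) (by omega)
          · have := hcost _ le_rfl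
            omega
        · refine hQ Q (fun a ha b hb => hcl a (List.mem_filter.1 ha).1 b (List.mem_filter.1 hb).1) ?_
          obtain ⟨a, ha, hqa⟩ := hex
          by_cases hat : a = t
          · subst hat
            exact ⟨s, List.mem_filter.2 ⟨hs, by simpa using htp.1⟩,
              hcl s hs a htL (fun w hw => htp.2 w hw) hqa⟩
          · exact ⟨a, List.mem_filter.2 ⟨ha, by simpa using hat⟩, hqa⟩
        · have := hsub.length_le
          omega
    · obtain ⟨L', hc, hsub, hQ, hfull⟩ := ih hL
      refine ⟨L', ?_, hsub, hQ, fun hlen s' hs' hs'L => ?_⟩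
      · rw [pruneP]
        refine .bind_le .tick (.bind hmem (d := l.length * (B ^ 10 + 1) + 1) ?_) ?_
        · simpa [hs] using hc
        · have := hcost _ le_rfl
          have h2 : B ^ 2 ≤ B ^ 10 := Nat.pow_le_pow_right (by omega) (by omega)
          omega
      · rcases List.mem_cons.1 hs' with rfl | hs'
        · exact absurd hs'L hs
        · exact hfull hlen s' hs' hs'L

end Procedures

end KFVD

namespace KFVD

variable {V : Type} [DecidableEq V] {G : Digraph V} [DecidableRel G.Adj] {I : Inst V}

/-! ## Correctness and running time -/

/-- Some solution has at most `k` vertices. -/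
def Attained (G : Digraph V) (W : Finset V) (k : ℕ) : Prop :=
  ∃ S, Sol G W S ∧ S.card ≤ k

/-- `k` is a correct answer for the instance `I`: it is attained, and no larger than the minimum
if some minimum solution is compatible with the undecided vertices. -/
def Answers (G : Digraph V) (I : Inst V) (k : ℕ) : Prop :=
  Attained G I.vertSet k ∧ ∀ S, Compatible G I.vertSet I.undSet S → k ≤ S.card

/-- `p` returns a value with property `P` after at most `b` steps. -/
def RunsWithin (p : Prog ℕ) (P : ℕ → Prop) (b : ℝ) : Prop :=
  ∃ v c, Computes p v c ∧ P v ∧ (c : ℝ) ≤ b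

theorem RunsWithin.bind {α : Type} {p : Prog α} {f : α → Prog ℕ} {P : ℕ → Prop} {a : α} {c : ℕ}
    {b : ℝ} (hp : Computes p a c) (h : RunsWithin (f a) P (b - c)) : RunsWithin (p >>= f) P b := by
  obtain ⟨v, d, hd, hP, hb⟩ := h
  refine ⟨v, c + d, hp.bind hd, hP, ?_⟩
  push_cast
  linarith

theorem RunsWithin.pure {P : ℕ → Prop} {v : ℕ} {b : ℝ} (hP : P v) (hb : 0 ≤ b) :
    RunsWithin (Pure.pure v) P b :=
  ⟨v, 0, .pure v 0, hP, by simpa using hb⟩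

/-- Four times the sum of the potentials. -/
def Inst.weight (I : Inst V) : ℕ := 3 * I.undSet.card + I.vertSet.card

/-- The bound on the time per node of the search tree. -/
def nodeCost (B : ℕ) : ℕ := B ^ 24

/-- The bound on the running time for an instance of weight less than `m`. -/
noncomputable def timeBound (B m M : ℕ) : ℝ := 64 * (nodeCost B : ℝ) * m * base ^ M

theorem Computes.toNode {α : Type} {p : Prog α} {a : α} {B i : ℕ} (hp : Computes p a (B ^ i))
    (hB : 2 ≤ B) (hi : i ≤ 24) : Computes p a (nodeCost B) :=
  hp.pow_mono 24 hB hi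

/-- The induction hypothesis for instances of weight less than `m`. -/
def SolvedBelow (G : Digraph V) [DecidableRel G.Adj] (B m : ℕ) : Prop :=
  ∀ I : Inst V, I.Fits B → I.weight < m →
    RunsWithin (kfvd G I) (Answers G I) (timeBound B m (measure G I.vertSet I.undSet))

/-! ### Single recursive calls: branches and reductions -/

section Branch

variable {B m : ℕ} {s : V}

theorem weight_afterSink_lt (hs : s ∈ I.undSet) (T : List V) :
    (afterSink G I s T).weight < I.weight := by
  have hsW := Inst.undSet_subset hs
  have h1 : (afterSink G I s T).undSet.card ≤ I.undSet.card := by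
    rw [undSet_afterSink hsW]
    exact Finset.card_le_card undAfter_subset
  have h2 : (afterSink G I s T).vertSet.card + 1 ≤ I.vertSet.card := by
    rw [vertSet_afterSink]
    exact card_lt_of_notMem Finset.sdiff_subset hsW (by simp [self_mem_bigR hsW])
  unfold Inst.weight
  omega

/-- The branch in which `s` is made a sink, the vertices of `T` not being sinks. -/
theorem sink_branch (ih : SolvedBelow G B m) (h : I.Fits B) (hm : I.weight < m + 1)
    (hs : s ∈ I.undSet) (T : List V) : ∃ a c, Computes (kfvd G (afterSink G I s T)) a c ∧
      Attained G I.vertSet (a + (outs G I.vertSet s).card) ∧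
      (∀ S, Compatible G I.vertSet I.undSet S → IsSink G (I.vertSet \ S) s →
        (∀ t ∈ T, ¬ IsSink G (I.vertSet \ S) t) → a + (outs G I.vertSet s).card ≤ S.card) ∧
      (c : ℝ) ≤ timeBound B m (measureAfter G I.vertSet I.undSet s T.toFinset) := by
  have hsW := Inst.undSet_subset hs
  have hlt := weight_afterSink_lt (G := G) hs T
  obtain ⟨a, c, hc, ⟨⟨S', hS', hS'a⟩, hcomp⟩, hb⟩ := ih (afterSink G I s T) (afterSink_fits h T) (by omega)
  rw [vertSet_afterSink] at hS'
  rw [vertSet_afterSink, undSet_afterSink hsW] at hcomp hb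
  refine ⟨a, c, hc, ⟨_, hS'.lift hsW, ?_⟩, fun S hS hsS hT => ?_, hb⟩
  · rw [hS'.card_lift]
    omega
  · have := hcomp _ (hS.restrict hsS fun z hz hzS hzR hzs => by
      simp only [undAfter, Finset.mem_sdiff, Finset.mem_union,
        mem_interacting_iff Inst.undSet_subset hsW, List.mem_toFinset]
      exact ⟨hz, fun hn => hn.elim (fun hn => hn.2.elim hzR hzs) fun hn => hT z hn hzS⟩)
    have := hsS.card_restrict
    omega

omit [DecidableEq V] in
theorem foldl_min_induction {f : V → ℕ} {P : ℕ → Prop} (L : List V) {k : ℕ} (hk : P k)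
    (hL : ∀ s ∈ L, P (f s)) : P (L.foldl (fun m s => min m (f s)) k) := by
  induction L generalizing k with
  | nil => exact hk
  | cons s L ih =>
    refine ih ?_ fun t ht => hL t (by simp [ht])
    change P (min k (f s))
    rcases min_choice k (f s) with e | e <;> rw [e]
    exacts [hk, hL s (by simp)]

omit [DecidableEq V] in
theorem foldl_min_le {f : V → ℕ} {b : ℕ} (L : List V) {k : ℕ}
    (h : k ≤ b ∨ ∃ s ∈ L, f s ≤ b) : L.foldl (fun m s => min m (f s)) k ≤ b := by
  induction L generalizing k with
  | nil => simpa using h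
  | cons s L ih =>
    refine ih ?_
    rcases h with h | ⟨t, ht, htb⟩
    · exact .inl (min_le_of_left_le h)
    · rcases List.mem_cons.1 ht with rfl | ht
      · exact .inl (min_le_of_right_le htb)
      · exact .inr ⟨t, ht, htb⟩

/-- The loop over the candidate sinks. -/
theorem candidates_loop (h : I.Fits B) {L : List V} (hL : ∀ s ∈ L, s ∈ I.undSet) {a c : V → ℕ}
    (ha : ∀ s ∈ L, Computes (kfvd G (afterSink G I s [])) (a s) (c s)) (k : ℕ) :
    Computes (L.foldlM (fun m s => do
      tick
      let Is ← updateSinkP G I s []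
      let d ← outDegP G I s
      let a ← kfvd G Is
      return min m (a + d)) k)
      (L.foldl (fun m s => min m (a s + (outs G I.vertSet s).card)) k)
      (L.map fun s => 3 * nodeCost B + c s).sum := by
  have hB := h.two_le
  induction L generalizing k with
  | nil => exact .pure k _
  | cons s L ih =>
    rw [List.foldlM_cons, List.foldl_cons, List.map_cons, List.sum_cons]
    refine .bind (a := min k (a s + (outs G I.vertSet s).card)) ?_
      (ih (fun t ht => hL t (by simp [ht])) (fun t ht => ha t (by simp [ht])) _)
    refine .bind_le ((Computes.tick_pow 0 hB).toNode hB (by omega)) (.bind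
      ((updateSinkP_pow h (Inst.undSet_subset (hL s (by simp))) (T := [])
        (by simp; omega)).toNode hB (by omega)) (.bind
      ((outDegP_pow h s).toNode hB (by omega)) (.bind_pure (f := fun a =>
        min k (a + (outs G I.vertSet s).card)) (ha s (by simp))))) (by omega)

/-- The time bounds of the children add up to the time bound of the node. -/
theorem timeBound_budget {M : ℕ} {t r : ℝ} (ht : t ≤ 64 * (nodeCost B : ℝ) * m * r)
    (hr : r ≤ base ^ M) : t + 64 * (nodeCost B : ℝ) ≤ timeBound B (m + 1) M := by
  have h1 : (1 : ℝ) ≤ base ^ M := one_le_pow₀ one_le_base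
  have h2 : 64 * (nodeCost B : ℝ) * m * r ≤ 64 * (nodeCost B : ℝ) * m * base ^ M :=
    mul_le_mul_of_nonneg_left hr (by positivity)
  -- As `base ^ M ≥ 1`, raising the factor `m` by one frees `64 * nodeCost B` steps for the work at
  -- the node itself, even if the measure does not drop.
  have h3 : 64 * (nodeCost B : ℝ) * 1 ≤ 64 * (nodeCost B : ℝ) * base ^ M :=
    mul_le_mul_of_nonneg_left h1 (by positivity)
  unfold timeBound
  push_cast
  linarith

theorem toFinset_delete_singleton (A : Finset V) (x : V) : A \ [x].toFinset = A.erase x := by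
  simp [Finset.sdiff_singleton_eq_erase]

/-- The reduction that deletes a source. -/
theorem source_step (ih : SolvedBelow G B m) (h : I.Fits B) (hm : I.weight < m + 1) {x : V}
    (hx : x ∈ I.vertSet) (hsrc : ∀ w ∈ I.vertSet, ¬ Arc G w x) :
    RunsWithin (kfvd G (I.delete [x])) (Answers G I)
      (timeBound B m (measure G I.vertSet I.undSet)) := by
  have hW : (I.delete [x]).vertSet = I.vertSet.erase x := by
    rw [Inst.vertSet_delete, toFinset_delete_singleton]
  have hU : (I.delete [x]).undSet = I.undSet.erase x := by
    rw [Inst.undSet_delete, toFinset_delete_singleton]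
  have hlt : (I.delete [x]).weight < m := by
    have h1 := Finset.card_erase_add_one hx
    have h2 := Finset.card_le_card (Finset.erase_subset x I.undSet)
    unfold Inst.weight at hm ⊢
    rw [hW, hU]
    omega
  obtain ⟨v, c, hc, ⟨⟨S, hS, hSv⟩, hcomp⟩, hb⟩ := ih _ (h.delete [x]) hlt
  rw [hW] at hS
  rw [hW, hU] at hcomp hb
  refine ⟨v, c, hc, ⟨⟨S, hS.insert_source hsrc, hSv⟩, fun S hS => ?_⟩, hb.trans ?_⟩
  · exact (hcomp _ (hS.erase_source hx hsrc)).trans (Finset.card_le_card (Finset.erase_subset _ _))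
  · refine mul_le_mul_of_nonneg_left (pow_le_pow_right₀ one_le_base ?_) (by positivity)
    exact measure_le (Finset.erase_subset _ _) (Finset.erase_subset _ _)
      (fun v hv hvW => Finset.mem_erase.2 ⟨(Finset.mem_erase.1 hvW).1, freeVerts_subset hv⟩)
      (Finset.erase_subset_erase _ Inst.undSet_subset)

/-- The reduction at a sink. -/
theorem sink_step (ih : SolvedBelow G B m) (h : I.Fits B) (hm : I.weight < m + 1) {x : V}
    (hx : IsSink G I.vertSet x) :
    RunsWithin (kfvd G (I.delete (bigRList G I x))) (Answers G I)
      (timeBound B m (measure G I.vertSet I.undSet)) := by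
  have hW : (I.delete (bigRList G I x)).vertSet = I.vertSet \ bigR G I.vertSet x := by
    rw [Inst.vertSet_delete, toFinset_bigRList]
  have hU : (I.delete (bigRList G I x)).undSet = I.undSet \ bigR G I.vertSet x := by
    rw [Inst.undSet_delete, toFinset_bigRList]
  have hlt : (I.delete (bigRList G I x)).weight < m := by
    have h1 := card_lt_of_notMem (Finset.sdiff_subset (s := I.vertSet) (t := bigR G I.vertSet x))
      hx.1 (by simp [self_mem_bigR hx.1])
    have h2 := Finset.card_le_card
      (Finset.sdiff_subset (s := I.undSet) (t := bigR G I.vertSet x))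
    unfold Inst.weight at hm ⊢
    rw [hW, hU]
    omega
  obtain ⟨v, c, hc, ⟨⟨S, hS, hSv⟩, hcomp⟩, hb⟩ := ih _ (h.delete _) hlt
  rw [hW] at hS
  rw [hW, hU] at hcomp hb
  have hout : outs G I.vertSet x = ∅ := Finset.eq_empty_of_forall_notMem fun w hw =>
    hx.2 w (mem_outs.1 hw).1 (mem_outs.1 hw).2
  refine ⟨v, c, hc, ⟨⟨_, hS.lift hx.1, ?_⟩, fun S hS => ?_⟩, hb.trans ?_⟩
  · simpa [hout] using hSv
  · exact (hcomp _ (hS.restrict (hS.1.isSink_of_isSink hx) fun z hz _ hzR _ =>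
      Finset.mem_sdiff.2 ⟨hz, hzR⟩)).trans (Finset.card_le_card Finset.sdiff_subset)
  · refine mul_le_mul_of_nonneg_left (pow_le_pow_right₀ one_le_base ?_) (by positivity)
    exact measure_le Finset.sdiff_subset Finset.sdiff_subset
      (fun v hv hvW => Finset.mem_sdiff.2 ⟨freeVerts_subset hv, (Finset.mem_sdiff.1 hvW).2⟩)
      (Finset.sdiff_subset_sdiff Inst.undSet_subset le_rfl)

/-- The branch in which `x` is decided not to be a sink. -/
theorem nonsink_branch (ih : SolvedBelow G B m) (h : I.Fits B) (hm : I.weight < m + 1) {x : V}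
    (hx : x ∈ I.undSet) : ∃ a c, Computes (kfvd G (I.lower [x])) a c ∧
      Attained G I.vertSet a ∧
      (∀ S, Compatible G I.vertSet I.undSet S → ¬ IsSink G (I.vertSet \ S) x → a ≤ S.card) ∧
      (c : ℝ) ≤ timeBound B m (measure G I.vertSet (I.undSet.erase x)) := by
  have hU : (I.lower [x]).undSet = I.undSet.erase x := by
    rw [Inst.undSet_lower, toFinset_delete_singleton]
  have hlt : (I.lower [x]).weight < m := by
    have h1 := Finset.card_erase_add_one hx
    unfold Inst.weight at hm ⊢
    rw [Inst.vertSet_lower, hU]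
    omega
  obtain ⟨a, c, hc, ⟨hatt, hcomp⟩, hb⟩ := ih _ (h.lower [x]) hlt
  rw [Inst.vertSet_lower] at hatt
  rw [Inst.vertSet_lower, hU] at hcomp hb
  exact ⟨a, c, hc, hatt, fun S hS hxS => hcomp S (hS.erase hxS), hb⟩

omit [DecidableRel G.Adj] in
theorem Attained.min {W : Finset V} {a b : ℕ} (ha : Attained G W a) (hb : Attained G W b) :
    Attained G W (min a b) := by
  rcases min_choice a b with e | e <;> rw [e]
  exacts [ha, hb]

end Branch

end KFVD

/-! ### One node of the search tree -/

namespace KFVD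

variable {V : Type} [DecidableEq V] {G : Digraph V} [DecidableRel G.Adj] {I : Inst V}
variable {B m : ℕ}

omit [DecidableEq V] in
theorem isEmpty_filter_iff {l : List V} {p : V → Bool} :
    (l.filter p).isEmpty = true ↔ ∀ w ∈ l, ¬ p w := by
  simp

omit [DecidableEq V] in
theorem cast_sum_cost_le {q : ℕ} {c : V → ℕ} {f : V → ℝ} {K : ℝ} (L : List V)
    (hc : ∀ s ∈ L, (c s : ℝ) ≤ K * f s) :
    (((L.map fun s => 3 * q + c s).sum : ℕ) : ℝ) ≤ L.length * (3 * q) + K * (L.map f).sum := by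
  induction L with
  | nil => simp
  | cons s L ih =>
    have h1 := ih fun t ht => hc t (by simp [ht])
    have h2 := hc s (by simp)
    simp only [List.map_cons, List.sum_cons, List.length_cons]
    push_cast at h1 ⊢
    linarith

/-- One pass of the loop over the thinned out list. -/
theorem survivor_loop_body (h : I.Fits B) {s : V} (hs : s ∈ I.undSet) {k a c : ℕ} {T : List V}
    (hT : T.length + 1 ≤ B) (ha : Computes (kfvd G (afterSink G I s T)) a c) :
    Computes (do
      tick
      let Is ← updateSinkP G I s T
      let d ← outDegP G I s
      let a ← kfvd G Is
      return (min k (a + d), s :: T))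
      (min k (a + (outs G I.vertSet s).card), s :: T) (3 * nodeCost B + c) := by
  have hB := h.two_le
  exact .bind_le ((Computes.tick_pow 0 hB).toNode hB (by omega)) (.bind
    ((updateSinkP_pow h (Inst.undSet_subset hs) hT).toNode hB (by omega)) (.bind
    ((outDegP_pow h s).toNode hB (by omega)) (.bind_pure (f := fun a =>
      (min k (a + (outs G I.vertSet s).card), s :: T)) ha))) (by omega)

theorem bigDropP_pow (h : I.Fits B) {v : V} (hv : v ∈ I.vertSet) :
    Computes (do let k ← dropP G I v; tick; return decide (15 ≤ k)) (decide (15 ≤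
      3 * (interacting G I.vertSet I.undSet v).card + (bigR G I.vertSet v).card)) (B ^ 19) := by
  refine .bind_pow 19 h.two_le (dropP_pow h hv) (j := 1) ?_ (by omega) (by omega)
  exact .bind_pow 1 h.two_le (.tick_pow 0 h.two_le) (.pure _ (B ^ 0)) (by omega) (by omega)

/-- At each node three facts meet: every branch returns an attained value, some branch keeps a given
compatible solution compatible, and the matching `branch_...` inequality bounds the sum over the
children. The weight falls in every call, so the induction hypothesis applies to all of them. -/
theorem solvedBelow_succ (ih : SolvedBelow G B m) : SolvedBelow G B (m + 1) := by
  intro I h hm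
  have hB := h.two_le
  have hQ : (0 : ℝ) ≤ (nodeCost B : ℝ) := by positivity
  set W := I.vertSet with hW
  set U := I.undSet with hU
  have hUW : U ⊆ W := Inst.undSet_subset
  rw [kfvd]
  refine .bind ((Computes.tick_pow 0 hB).toNode hB (by omega)) ?_
  refine .bind ((vertsP_pow h).toNode hB (by omega)) ?_
  refine .bind ((findP_pow (k := 3) hB h.verts_lt fun v _ =>
    (inP_pow (G := G) h v).bind_pure (f := List.isEmpty)).toNode hB (by omega)) ?_
  cases hsrc : I.verts.find? fun v => (I.verts.filter fun w => decide (Arc G w v)).isEmpty with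
  | some x =>
    have hx := List.mem_of_find?_eq_some hsrc
    have hxs := List.find?_some hsrc
    rw [isEmpty_filter_iff] at hxs
    refine .bind ((deleteP_pow h (X := [x]) (by simpa using hB)).toNode hB (by omega)) ?_
    obtain ⟨v, c, hc, hv, hb⟩ := source_step ih h hm (Inst.mem_vertSet.2 hx)
      fun w hw => by simpa using hxs w (Inst.mem_vertSet.1 hw)
    refine ⟨v, c, hc, hv, ?_⟩
    have := timeBound_budget (M := measure G W U) hb le_rfl
    linarith
  | none =>
  refine .bind ((findP_pow (k := 3) hB h.verts_lt fun v _ =>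
    (outP_pow (G := G) h v).bind_pure (f := List.isEmpty)).toNode hB (by omega)) ?_
  cases hsnk : I.verts.find? fun v => (outList G I v).isEmpty with
  | some x =>
    have hx := List.mem_of_find?_eq_some hsnk
    have hxs := List.find?_some hsnk
    rw [outList, isEmpty_filter_iff] at hxs
    have hxW : x ∈ I.vertSet := Inst.mem_vertSet.2 hx
    refine .bind ((bigRP_pow h hxW).toNode hB (by omega)) ?_
    refine .bind ((deleteP_pow h (bigRList_lt h)).toNode hB (by omega)) ?_
    obtain ⟨v, c, hc, hv, hb⟩ := sink_step ih h hm (x := x)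
      ⟨hxW, fun w hw => by simpa using hxs w (Inst.mem_vertSet.1 hw)⟩
    refine ⟨v, c, hc, hv, ?_⟩
    have := timeBound_budget (M := measure G W U) hb le_rfl
    linarith
  | none =>
  have hsucc : ∀ x ∈ W, ∃ w ∈ W, Arc G x w := fun x hx => by
    have := List.find?_eq_none.1 hsnk x (Inst.mem_vertSet.1 hx)
    rw [outList, isEmpty_filter_iff] at this
    simpa [hW, Inst.mem_vertSet] using this
  have hns : ∀ x ∈ W, ¬ IsSink G W x := fun x hx hs => by
    obtain ⟨w, hw, a⟩ := hsucc x hx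
    exact hs.2 w hw a
  dsimp only
  split
  · rename_i hund
    have hU0 : U = ∅ := by simp [hU, Inst.undSet, hund]
    have hcard : W.card = I.verts.length := List.toFinset_card_of_nodup h.nodup
    refine ⟨_, _, (lengthP_pow h.verts_lt).toNode hB (by omega), ⟨⟨W, ⟨subset_rfl, fun u hu =>
        absurd (Finset.mem_sdiff.1 hu).1 (Finset.mem_sdiff.1 hu).2⟩,
      hcard.le⟩, fun S hS => ?_⟩, ?_⟩
    · rw [← hU, hU0] at hS
      rw [hS.eq_of_undecided_empty hns, ← hW, hcard]
    · have := timeBound_budget (B := B) (m := m) (M := measure G W U) (t := 0) (r := 0) (by simp)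
        (pow_pos base_pos _).le
      linarith
  · rename_i x₀ und' hund
    refine .bind ((findP_pow hB h.und_lt fun v hv =>
      bigDropP_pow (G := G) h (mem_vertSet_of_mem_und hv)).toNode hB (by omega)) ?_
    cases hbig : I.und.find? fun v => decide (15 ≤
        3 * (interacting G I.vertSet I.undSet v).card + (bigR G I.vertSet v).card) with
    | some x =>
      have hx : x ∈ U := Inst.mem_undSet.2 (List.mem_of_find?_eq_some hbig)
      have hd : 15 ≤ 3 * (interacting G W U x).card + (bigR G W x).card := by
        simpa using List.find?_some hbig
      -- A free vertex has `3·1 + 11 = 14 < 15`, so the first branching rule never spends a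
      -- branching on it.
      have hxf : x ∉ freeVerts G W U := fun hf => by
        have h1 := (mem_freeVerts.1 hf).2
        have h2 := Finset.card_le_card h1.2
        rw [Finset.card_singleton] at h2
        omega
      obtain ⟨a, c, hc, hatt, hcomp, hb⟩ := sink_branch ih h hm hx []
      obtain ⟨a', c', hc', hatt', hcomp', hb'⟩ := nonsink_branch ih h hm hx
      refine .bind ((updateSinkP_pow h (hUW hx) (T := []) (by simp; omega)).toNode hB
        (by omega)) ?_
      refine .bind ((lowerP_pow h (X := [x]) (by simpa using hB)).toNode hB (by omega)) ?_
      refine .bind ((outDegP_pow h x).toNode hB (by omega)) ?_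
      refine .bind hc (.bind hc' (.bind ((Computes.tick_pow 0 hB).toNode hB (by omega))
        (.pure ⟨hatt.min hatt', fun S hS => ?_⟩ ?_)))
      · by_cases hxS : IsSink G (W \ S) x
        · exact min_le_of_left_le (hcomp S hS hxS (by simp))
        · exact min_le_of_right_le (hcomp' S hS hxS)
      · have hM1 := measure_update (F := ∅) (T := ∅) hUW hx hxf (by simp) (by simp) (by simp)
        simp only [Finset.union_empty, Finset.card_empty, mul_zero, add_zero] at hM1
        have hM2 := measure_erase hUW hx hxf
        have := timeBound_budget (B := B) (m := m) (t := c + c') (by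
          rw [mul_add]
          exact add_le_add hb hb') (branch_two (a := 15) (b := 3) (M := measure G W U)
            (show measureAfter G W U x ∅ + 15 ≤ _ by unfold measureAfter; omega) hM2
            (by norm_num [base]))
        linarith
    | none =>
    have hR : Reduced G W U := ⟨hUW, hsucc, fun v hv => by
      have := List.find?_eq_none.1 hbig v (Inst.mem_undSet.1 hv)
      simp only [decide_eq_true_eq] at this
      exact Nat.le_of_lt_succ (not_le.1 this)⟩
    refine .bind ((undDegP_pow h x₀).toNode hB (by omega)) ?_
    have hund' : und'.length + 1 ≤ B := by
      have := h.und_lt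
      rw [hund, List.length_cons] at this
      omega
    obtain ⟨x, hx', hmax', hxc⟩ := argmaxFrom_pow (g := fun v => (undNbrs G U v).card) hB hund' x₀
      fun v _ => undDegP_pow (G := G) h v
    refine .bind (hxc.toNode hB (by omega)) ?_
    rw [← hund] at hx' hmax'
    have hx : x ∈ U := Inst.mem_undSet.2 hx'
    have hmax : ∀ v ∈ U, (undNbrs G U v).card ≤ (undNbrs G U x).card := fun v hv =>
      hmax' v (Inst.mem_undSet.1 hv)
    have hnil : ([] : List V).length + 1 ≤ B := by simp; omega
    obtain ⟨ax, cx, hcx, hattx, hcompx, hbx⟩ := sink_branch ih h hm hx []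
    refine .bind ((updateSinkP_pow h (hUW hx) hnil).toNode hB (by omega)) ?_
    refine .bind ((outDegP_pow h x).toNode hB (by omega)) ?_
    refine .bind hcx (.bind ((Computes.tick_pow 0 hB).toNode hB (by omega)) ?_)
    refine .bind ((survivingP_pow h x).toNode hB (by omega)) ?_
    have hxU : x ∈ I.undSet := hx
    cases hsurv : survivingList G I x with
    | nil =>
      have hS : ∀ y ∈ outs G W x, ∃ u ∈ U, u ≠ x ∧ Arc G u y := fun y hy => by
        by_contra! hn
        have : y ∈ survivingList G I x := mem_survivingList.2
          ⟨hy, fun w hw a => by_contra fun hwx => hn w hw hwx a⟩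
        simp [hsurv] at this
      have hcand : ∀ s ∈ candidateList G I x, ∃ y, Candidate G W U x y s := fun s hs =>
        mem_candidateList.1 hs
      have hnd : (candidateList G I x).Nodup := h.und_nodup.filter _
      have hsb : ∀ s, s ∈ U → _ := fun s hs => sink_branch ih h hm hs []
      choose! a c hac using hsb
      have hCU : ∀ s ∈ candidateList G I x, s ∈ I.undSet := fun s hs => (hcand s hs).choose_spec.mem
      refine .bind ((candidatesP_pow h x).toNode hB (by omega)) ?_
      refine ⟨_, _, candidates_loop h hCU (fun s hs => (hac s (hCU s hs)).1) _, ⟨?_, ?_⟩, ?_⟩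
      · exact foldl_min_induction _ hattx fun s hs => (hac s (hCU s hs)).2.1
      · intro S hSc
        apply foldl_min_le
        by_cases hxS : IsSink G (W \ S) x
        · exact .inl (hcompx S hSc hxS (by simp))
        · obtain ⟨z, hz, hzS, y, hy, hr⟩ := hSc.exists_candidate hns (hUW hx) hxS
          exact .inr ⟨z, mem_candidateList.2 ⟨y, hy, hz, hr⟩, (hac z hz).2.2.1 S hSc hzS (by simp)⟩
      · obtain ⟨hlen, hsum⟩ := branch_candidates hR hx hmax hS hnd hcand
        have hcost := cast_sum_cost_le (q := nodeCost B) (candidateList G I x) fun s hs =>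
          (hac s (hCU s hs)).2.2.2
        have hbud := timeBound_budget (B := B) (m := m) (t := cx + 64 * (nodeCost B : ℝ) * m *
          ((candidateList G I x).map fun s => base ^ measureAfter G W U s ∅).sum) (by
            rw [mul_add]
            exact add_le_add hbx le_rfl) hsum
        have hlen' : ((candidateList G I x).length : ℝ) ≤ 3 := by exact_mod_cast hlen
        have := mul_le_mul_of_nonneg_right hlen' (show 0 ≤ 3 * (nodeCost B : ℝ) by positivity)
        simp only [List.toFinset_nil] at hcost
        linarith
    | cons y l =>
      obtain ⟨hyo, hy⟩ := mem_survivingList.1 (show y ∈ survivingList G I x by simp [hsurv])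
      refine .bind ((outReachP_pow h y).toNode hB (by omega)) ?_
      refine .bind ((undDegP_pow h x).toNode hB (by omega)) ?_
      have hmem : ∀ s, s ∈ outReachList G I y ↔ Candidate G W U x y s := fun s =>
        mem_outReachList.trans ⟨fun h => ⟨hyo, h.1, h.2⟩, fun h => ⟨h.mem, h.inReach⟩⟩
      have hex : ∀ S, Compatible G W U S → ¬ IsSink G (W \ S) x →
          ∃ s ∈ outReachList G I y, IsSink G (W \ S) s := fun S hS hxS => by
        obtain ⟨z, hz, hzS, hr⟩ := hS.exists_sink_of_surviving hns hxS (mem_outs.1 hyo).1 hy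
        exact ⟨z, (hmem z).2 ⟨hyo, hz, hr⟩, hzS⟩
      split
      · rename_i hn
        have hne : (undNbrs G U x).Nonempty := Finset.card_pos.1 hn
        have hnd : (outReachList G I y).Nodup := h.und_nodup.filter _
        have hlen := length_le_two_of_survivor hR hx hnd hne hyo hmem
        obtain ⟨L, hLc, hLsub, hLQ, hLfull⟩ :=
          pruneP_computes (G := G) h (outReachList G I y) (outReachList_lt (G := G) (v := y) h)
        have hLlen := hLsub.length_le
        have hLc' : Computes (pruneP G I (outReachList G I y) (outReachList G I y)) L
            (nodeCost B) :=
          Computes.toNode (hLc.mono (loop_cost hB (outReachList_lt h))) hB (by omega)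
        have hLex : ∀ S, Compatible G W U S → ¬ IsSink G (W \ S) x →
            ∃ s ∈ L, IsSink G (W \ S) s := fun S hS hxS =>
          hLQ _ (fun s hs t _ hst ht =>
            hS.1.isSink_of_outs_subset_outs ht (hUW ((hmem s).1 hs).mem) hst) (hex S hS hxS)
        refine .bind hLc' ?_
        rcases L with _ | ⟨s₁, _ | ⟨s₂, _ | ⟨s₃, L⟩⟩⟩
        · refine .bind (.pure _ 0) (.pure ⟨hattx, fun S hS => ?_⟩ ?_)
          · by_cases hxS : IsSink G (W \ S) x
            · exact hcompx S hS hxS (by simp)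
            · obtain ⟨s, hs, _⟩ := hLex S hS hxS
              simp at hs
          · have := timeBound_budget hbx
              (pow_le_pow_right₀ one_le_base (hR.measureAfter_le hx))
            push_cast
            linarith
        · have h₁ := (hmem s₁).1 (hLsub.subset (by simp))
          obtain ⟨a₁, c₁, hc₁, hatt₁, hcomp₁, hb₁⟩ := sink_branch ih h hm h₁.mem []
          simp only [List.foldlM_cons, List.foldlM_nil]
          refine .bind (.bind (survivor_loop_body h h₁.mem hnil hc₁) (.pure _ 0))
            (.pure ⟨hattx.min hatt₁, fun S hS => ?_⟩ ?_)
          · by_cases hxS : IsSink G (W \ S) x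
            · exact min_le_of_left_le (hcompx S hS hxS (by simp))
            · obtain ⟨s, hs, hsS⟩ := hLex S hS hxS
              obtain rfl : s = s₁ := by simpa using hs
              exact min_le_of_right_le (hcomp₁ S hS hsS (by simp))
          · have := timeBound_budget (B := B) (m := m) (t := cx + c₁) (by
              rw [mul_add]
              exact add_le_add hbx hb₁) (h₁.branch hR hx)
            push_cast
            linarith
        · have h₁ := (hmem s₁).1 (hLsub.subset (by simp))
          have h₂ := (hmem s₂).1 (hLsub.subset (by simp))
          -- `R⁺(y)` has at most two elements here, so two survivors mean that nothing was removed
          -- and neither dominates the other.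
          have hlen2 : [s₁, s₂].length = (outReachList G I y).length := by
            simp only [List.length_cons, List.length_nil] at hLlen ⊢
            omega
          have hLeq := hLsub.eq_of_length hlen2
          have h12 : s₁ ≠ s₂ := by
            rw [← hLeq] at hnd
            simpa using hnd
          have hdom := hLfull hlen2
          rw [← hLeq] at hdom
          obtain ⟨a₁, c₁, hc₁, hatt₁, hcomp₁, hb₁⟩ := sink_branch ih h hm h₁.mem []
          obtain ⟨a₂, c₂, hc₂, hatt₂, hcomp₂, hb₂⟩ := sink_branch ih h hm h₂.mem [s₁]
          simp only [List.foldlM_cons, List.foldlM_nil]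
          refine .bind (.bind (survivor_loop_body h h₁.mem hnil hc₁)
            (.bind (survivor_loop_body h h₂.mem (by simpa using hB) hc₂) (.pure _ 0)))
            (.pure ⟨(hattx.min hatt₁).min hatt₂, fun S hS => ?_⟩ ?_)
          · by_cases hxS : IsSink G (W \ S) x
            · exact min_le_of_left_le (min_le_of_left_le (hcompx S hS hxS (by simp)))
            · by_cases h1S : IsSink G (W \ S) s₁
              · exact min_le_of_left_le (min_le_of_right_le (hcomp₁ S hS h1S (by simp)))
              · obtain ⟨s, hs, hsS⟩ := hLex S hS hxS
                have hss : s = s₁ ∨ s = s₂ := by simpa using hs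
                obtain rfl := hss.resolve_left fun e => h1S (e ▸ hsS)
                exact min_le_of_right_le (hcomp₂ S hS hsS (by simpa using h1S))
          · have hbr := branch_two_survivor hR hx hne (fun s hs hsU => by
                have := (hmem s).2 ⟨hyo, hsU, hs⟩
                rw [← hLeq] at this
                simpa using this) h₁ h₂ h12
              (hdom s₁ (by simp) (by simp) s₂ (by simp) h12.symm)
              (hdom s₂ (by simp) (by simp) s₁ (by simp) h12)
            have := timeBound_budget (B := B) (m := m) (t := cx + c₁ + c₂) (by
              rw [mul_add, mul_add]
              exact add_le_add (add_le_add hbx hb₁) hb₂) hbr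
            push_cast
            linarith
        · simp only [List.length_cons] at hLlen
          omega
      · rename_i hn
        -- `x` maximizes the number of undecided neighbours and has none.
        have hind : ∀ u ∈ U, ∀ w ∈ U, ¬ Arc G u w := fun v hv w hw a => by
          have h1 := hmax v hv
          have h2 := Finset.card_pos.2 ⟨w, mem_undNbrs.2 ⟨hw, .inl a⟩⟩
          have hn' : ¬ 1 ≤ (undNbrs G U x).card := hn
          omega
        cases hL : outReachList G I y with
        | nil =>
          refine .pure ⟨hattx, fun S hS => ?_⟩ ?_
          · by_cases hxS : IsSink G (W \ S) x
            · exact hcompx S hS hxS (by simp)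
            · obtain ⟨s, hs, _⟩ := hex S hS hxS
              simp [hL] at hs
          · have := timeBound_budget hbx
              (pow_le_pow_right₀ one_le_base (hR.measureAfter_le hx))
            linarith
        | cons s l' =>
          have h₁ := (hmem s).1 (by simp [hL])
          obtain ⟨a₁, c₁, hc₁, hatt₁, hcomp₁, hb₁⟩ := sink_branch ih h hm h₁.mem []
          refine .bind ((updateSinkP_pow h (hUW h₁.mem) hnil).toNode hB (by omega)) ?_
          refine .bind ((outDegP_pow h s).toNode hB (by omega)) ?_
          refine .bind hc₁ (.bind ((Computes.tick_pow 0 hB).toNode hB (by omega))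
            (.pure ⟨hattx.min hatt₁, fun S hS => ?_⟩ ?_))
          · by_cases hxS : IsSink G (W \ S) x
            · exact min_le_of_left_le (hcompx S hS hxS (by simp))
            · exact min_le_of_right_le (hcomp₁ S hS
                (hS.isSink_of_independent hR hx hind h₁ hy hxS) (by simp))
          · have := timeBound_budget (B := B) (m := m) (t := cx + c₁) (by
              rw [mul_add]
              exact add_le_add hbx hb₁) (h₁.branch hR hx)
            linarith

theorem solvedBelow (m : ℕ) : SolvedBelow G B m := by
  induction m with
  | zero => exact fun I _ h => absurd h (Nat.not_lt_zero _)
  | succ m ih => exact solvedBelow_succ ih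

end KFVD

namespace KFVD

/-! ## Knot-free deletion sets -/

section Knots

variable {V : Type} [Fintype V] [DecidableEq V] {G : Digraph V} {S : Finset V}

theorem reaches_of_reach {u v : {v : V // v ∉ S}} (h : (G.deleteVertices S).Reach u v) :
    Reaches G (Finset.univ \ S) v u := by
  induction h using Relation.ReflTransGen.head_induction_on with
  | refl => exact .refl (by simp [v.2])
  | @head a c hac _ ih =>
    -- Steps along loops are dropped.
    by_cases e : (a : V) = c
    · rwa [e]
    · exact .step (by simp [a.2]) ⟨e, hac⟩ ih

theorem reach_of_reaches {u v : V} (h : Reaches G (Finset.univ \ S) v u) :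
    ∀ (hu : u ∉ S) (hv : v ∉ S), (G.deleteVertices S).Reach ⟨u, hu⟩ ⟨v, hv⟩ := by
  induction h with
  | refl h => exact fun _ _ => .refl
  | @step u w hu a hw ih =>
    intro hu hv
    have hw' : w ∉ S := (Finset.mem_sdiff.1 hw.mem_left).2
    have hadj : (G.deleteVertices S).Adj ⟨u, hu⟩ ⟨w, hw'⟩ := a.2
    exact .head hadj (ih hw' hv)

/-- From every vertex of a finite digraph one can reach a vertex that is reachable from all
vertices it reaches. -/
theorem exists_terminal {X : Type} [Finite X] (H : Digraph X) (u : X) :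
    ∃ v, H.Reach u v ∧ ∀ q, H.Reach v q → H.Reach q v := by
  classical
  obtain ⟨v, hv, hmin⟩ := Set.exists_min_image {w | H.Reach u w}
    (fun w => {q | H.Reach w q}.ncard) (Set.toFinite _) ⟨u, .refl⟩
  refine ⟨v, hv, fun q hq => ?_⟩
  have hsub : {r | H.Reach q r} ⊆ {r | H.Reach v r} := fun r hr => hq.trans hr
  have heq := Set.eq_of_subset_of_ncard_le hsub (hmin q (hv.trans hq)) (Set.toFinite _)
  have : v ∈ {r | H.Reach v r} := .refl
  rwa [← heq] at this

/-- The strong component of a terminal vertex is closed under arcs, so without knots it is a single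
vertex, a sink. Conversely, a sink reached from a knot lies in the knot, and since it must reach the
whole knot, the knot would be a single vertex. -/
theorem isKnotFreeDeletionSet_iff : G.IsKnotFreeDeletionSet S ↔ Sol G Finset.univ S := by
  constructor
  · refine fun h => ⟨Finset.subset_univ _, fun u hu => ?_⟩
    have huS : u ∉ S := (Finset.mem_sdiff.1 hu).2
    obtain ⟨v, huv, hv⟩ := exists_terminal (G.deleteVertices S) ⟨u, huS⟩
    refine ⟨v, ⟨by simp [v.2], fun w hw a => ?_⟩, reaches_of_reach huv⟩
    have hwS : w ∉ S := (Finset.mem_sdiff.1 hw).2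
    have hvw : (G.deleteVertices S).Reach v ⟨w, hwS⟩ := .single a.2
    refine h {q | (G.deleteVertices S).Reach v q ∧ (G.deleteVertices S).Reach q v}
      ⟨⟨v, rfl⟩, ⟨v, ⟨.refl, .refl⟩, ⟨w, hwS⟩, ⟨hvw, hv _ hvw⟩, fun e => a.ne (by rw [e])⟩,
        fun p hp q hpq => ?_⟩
    have hvq := hp.1.tail hpq
    exact ⟨hvq, hv q hvq⟩
  · rintro ⟨-, h⟩ K ⟨⟨v, rfl⟩, hnt, hcl⟩
    obtain ⟨z, hz, hvz⟩ := h v (by simp [v.2])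
    have hzS : z ∉ S := (Finset.mem_sdiff.1 hz.1).2
    have hvz' := reach_of_reaches hvz v.2 hzS
    have hK : ∀ q, (G.deleteVertices S).Reach v q → (G.deleteVertices S).Reach q v :=
      fun q hq => by
        have : q ∈ {w | (G.deleteVertices S).Reach v w ∧ (G.deleteVertices S).Reach w v} := by
          unfold Digraph.Reach at hq
          induction hq with
          | refl => exact ⟨.refl, .refl⟩
          | tail _ hpq ih => exact hcl _ ih _ hpq
        exact this.2
    have honly : ∀ q, (G.deleteVertices S).Reach v q → q = ⟨z, hzS⟩ := fun q hq => by
      have h1 : (G.deleteVertices S).Reach ⟨z, hzS⟩ q := (hK _ hvz').trans hq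
      exact Subtype.ext ((reaches_of_reach h1).eq_of_isSink hz).symm
    obtain ⟨p, hp, q, hq, hpq⟩ := hnt
    exact hpq ((honly p hp.1).trans (honly q hq.1).symm)

end Knots

end KFVD

/-! ### The bound for the whole algorithm -/

theorem mainTheorem1 :
    ∃ (C : ℝ) (k : ℕ), ∀ (n : ℕ) (G : Digraph (Fin n)) [DecidableRel G.Adj],
      ∃ opt time : ℕ,
        (KFVD.solve G).run 0 = some (opt, time) ∧
        IsLeast {m : ℕ | ∃ S : Finset (Fin n), G.IsKnotFreeDeletionSet S ∧ S.card = m} opt ∧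
        (time : ℝ) ≤ C * ((n : ℝ) + 1) ^ k * (1.4549 : ℝ) ^ n := by
  -- The time bound is applied with `B = 2n + 2` and `m = 4n + 1`: the factor `64 (2n + 2)^24 (4n +
  -- 1)` is at most `64 · 2^24 · 4 · (n + 1)^25`.
  refine ⟨64 * 2 ^ 24 * 4, 25, fun n G _ => ?_⟩
  set I : KFVD.Inst (Fin n) := ⟨List.finRange n, []⟩ with hI
  have hverts : I.verts = List.finRange n := by simp [KFVD.Inst.verts, hI]
  have hW : I.vertSet = Finset.univ := by
    ext v
    simp [KFVD.Inst.mem_vertSet, hverts]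
  have hU : I.undSet = Finset.univ := by
    ext v
    simp [KFVD.Inst.mem_undSet, hI]
  have hfits : I.Fits (2 * n + 2) := ⟨by rw [hverts]; exact List.nodup_finRange n, by simp [hverts]⟩
  have hweight : I.weight < 4 * n + 1 := by
    simp only [KFVD.Inst.weight, hU, hW, Finset.card_univ, Fintype.card_fin]
    omega
  obtain ⟨opt, c, hc, ⟨⟨S, hS, hSopt⟩, hcomp⟩, hb⟩ :=
    KFVD.solvedBelow (G := G) (4 * n + 1) I hfits hweight
  obtain ⟨time, hrun, htime⟩ := hc 0
  rw [hW] at hS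
  rw [hW, hU] at hcomp hb
  refine ⟨opt, time, hrun, ?_, ?_⟩
  · obtain ⟨S₀, hS₀, hmin⟩ := Set.exists_min_image {S | KFVD.Sol G Finset.univ S} Finset.card
      (Set.toFinite _) ⟨S, hS⟩
    -- All vertices are undecided at the start, so every minimum solution is compatible.
    have hle := hcomp S₀ ⟨⟨hS₀, hmin⟩, fun z _ => .inl (Finset.mem_univ z)⟩
    have hS₀S := hmin S hS
    refine ⟨⟨S, KFVD.isKnotFreeDeletionSet_iff.2 hS, by omega⟩, ?_⟩
    rintro _ ⟨S', hS', rfl⟩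
    exact hle.trans (hmin S' (KFVD.isKnotFreeDeletionSet_iff.1 hS'))
  · have hM : KFVD.measure G (Finset.univ : Finset (Fin n)) Finset.univ ≤ 4 * n := by
      have := KFVD.measure_add (G := G) (subset_refl (Finset.univ : Finset (Fin n)))
      simp only [Finset.card_univ, Fintype.card_fin] at this
      omega
    have h1 : KFVD.base ^ KFVD.measure G (Finset.univ : Finset (Fin n)) Finset.univ ≤
        (1.4549 : ℝ) ^ n :=
      calc _ ≤ KFVD.base ^ (4 * n) := pow_le_pow_right₀ KFVD.one_le_base hM
        _ = (KFVD.base ^ 4) ^ n := pow_mul _ _ _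
        _ ≤ _ := pow_le_pow_left₀ (pow_pos KFVD.base_pos 4).le KFVD.base_pow_four n
    have h2 : (time : ℝ) ≤ c := by exact_mod_cast (by omega : time ≤ c)
    have hn : (0 : ℝ) ≤ n := Nat.cast_nonneg n
    calc (time : ℝ) ≤ 64 * (2 * (n : ℝ) + 2) ^ 24 * (4 * n + 1) *
          KFVD.base ^ KFVD.measure G (Finset.univ : Finset (Fin n)) Finset.univ := by
          refine h2.trans (hb.trans_eq ?_)
          simp only [KFVD.timeBound, KFVD.nodeCost]
          push_cast
          ring
      _ ≤ 64 * (2 * (n : ℝ) + 2) ^ 24 * (4 * (n + 1)) * (1.4549 : ℝ) ^ n := by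
          have h3 : (4 * n + 1 : ℝ) ≤ 4 * (n + 1) := by linarith
          exact mul_le_mul (mul_le_mul_of_nonneg_left h3 (by positivity)) h1
            (pow_pos KFVD.base_pos _).le (by positivity)
      _ = 64 * 2 ^ 24 * 4 * ((n : ℝ) + 1) ^ 25 * (1.4549 : ℝ) ^ n := by
          rw [show 2 * (n : ℝ) + 2 = 2 * (n + 1) by ring, mul_pow]
          ring
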